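/- Let $0<\omega<\alpha$, let $\mathbb S$ be the circle $[-\pi,\pi]$ with $-\pi,\pi$ identified, and let $\mathcal E^*_\omega$ be the set of exceptional energies, i.e. those $E\in\mathbb R$ with $2E=(2n+1)\omega+(r+\frac12)^2$ or $E=(n+\frac12)\omega$ for some $n\in\mathbb N=\{0,1,2,\dots\}$, $r\in\mathbb Z$. For $E\notin\mathcal E^*_\omega$ put $$v_n(x,E)=\rho_n(E)\cos\bigl(k_n(E)(|x|-\pi)\bigr),\quad k_n(E)=\sqrt{2E-(2n+1)\omega},\quad \rho_n(E)=\Bigl(\pi+\tfrac{\sin(2k_n(E)\pi)}{2k_n(E)}\Bigr)^{-1/2}$$ (hyperbolic functions replacing circular ones when $k_n$ is imaginary), and let $\theta=\arccos(-\omega/\alpha)$, $\lambda=\frac1{2\sqrt{\alpha^2-\omega^2}}$. A sequence $u_n(x,E)=C(n,E)v_n(x,E)$, $n\ge0$, satisfies the matching conditions $$u_n'(0+)-u_n'(0-)=2\alpha(2\omega)^{-1/2}\bigl(\sqrt{n+1}\,u_{n+1}(0)+\sqrt n\,u_{n-1}(0)\bigr)\qquad(n\ge0,\ \text{last term } 0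 \text{ for } n=0)$$ if and only if $$\alpha\sqrt{n+2}\,v_{n+2}(0,E)C(n+2)-\sqrt{2\omega}\,v_{n+1}'(0+,E)C(n+1)+\alpha\sqrt{n+1}\,v_n(0,E)C(n)=0\quad(n\ge0)\qquad(\ast)$$ and $\alpha v_1(0,E)C(1)=\sqrt{2\omega}\,v_0'(0+,E)C(0)$. Then: (a) For every $E\notin\mathcal E^*_\omega$ there is a unique complex solution $C^\star_+(\cdot,E)$ of $(\ast)$ with $C^\star_+(n,E)=n^{-1/2}e^{in\theta-i\lambda E\log n}+O(n^{-3/2})$ as $n\to\infty$, and a unique $Z(E)\in\mathbb C$ with $\mathrm{Re}\{Z(E)C^\star_+(0,E)\}=1$ and $\alpha v_1(0,E)\,\mathrm{Re}\{Z(E)C^\star_+(1,E)\}=\sqrt{2\omega}\,v_0'(0+,E)$. With $C(n,E)=C(0,E)\,\mathrm{Re}\{Z(E)C^\star_+(n,E)\}$, where $C(0,E)$ is fixed by $C(0,E)|Z(E)|=(\pi\sqrt{\alpha^2-\omega^2})^{-1/2}$, the sequence $u_n(x,E)=C(n,E)v_n(x,E)$ is a formal eigenfunction: it is not identically zero, each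 $u_n(\cdot,E)$ is even, continuous and $C^1$-periodic on $\mathbb S$, $-\frac12u_n''+(n+\frac12)\omega u_n=Eu_n$ on $\mathbb S\setminus\{0\}$, and the matching conditions hold. (b) For all $\Psi,\Phi\in C_0(\mathbb R\setminus\mathcal E^*_\omega)$ (complex-valued continuous functions on $\mathbb R$ with compact support disjoint from $\mathcal E^*_\omega$), all integrals below exist, the series converges absolutely, and $$\sum_{n=0}^\infty\iint_{\mathbb R^2}dE_1\,dE_2\;\bar\Psi(E_1)\Phi(E_2)\int_{\mathbb S}dx\;u_n(x,E_1)u_n(x,E_2)=\int_{\mathbb R}dE\;\bar\Psi(E)\Phi(E).$$ (c) For $\Psi\in C_0(\mathbb R\setminus\mathcal E^*_\omega)$ the integrals $\psi_n(x)=\int_{\mathbb R}\Psi(E)u_n(x,E)\,dE$ exist, and the map $\imath:\Psi\mapsto\{\psi_n\}_{n\ge0}$ extends to a unique linear isometry of $L^2(\mathbb R)$ into $\ell^2(\mathbb N)\otimes L^2_+(\mathbb S)=\ell^2(\mathbb N;L^2_+(\mathbb S))$, where $L^2_+(\mathbb S)$ is the space of even functions in $L^2(\mathbb S)$. -/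

import Mathlib

open MeasureTheory Filter Asymptotics
open scoped Topology ENNReal ComplexConjugate

noncomputable section

namespace Smilansky

/-- Exceptional energies: those with `2E = (2n+1)ω + (r+1/2)²` for some `n ≥ 0`, `r ∈ ℤ`
(where some `v_n(0,E)` vanishes), together with the thresholds `(n+1/2)ω`. -/
def exceptional (ω : ℝ) : Set ℝ :=
  {E | ∃ (n : ℕ) (r : ℤ), 2 * E = (2 * n + 1) * ω + ((r : ℝ) + 1 / 2) ^ 2} ∪
    {E | ∃ n : ℕ, E = ((n : ℝ) + 1 / 2) * ω}

/-- `2E - (2n+1)ω`, the square of the wave number `k_n(E)`. -/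
def kSq (ω : ℝ) (n : ℕ) (E : ℝ) : ℝ := 2 * E - (2 * n + 1) * ω

/-- The normalized even solution of `L_n v = E v`, i.e. `ρ_n cos (k_n (|x| - π))` with
`ρ_n = (π + sin (2 k_n π) / (2 k_n))^(-1/2)`. For imaginary `k_n = i χ_n` it is written with
hyperbolic functions. (The value at the threshold `k_n = 0`, an exceptional energy, is
irrelevant.) -/
def v (ω : ℝ) (n : ℕ) (x E : ℝ) : ℝ :=
  if 0 ≤ kSq ω n E then
    (Real.pi + Real.sin (2 * √(kSq ω n E) * Real.pi) / (2 * √(kSq ω n E))) ^ (-(1 / 2) : ℝ) *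
      Real.cos (√(kSq ω n E) * (|x| - Real.pi))
  else
    (Real.pi + Real.sinh (2 * √(-kSq ω n E) * Real.pi) / (2 * √(-kSq ω n E))) ^ (-(1 / 2) : ℝ) *
      Real.cosh (√(-kSq ω n E) * (|x| - Real.pi))

/-- The right derivative `v_n'(0+, E)`. -/
def vPrime (ω : ℝ) (n : ℕ) (E : ℝ) : ℝ := derivWithin (fun x => v ω n x E) (Set.Ici 0) 0

/-- The difference equation for the coefficients `C(n,E)`, `n ≥ 0`, which the matching conditions
impose on `C(n,E) v_n(x,E)` at the levels `n + 1`. -/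
def SolvesRecursion (α ω E : ℝ) (D : ℕ → ℂ) : Prop :=
  ∀ n : ℕ, ((α * √((n : ℝ) + 2) * v ω (n + 2) 0 E : ℝ) : ℂ) * D (n + 2)
    - ((√(2 * ω) * vPrime ω (n + 1) E : ℝ) : ℂ) * D (n + 1)
    + ((α * √((n : ℝ) + 1) * v ω n 0 E : ℝ) : ℂ) * D n = 0

/-- The angle in the asymptotics of the normal solutions. -/
def theta (α ω : ℝ) : ℝ := Real.arccos (-(ω / α))

/-- The logarithmic rate in the asymptotics of the normal solutions. -/
def lam (α ω : ℝ) : ℝ := 1 / (2 * √(α ^ 2 - ω ^ 2))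

/-- `D` is the normal solution `C⋆₊(·,E)`: it solves the difference equation and
`D n = n^(-1/2) exp (i n θ - i λ E log n) + O(n^(-3/2))`. -/
def IsNormalSolution (α ω E : ℝ) (D : ℕ → ℂ) : Prop :=
  SolvesRecursion α ω E D ∧
    (fun n : ℕ => D n - (((n : ℝ) ^ (-(1 / 2) : ℝ) : ℝ) : ℂ) *
        Complex.exp (Complex.I * ((n * theta α ω - lam α ω * E * Real.log n : ℝ) : ℂ)))
      =O[atTop] fun n : ℕ => (n : ℝ) ^ (-(3 / 2) : ℝ)

/-- The normal solution `C⋆₊(n,E)`; its existence and uniqueness is part of the theorem. -/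
def normalSolution (α ω E : ℝ) : ℕ → ℂ := Classical.epsilon (IsNormalSolution α ω E)

/-- The equations for the complex amplitude `Z(E)`: `n ↦ Re (Z C⋆₊(n,E))` has value `1` at `0` and
satisfies the initial condition (the matching condition at level `0`). -/
def IsAmplitude (α ω E : ℝ) (Z : ℂ) : Prop :=
  (Z * normalSolution α ω E 0).re = 1 ∧
    α * v ω 1 0 E * (Z * normalSolution α ω E 1).re = √(2 * ω) * vPrime ω 0 E

/-- The amplitude `Z(E)`; its existence and uniqueness is part of the theorem. -/
def Z (α ω E : ℝ) : ℂ := Classical.epsilon (IsAmplitude α ω E)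

/-- The normalization factor `C(0,E)`, fixed by `C(0,E) |Z(E)| = (π √(α² - ω²))^(-1/2)`. -/
def normFactor (α ω E : ℝ) : ℝ := (Real.pi * √(α ^ 2 - ω ^ 2)) ^ (-(1 / 2) : ℝ) / ‖Z α ω E‖

/-- The coefficients `C(n,E) = C(0,E) Re (Z(E) C⋆₊(n,E))`. -/
def coeff (α ω : ℝ) (n : ℕ) (E : ℝ) : ℝ :=
  normFactor α ω E * (Z α ω E * normalSolution α ω E n).re

/-- The components `u_n(x,E) = C(n,E) v_n(x,E)` of the formal eigenfunction. -/
def u (α ω : ℝ) (n : ℕ) (x E : ℝ) : ℝ := coeff α ω n E * v ω n x E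

/-- `w = (w_n)` is a formal eigenfunction of the Hamiltonian at energy `E`, even with respect to
the interaction point `0` of the circle `[-π, π]` (with `-π`, `π` identified): each `w_n` is even,
is continuous and periodic, satisfies `-(1/2) w_n'' + (n+1/2) ω w_n = E w_n` away from `0`, and
the `w_n` satisfy the matching conditions at `0` (where for `n = 0` the last term is zero). -/
structure IsFormalEigenfunction (α ω E : ℝ) (w : ℕ → ℝ → ℝ) : Prop where
  ne_zero : ∃ n, ∃ x ∈ Set.Icc (-Real.pi) Real.pi, w n x ≠ 0
  even : ∀ n x, w n (-x) = w n x
  continuousOn : ∀ n, ContinuousOn (w n) (Set.Icc (-Real.pi) Real.pi)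
  eq_pi : ∀ n, w n Real.pi = w n (-Real.pi)
  deriv_pi : ∀ n, ∃ d, HasDerivWithinAt (w n) d (Set.Iic Real.pi) Real.pi ∧
    HasDerivWithinAt (w n) d (Set.Ici (-Real.pi)) (-Real.pi)
  diff : ∀ n, ∀ x ∈ Set.Ioo (-Real.pi) Real.pi, x ≠ 0 → DifferentiableAt ℝ (w n) x
  diff_deriv : ∀ n, ∀ x ∈ Set.Ioo (-Real.pi) Real.pi, x ≠ 0 → DifferentiableAt ℝ (deriv (w n)) x
  eigen : ∀ n : ℕ, ∀ x ∈ Set.Ioo (-Real.pi) Real.pi, x ≠ 0 →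
    -(1 / 2) * deriv (deriv (w n)) x + ((n : ℝ) + 1 / 2) * ω * w n x = E * w n x
  matching : ∀ n : ℕ, ∃ dr dl, HasDerivWithinAt (w n) dr (Set.Ici 0) 0 ∧
    HasDerivWithinAt (w n) dl (Set.Iic 0) 0 ∧
    dr - dl = 2 * α * (2 * ω) ^ (-(1 / 2) : ℝ) *
      (√((n : ℝ) + 1) * w (n + 1) 0 + if n = 0 then 0 else √(n : ℝ) * w (n - 1) 0)

/-- `C_0(ℝ ∖ E*)`: continuous, compactly supported, no exceptional energy in the support. -/
structure Admissible (ω : ℝ) (Ψ : ℝ → ℂ) : Prop where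
  continuous : Continuous Ψ
  hasCompactSupport : HasCompactSupport Ψ
  disjoint : Disjoint (tsupport Ψ) (exceptional ω)

theorem Admissible.memLp {ω : ℝ} {Ψ : ℝ → ℂ} (h : Admissible ω Ψ) : MemLp Ψ 2 volume :=
  h.continuous.memLp_of_hasCompactSupport h.hasCompactSupport

/-- Lebesgue measure on the circle, in the coordinate `x ∈ [-π, π]`. -/
def circleMeasure : Measure ℝ := volume.restrict (Set.Icc (-Real.pi) Real.pi)

/-- `L²₊(𝕊)`: the square-integrable functions on the circle that are invariant under `x ↦ -x`. -/
def L2Even : Submodule ℂ (Lp ℂ 2 circleMeasure) where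
  carrier := {f | ∃ g : ℝ → ℂ, (∀ x, g (-x) = g x) ∧ f =ᵐ[circleMeasure] g}
  zero_mem' := ⟨fun _ => 0, fun _ => rfl, Lp.coeFn_zero ℂ 2 circleMeasure⟩
  add_mem' := by
    rintro f₁ f₂ ⟨g₁, h₁, e₁⟩ ⟨g₂, h₂, e₂⟩
    exact ⟨fun x => g₁ x + g₂ x, fun x => by simp [h₁, h₂],
      (Lp.coeFn_add f₁ f₂).trans (e₁.add e₂)⟩
  smul_mem' := by
    rintro c f ⟨g, h, e⟩
    exact ⟨fun x => c * g x, fun x => by simp [h], (Lp.coeFn_smul c f).trans (e.const_smul c)⟩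

/-- `P_n(E₁,E₂)`, the scalar product of `u_n(·,E₁)` and `u_n(·,E₂)` in `L²(𝕊)`. -/
def P (α ω : ℝ) (n : ℕ) (E₁ E₂ : ℝ) : ℝ := ∫ x, u α ω n x E₁ * u α ω n x E₂ ∂circleMeasure

end Smilansky

end

/-! Put y_n = u_n(0,E). The matching conditions become the three-term recursion √(n+2) y_{n+2} +
√(n+1) y_n = b_{n+1} y_{n+1}, whose coefficients depend only on v_n'(0+)/v_n(0) (`jacobiCoeff`). At
high levels v_n is a hyperbolic cosine, so this quotient is -χ_n up to an exponentially small error,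
with χ_n² = (2n+1)ω - 2E. Expanding the root gives b_n = √n (2 cos θ + (cos θ/2 + 2λE sin θ)/n +
O(n⁻²)) (`exists_coeffBound`), exactly what is needed for n^(-1/4) exp(i(nθ - λE log n)) to solve
the recursion with a small defect (`norm_defect_le`).

The Wronskian of a real solution with this profile has increments O(n⁻²) relative to its size, so it
converges with rate 1/n to a Jost coefficient Λ, and the solution equals -Im(Λ conj(profile))/sin θ
+ O(n^(-5/4)), uniformly for E in compact sets of non-exceptional energies (`exists_uniform_jost`).
Two real solutions are used: `regSol`, which satisfies the condition at level 0, and `auxSol`. Their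
constant Wronskian becomes Im(Λ₁ conj Λ₂) = sin θ ≠ 0 (`im_regJost_mul_conj_auxJost`). This
nondegeneracy makes C⋆₊ and Z explicit in terms of Λ₁, Λ₂ and unique, which is part (a).

For the normalization, Green's formula on each level and the matching conditions telescope into a
Christoffel–Darboux formula for the partial sums K_N of the P_n (`sub_mul_partialKernel`). With the
asymptotics it yields (x-y) K_N(x,y) = Im(φ(x) conj φ(y) e^{iL(x-y)})/π + O(1/N), where L = λ log N
and φ is a continuous unimodular phase (`exists_kernel_asymptotics`). The factor 1/π is the effect
of the prescribed C(0,E)|Z(E)| (`amp_sq`). Division by x-y is harmful only near the diagonal; there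
1/t is replaced by t/(t²+δ²) with δ = N^(-1/2), and the crude bound K_N = O(log N)
(`exists_partialKernel_bound`) suffices because the affected region has mass O(δ).

The regularized kernel e^{iLt} t/(t²+δ²) tends to iπ times the delta function when L → ∞ and δL → 0
(`tendsto_integral_regularized_kernel`): in Fourier space its quadratic form compares the spectral
mass above L with the mass below L. Hence the norm identity holds for a single Ψ
(`Admissible.tendsto_integral_partialKernel`). The map Ψ ↦ (ψ_n) is therefore isometric on
admissible functions, which are dense because the exceptional set is closed and countable. The
extension to L² is an isometry, isometries preserve inner products, and so the case of two different
functions Ψ, Φ in (b) comes for free. -/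

namespace Smilansky

/-! ### Fourier analysis: the limit of the regularized kernel e^{iLt} t/(t²+δ²). -/

section Fourier

open FourierTransform SchwartzMap
open scoped ContDiff

/-- The `L²` Fourier transform of a function in `L¹ ∩ L²` is given by the Fourier integral. -/
theorem fourier_toLp_ae_eq {f : ℝ → ℂ} (h1 : Integrable f) (h2 : MemLp f 2) :
    (𝓕 (h2.toLp f) : Lp ℂ 2 (volume : Measure ℝ)) =ᵐ[volume] 𝓕 f := by
  have hcont : Continuous (𝓕 f) :=
    VectorFourier.fourierIntegral_continuous Real.continuous_fourierChar
      (by fun_prop) h1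
  refine ae_eq_of_integral_contDiff_smul_eq
    ((Lp.memLp _).locallyIntegrable (by norm_num)) hcont.locallyIntegrable ?_
  intro g g_smooth g_cpt
  have hg₁ : HasCompactSupport (Complex.ofRealCLM ∘ g) := g_cpt.comp_left rfl
  have hg₂ : ContDiff ℝ ∞ (Complex.ofRealCLM ∘ g) := by fun_prop
  set G : 𝓢(ℝ, ℂ) := hg₁.toSchwartzMap hg₂ with hG
  have hGx : ∀ x, G x = (g x : ℂ) := fun x => by simp [hG]
  -- Both transforms are tested against g. For the L² transform, duality of tempered distributions
  -- moves 𝓕 onto g; for the Fourier integral this is the multiplication formula used below.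
  have e1 : ∫ x, g x • (𝓕 (h2.toLp f) : Lp ℂ 2 (volume : Measure ℝ)) x
      = ∫ x, (𝓕 G : 𝓢(ℝ, ℂ)) x • f x := by
    have := congrArg (fun T => T G)
      (Lp.fourier_toTemperedDistribution_eq (E := ℝ) (F := ℂ) (h2.toLp f))
    simp only [TemperedDistribution.fourier_apply, Lp.toTemperedDistribution_apply] at this
    rw [show (∫ x, g x • (𝓕 (h2.toLp f) : Lp ℂ 2 (volume : Measure ℝ)) x)
      = ∫ x, G x • (𝓕 (h2.toLp f) : Lp ℂ 2 (volume : Measure ℝ)) x by simp [hGx], ← this]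
    refine integral_congr_ae ?_
    filter_upwards [h2.coeFn_toLp] with x hx
    rw [hx]
  rw [e1]
  have := VectorFourier.integral_fourierIntegral_smul_eq_flip (μ := (volume : Measure ℝ))
    (ν := (volume : Measure ℝ)) (e := Real.fourierChar) (L := innerₗ ℝ)
    Real.continuous_fourierChar (by fun_prop) G.integrable h1
  rw [flip_innerₗ] at this
  calc _ = ∫ x, G x • 𝓕 f x := this
    _ = _ := by simp [hGx]

theorem fourier_sq_plancherel {f : ℝ → ℂ} (h1 : Integrable f) (h2 : MemLp f 2) :
    Integrable (fun ξ => ‖𝓕 f ξ‖ ^ 2) ∧ ∫ ξ, ‖𝓕 f ξ‖ ^ 2 = ∫ x, ‖f x‖ ^ 2 := by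
  have hae := fourier_toLp_ae_eq h1 h2
  have hm : MemLp (𝓕 f) 2 := (memLp_congr_ae hae).1 (Lp.memLp _)
  refine ⟨hm.integrable_norm_pow (by norm_num), ?_⟩
  have hn := Lp.norm_fourier_eq (E := ℝ) (F := ℂ) (h2.toLp f)
  have key : ∀ F : Lp ℂ 2 (volume : Measure ℝ), ‖F‖ ^ 2 = ∫ x, ‖F x‖ ^ 2 := by
    intro F
    have := L2.inner_def (𝕜 := ℂ) F F
    rw [inner_self_eq_norm_sq_to_K] at this
    simp only [inner_self_eq_norm_sq_to_K] at this
    have h := congrArg Complex.re this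
    norm_cast at h
  have h3 := key (𝓕 (h2.toLp f))
  rw [hn, key] at h3
  calc ∫ ξ, ‖𝓕 f ξ‖ ^ 2 = ∫ x, ‖(𝓕 (h2.toLp f) : Lp ℂ 2 (volume : Measure ℝ)) x‖ ^ 2 := by
        refine integral_congr_ae ?_
        filter_upwards [hae] with x hx
        rw [hx]
    _ = ∫ x, ‖(h2.toLp f) x‖ ^ 2 := h3.symm
    _ = _ := by
        refine integral_congr_ae ?_
        filter_upwards [h2.coeFn_toLp] with x hx
        rw [hx]

/-- The spectral density `|∫ f(y) e^{-isy} dy|²`. -/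
noncomputable def specDensity (f : ℝ → ℂ) (s : ℝ) : ℝ := ‖𝓕 f (s / (2 * Real.pi))‖ ^ 2

theorem specDensity_nonneg (f : ℝ → ℂ) (s : ℝ) : 0 ≤ specDensity f s := by
  unfold specDensity; positivity

theorem integrable_specDensity {f : ℝ → ℂ} (h1 : Integrable f) (h2 : MemLp f 2) :
    Integrable (specDensity f) :=
  (fourier_sq_plancherel h1 h2).1.comp_div (by positivity)

theorem integral_specDensity {f : ℝ → ℂ} (h1 : Integrable f) (h2 : MemLp f 2) :
    ∫ s, specDensity f s = 2 * Real.pi * ∫ x, ‖f x‖ ^ 2 := by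
  rw [← (fourier_sq_plancherel h1 h2).2]
  have := Measure.integral_comp_div (fun ξ => ‖𝓕 f ξ‖ ^ 2) (2 * Real.pi)
  rw [abs_of_pos (by positivity), smul_eq_mul] at this
  exact this

/-- The exponential of a difference factors, so the double integral is conj(F) · F for one Fourier
integral F. -/
theorem integral_exp_sesq_eq_specDensity (f : ℝ → ℂ) (s : ℝ) :
    ∫ p : ℝ × ℝ, conj (f p.1) * f p.2 * Complex.exp (Complex.I * (s * (p.1 - p.2) : ℝ))
      = specDensity f s := by
  have e2 : 𝓕 f (s / (2 * Real.pi)) = ∫ y : ℝ, f y * Complex.exp (-(Complex.I * (s * y))) := by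
    rw [Real.fourier_real_eq_integral_exp_smul]
    refine integral_congr_ae (ae_of_all _ fun y => ?_)
    simp only [smul_eq_mul]
    rw [mul_comm]
    congr 2
    have : (Real.pi : ℂ) ≠ 0 := by exact_mod_cast Real.pi_ne_zero
    push_cast
    field_simp
  have e1 : ∫ x : ℝ, conj (f x) * Complex.exp (Complex.I * (s * x))
      = conj (𝓕 f (s / (2 * Real.pi))) := by
    rw [e2, ← integral_conj]
    refine integral_congr_ae (ae_of_all _ fun y => ?_)
    simp [← Complex.exp_conj]
  rw [specDensity, Complex.ofReal_pow, ← Complex.conj_mul', ← e1, e2, Measure.volume_eq_prod,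
    ← integral_prod_mul]
  refine integral_congr_ae (ae_of_all _ fun p => ?_)
  simp only
  rw [mul_mul_mul_comm, ← Complex.exp_add]
  congr 2
  push_cast
  ring

/-- Write 1/(δ - iεt) = ∫₀^∞ exp(-(δ - iεt)s) ds and apply Fubini: each s only shifts the frequency
from L to L + εs, and the inner double integral is a spectral density. The signs ε = ±1 supply the
two halves of the odd kernel. -/
theorem integral_regularized_half {f : ℝ → ℂ} (hf : Continuous f) (hc : HasCompactSupport f)
    (L ε δ : ℝ) (hδ : 0 < δ) :
    ∫ p : ℝ × ℝ, conj (f p.1) * f p.2 * Complex.exp (Complex.I * (L * (p.1 - p.2) : ℝ)) *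
        (1 / (δ - Complex.I * (ε * (p.1 - p.2) : ℝ)))
      = ∫ s in Set.Ioi (0 : ℝ), ((Real.exp (-(δ * s)) * specDensity f (L + ε * s) : ℝ) : ℂ) := by
  have hint : Integrable f := hf.integrable_of_hasCompactSupport hc
  set g : ℝ × ℝ → ℝ → ℂ := fun p s => conj (f p.1) * f p.2 *
    Complex.exp (Complex.I * (L * (p.1 - p.2) : ℝ)) *
      Complex.exp ((-δ + Complex.I * (ε * (p.1 - p.2) : ℝ)) * s) with hg
  have hre : ∀ p : ℝ × ℝ, (-δ + Complex.I * (ε * (p.1 - p.2) : ℝ) : ℂ).re = -δ := by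
    intro p; simp
  have hgi : Integrable (Function.uncurry g)
      ((volume : Measure (ℝ × ℝ)).prod (volume.restrict (Set.Ioi (0 : ℝ)))) := by
    have hF : Integrable (fun p : ℝ × ℝ => ‖f p.1‖ * ‖f p.2‖) := hint.norm.mul_prod hint.norm
    have hE : Integrable (fun s : ℝ => Real.exp (-δ * s)) (volume.restrict (Set.Ioi (0 : ℝ))) :=
      exp_neg_integrableOn_Ioi 0 hδ
    refine (hF.mul_prod hE).mono' ?_ (ae_of_all _ fun z => ?_)
    · refine Continuous.aestronglyMeasurable ?_
      simp only [hg, Function.uncurry_def]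
      fun_prop
    · simp only [hg, Function.uncurry_def, norm_mul, Complex.norm_exp, RCLike.norm_conj]
      simp
  calc _ = ∫ p : ℝ × ℝ, ∫ s in Set.Ioi (0 : ℝ), g p s := by
        refine integral_congr_ae (ae_of_all _ fun p => ?_)
        simp only [hg]
        rw [integral_const_mul, integral_exp_mul_complex_Ioi (by rw [hre]; linarith)]
        congr 1
        rw [Complex.ofReal_zero, mul_zero, Complex.exp_zero, neg_div, ← div_neg]
        congr 1
        ring
    _ = ∫ s in Set.Ioi (0 : ℝ), ∫ p : ℝ × ℝ, g p s := integral_integral_swap hgi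
    _ = _ := by
        refine integral_congr_ae (ae_of_all _ fun s => ?_)
        simp only [hg]
        rw [Complex.ofReal_mul, ← integral_exp_sesq_eq_specDensity, ← integral_const_mul]
        refine integral_congr_ae (ae_of_all _ fun p => ?_)
        simp only
        rw [mul_assoc, ← Complex.exp_add, Complex.ofReal_exp, mul_left_comm, ← Complex.exp_add]
        congr 2
        push_cast
        ring

/-- After translation only the part of h on (L, ∞) is seen, with weights at most 1: the tail of an
integrable function. -/
theorem tendsto_integral_specDensity_right {h : ℝ → ℝ} (h0 : ∀ s, 0 ≤ h s) (hi : Integrable h)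
    {L δ : ℕ → ℝ} (hL : Tendsto L atTop atTop) (hδ : ∀ᶠ n in atTop, 0 < δ n) :
    Tendsto (fun n => ∫ s in Set.Ioi (0 : ℝ), Real.exp (-(δ n * s)) * h (L n + s))
      atTop (𝓝 0) := by
  have key : ∀ n, ∫ s in Set.Ioi (0 : ℝ), Real.exp (-(δ n * s)) * h (L n + s)
      = ∫ u, (Set.Ioi (L n)).indicator (fun u => Real.exp (-(δ n * (u - L n))) * h u) u := by
    intro n
    rw [← integral_indicator measurableSet_Ioi, ← integral_add_left_eq_self
      (fun u => (Set.Ioi (L n)).indicator (fun u => Real.exp (-(δ n * (u - L n))) * h u) u) (L n)]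
    refine integral_congr_ae (ae_of_all _ fun s => ?_)
    by_cases hs : 0 < s <;> simp [Set.indicator, hs]
  simp_rw [key]
  rw [← integral_zero ℝ ℝ]
  refine tendsto_integral_filter_of_dominated_convergence h ?_ ?_ hi ?_
  · refine Eventually.of_forall fun n => ?_
    refine AEStronglyMeasurable.indicator ?_ measurableSet_Ioi
    exact (Continuous.aestronglyMeasurable (by fun_prop)).mul hi.1
  · filter_upwards [hδ] with n hn
    refine ae_of_all _ fun u => ?_
    by_cases hu : L n < u
    · simp only [Set.indicator, Set.mem_Ioi, hu, if_true, norm_mul, Real.norm_eq_abs,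
        Real.abs_exp, abs_of_nonneg (h0 u)]
      refine mul_le_of_le_one_left (h0 u) (Real.exp_le_one_iff.2 ?_)
      have := mul_pos hn (sub_pos.2 hu)
      linarith
    · simp [Set.indicator, hu, h0 u]
  · refine ae_of_all _ fun u => tendsto_const_nhds.congr' ?_
    filter_upwards [hL.eventually_ge_atTop u] with n hn
    simp [Set.indicator, hn]

/-- After reflection the domain is (-∞, L), which exhausts the line, and the weight is exp(-δ(L-u)).
It tends to 1 at each fixed u because δL → 0, and δ → 0 follows from δL → 0 and L → ∞. -/
theorem tendsto_integral_specDensity_left {h : ℝ → ℝ} (h0 : ∀ s, 0 ≤ h s) (hi : Integrable h)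
    {L δ : ℕ → ℝ} (hL : Tendsto L atTop atTop) (hδ : ∀ᶠ n in atTop, 0 < δ n)
    (hLδ : Tendsto (fun n => δ n * L n) atTop (𝓝 0)) :
    Tendsto (fun n => ∫ s in Set.Ioi (0 : ℝ), Real.exp (-(δ n * s)) * h (L n - s))
      atTop (𝓝 (∫ u, h u)) := by
  have key : ∀ n, ∫ s in Set.Ioi (0 : ℝ), Real.exp (-(δ n * s)) * h (L n - s)
      = ∫ u, (Set.Iio (L n)).indicator (fun u => Real.exp (-(δ n * (L n - u))) * h u) u := by
    intro n
    rw [← integral_indicator measurableSet_Ioi, ← integral_sub_left_eq_self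
      (fun u => (Set.Iio (L n)).indicator (fun u => Real.exp (-(δ n * (L n - u))) * h u) u) _ (L n)]
    refine integral_congr_ae (ae_of_all _ fun s => ?_)
    by_cases hs : 0 < s <;> simp [Set.indicator, hs]
  have hδ0 : Tendsto δ atTop (𝓝 0) := by
    have h1 : Tendsto (fun n => (δ n * L n) * (L n)⁻¹) atTop (𝓝 (0 * 0)) :=
      hLδ.mul (tendsto_inv_atTop_zero.comp hL)
    rw [mul_zero] at h1
    refine h1.congr' ?_
    filter_upwards [hL.eventually_gt_atTop 0] with n hn
    field_simp
  simp_rw [key]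
  refine tendsto_integral_filter_of_dominated_convergence h ?_ ?_ hi ?_
  · refine Eventually.of_forall fun n => ?_
    refine AEStronglyMeasurable.indicator ?_ measurableSet_Iio
    exact (Continuous.aestronglyMeasurable (by fun_prop)).mul hi.1
  · filter_upwards [hδ] with n hn
    refine ae_of_all _ fun u => ?_
    by_cases hu : u < L n
    · simp only [Set.indicator, Set.mem_Iio, hu, if_true, norm_mul, Real.norm_eq_abs,
        Real.abs_exp, abs_of_nonneg (h0 u)]
      refine mul_le_of_le_one_left (h0 u) (Real.exp_le_one_iff.2 ?_)
      have := mul_pos hn (sub_pos.2 hu)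
      linarith
    · simp [Set.indicator, hu, h0 u]
  · refine ae_of_all _ fun u => ?_
    have h1 : Tendsto (fun n => Real.exp (-(δ n * (L n - u))) * h u) atTop (𝓝 (h u)) := by
      have h2 : Tendsto (fun n => -(δ n * L n - δ n * u)) atTop (𝓝 (-(0 - 0 * u))) :=
        (hLδ.sub (hδ0.mul_const u)).neg
      have h3 := ((Real.continuous_exp.tendsto _).comp h2).mul_const (h u)
      simp only [zero_mul, sub_zero, neg_zero, Real.exp_zero, one_mul] at h3
      refine h3.congr fun n => ?_
      simp only [Function.comp_apply]
      congr 2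
      ring
    refine h1.congr' ?_
    filter_upwards [hL.eventually_gt_atTop u] with n hn
    simp [Set.indicator, hn]

/-- The one-sided oscillating kernel `e^{iL(x-y)}/(x-y)`, regularized at scale `δ ≪ 1/L`,
converges to `iπ δ(x-y)`. -/
theorem tendsto_integral_regularized_kernel {f : ℝ → ℂ} (hf : Continuous f)
    (hc : HasCompactSupport f) {L δ : ℕ → ℝ} (hL : Tendsto L atTop atTop)
    (hδ : ∀ᶠ n in atTop, 0 < δ n) (hLδ : Tendsto (fun n => δ n * L n) atTop (𝓝 0)) :
    Tendsto (fun n => ∫ p : ℝ × ℝ, conj (f p.1) * f p.2 *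
        Complex.exp (Complex.I * (L n * (p.1 - p.2) : ℝ)) *
          (((p.1 - p.2) / ((p.1 - p.2) ^ 2 + δ n ^ 2) : ℝ) : ℂ)) atTop
      (𝓝 (Complex.I * Real.pi * ((∫ x, ‖f x‖ ^ 2 : ℝ) : ℂ))) := by
  have h1 : Integrable f := hf.integrable_of_hasCompactSupport hc
  have h2 : MemLp f 2 := hf.memLp_of_hasCompactSupport hc
  have hR := tendsto_integral_specDensity_right (specDensity_nonneg f)
    (integrable_specDensity h1 h2) hL hδ
  have hLf := tendsto_integral_specDensity_left (specDensity_nonneg f)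
    (integrable_specDensity h1 h2) hL hδ hLδ
  rw [integral_specDensity h1 h2] at hLf
  -- The constant comes from the partial fractions t/(t²+δ²) = (2i)⁻¹ (1/(δ-it) - 1/(δ+it)); the
  -- mass to the right of L vanishes and that to the left is 2π‖f‖².
  have hlim := ((Complex.continuous_ofReal.tendsto _).comp (hR.sub hLf)).const_mul
    (1 / (2 * Complex.I))
  have hval : 1 / (2 * Complex.I) * (((0 - 2 * Real.pi * ∫ x, ‖f x‖ ^ 2 : ℝ)) : ℂ)
      = Complex.I * Real.pi * ((∫ x, ‖f x‖ ^ 2 : ℝ) : ℂ) := by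
    push_cast
    field_simp
    rw [Complex.I_sq]
    ring
  rw [hval] at hlim
  refine hlim.congr' ?_
  filter_upwards [hδ] with n hn
  have hA := integral_regularized_half hf hc (L n) 1 (δ n) hn
  have hB := integral_regularized_half hf hc (L n) (-1) (δ n) hn
  have hne : ∀ (ε : ℝ) (p : ℝ × ℝ), (δ n - Complex.I * (ε * (p.1 - p.2) : ℝ) : ℂ) ≠ 0 := by
    intro ε p h0
    have := congrArg Complex.re h0
    simp at this
    exact hn.ne' this
  have hint : ∀ ε : ℝ, Integrable fun p : ℝ × ℝ => conj (f p.1) * f p.2 *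
      Complex.exp (Complex.I * (L n * (p.1 - p.2) : ℝ)) *
        (1 / (δ n - Complex.I * (ε * (p.1 - p.2) : ℝ))) := by
    intro ε
    have hF : Integrable (fun p : ℝ × ℝ => ‖f p.1‖ * ‖f p.2‖) := h1.norm.mul_prod h1.norm
    refine (hF.mul_const (1 / δ n)).mono' ?_ (ae_of_all _ fun p => ?_)
    · refine Continuous.aestronglyMeasurable ?_
      refine Continuous.mul (by fun_prop) (Continuous.div (by fun_prop) (by fun_prop) (hne ε))
    · simp only [norm_mul, Complex.norm_exp, RCLike.norm_conj]
      have h5 : δ n ≤ ‖(δ n - Complex.I * (ε * (p.1 - p.2) : ℝ) : ℂ)‖ := by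
        have := Complex.re_le_norm (δ n - Complex.I * (ε * (p.1 - p.2) : ℝ) : ℂ)
        simpa using this
      have h6 : ‖(1 / (δ n - Complex.I * (ε * (p.1 - p.2) : ℝ)) : ℂ)‖ ≤ 1 / δ n := by
        rw [norm_div, norm_one]
        exact one_div_le_one_div_of_le hn h5
      have h7 : Real.exp (Complex.I * (L n * (p.1 - p.2) : ℝ)).re = 1 := by simp
      rw [h7, mul_one]
      exact mul_le_mul_of_nonneg_left h6 (by positivity)
  simp only [Function.comp_apply]
  have e3 : (((∫ s in Set.Ioi (0 : ℝ), Real.exp (-(δ n * s)) * specDensity f (L n + s)) -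
      ∫ s in Set.Ioi (0 : ℝ), Real.exp (-(δ n * s)) * specDensity f (L n - s) : ℝ) : ℂ)
      = (∫ p : ℝ × ℝ, conj (f p.1) * f p.2 *
        Complex.exp (Complex.I * (L n * (p.1 - p.2) : ℝ)) *
          (1 / (δ n - Complex.I * (1 * (p.1 - p.2) : ℝ)))) -
        ∫ p : ℝ × ℝ, conj (f p.1) * f p.2 *
        Complex.exp (Complex.I * (L n * (p.1 - p.2) : ℝ)) *
          (1 / (δ n - Complex.I * (-1 * (p.1 - p.2) : ℝ))) := by
    rw [hA, hB, Complex.ofReal_sub, ← integral_complex_ofReal, ← integral_complex_ofReal]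
    simp [sub_eq_add_neg]
  rw [e3, ← integral_sub (hint 1) (hint (-1)), ← integral_const_mul]
  refine integral_congr_ae (ae_of_all _ fun p => ?_)
  simp only
  rw [← mul_sub, mul_left_comm]
  congr 1
  have hp := hne 1 p
  have hm := hne (-1) p
  have hq : (((p.1 - p.2) ^ 2 + δ n ^ 2 : ℝ) : ℂ) ≠ 0 := by
    exact_mod_cast (by positivity : (p.1 - p.2) ^ 2 + δ n ^ 2 ≠ 0)
  have hI : (2 * Complex.I) ≠ 0 := by simp
  rw [Complex.ofReal_div]
  rw [div_sub_div _ _ hp hm, div_mul_div_comm, div_eq_div_iff (mul_ne_zero hI (mul_ne_zero hp hm)) hq]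
  push_cast
  linear_combination (2 * Complex.I * ((p.1:ℂ) - p.2) ^ 3) * Complex.I_sq

end Fourier
-- The oscillating profile as an approximate solution of the recursion.
section Difference

/-- The oscillating profile `x^(-1/4) exp (i (x θ - μ log x))`. -/
noncomputable def osc (θ μ x : ℝ) : ℂ :=
  ((x ^ (-(1 / 4) : ℝ) : ℝ) : ℂ) * Complex.exp (Complex.I * ((x * θ - μ * Real.log x : ℝ) : ℂ))

theorem norm_osc (θ μ : ℝ) {x : ℝ} (hx : 0 ≤ x) : ‖osc θ μ x‖ = x ^ (-(1 / 4) : ℝ) := by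
  rw [osc, norm_mul, Complex.norm_exp, Complex.norm_real, Real.norm_eq_abs,
    abs_of_nonneg (Real.rpow_nonneg hx _)]
  simp

/-- The algebraic and logarithmic factors are merged into one complex power of 1 + h/x, so a single
expansion covers all shifts. -/
theorem osc_add (θ μ : ℝ) {x h : ℝ} (hx : 0 < x) (hxh : 0 < x + h) :
    osc θ μ (x + h) = osc θ μ x * (Complex.exp (Complex.I * (h * θ : ℝ)) *
      Complex.exp ((-(1 / 4) - Complex.I * μ) * (Real.log (1 + h / x) : ℝ))) := by
  have h1 : 0 < 1 + h / x := by
    have : 1 + h / x = (x + h) / x := by field_simp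
    rw [this]; positivity
  have hl : Real.log (x + h) = Real.log x + Real.log (1 + h / x) := by
    rw [← Real.log_mul hx.ne' h1.ne']
    congr 1
    field_simp
  have hp : ((x + h) ^ (-(1 / 4) : ℝ) : ℝ)
      = x ^ (-(1 / 4) : ℝ) * Real.exp (-(1 / 4) * Real.log (1 + h / x)) := by
    rw [Real.rpow_def_of_pos hx, Real.rpow_def_of_pos hxh, hl, ← Real.exp_add]
    congr 1
    ring
  rw [osc, osc, hp, hl, Complex.ofReal_mul, mul_assoc, mul_assoc, Complex.ofReal_exp,
    ← Complex.exp_add, ← Complex.exp_add, ← Complex.exp_add]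
  congr 2
  push_cast
  ring

theorem sqrt_add_eq {x h : ℝ} (hx : 0 < x) (hxh : 0 < x + h) :
    √(x + h) = √x * Real.exp (1 / 2 * Real.log (1 + h / x)) := by
  have h1 : 0 < 1 + h / x := by
    have : 1 + h / x = (x + h) / x := by field_simp
    rw [this]; positivity
  have : x + h = x * (1 + h / x) := by field_simp
  rw [this, Real.sqrt_mul hx.le, Real.sqrt_eq_rpow (1 + h / x), Real.rpow_def_of_pos h1]
  congr 2
  rw [mul_comm]

theorem abs_log_one_add_sub_le {t : ℝ} (ht : |t| ≤ 1 / 2) :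
    |Real.log (1 + t) - t| ≤ 2 * t ^ 2 := by
  have h := Real.abs_log_sub_add_sum_range_le (x := -t) (by rw [abs_neg]; linarith) 1
  simp only [Finset.range_one, Finset.sum_singleton, abs_neg, sub_neg_eq_add] at h
  norm_num at h
  have h2 : t ^ 2 / (1 - |t|) ≤ 2 * t ^ 2 := by
    rw [div_le_iff₀ (by linarith)]
    nlinarith [sq_nonneg t]
  calc _ = |-t + Real.log (1 + t)| := by congr 1; ring
    _ ≤ _ := h.trans h2

/-- First-order Taylor expansion of (1+t)^σ. The constant depends on σ only through R, which later
gives uniformity in the energy. -/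
theorem norm_exp_mul_log_sub_le {R : ℝ} {σ : ℂ} (hσ : ‖σ‖ ≤ R) {t : ℝ} (ht : |t| ≤ 1 / 2) :
    ‖Complex.exp (σ * (Real.log (1 + t) : ℝ)) - 1 - σ * t‖
      ≤ (4 * R ^ 2 * Real.exp R + 2 * R) * t ^ 2 := by
  have hR : 0 ≤ R := (norm_nonneg _).trans hσ
  have hl := abs_log_one_add_sub_le ht
  have hl2 : |Real.log (1 + t)| ≤ 2 * |t| := by
    have : |Real.log (1 + t)| ≤ |Real.log (1 + t) - t| + |t| := by
      simpa using abs_add_le (Real.log (1 + t) - t) t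
    have h3 : 2 * t ^ 2 ≤ |t| := by
      rw [← sq_abs]; nlinarith [abs_nonneg t]
    linarith
  set z : ℂ := σ * (Real.log (1 + t) : ℝ) with hz
  have hzn : ‖z‖ ≤ 2 * R * |t| := by
    rw [hz, norm_mul, Complex.norm_real, Real.norm_eq_abs]
    calc _ ≤ R * (2 * |t|) := by gcongr
      _ = _ := by ring
  have hzR : ‖z‖ ≤ R := hzn.trans (by nlinarith)
  have h1 := Complex.norm_exp_sub_sum_le_norm_mul_exp z 2
  simp only [Finset.sum_range_succ, Finset.sum_range_zero] at h1
  norm_num at h1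
  have h2 : ‖z‖ ^ 2 * Real.exp ‖z‖ ≤ 4 * R ^ 2 * Real.exp R * t ^ 2 := by
    calc _ ≤ (2 * R * |t|) ^ 2 * Real.exp R := by gcongr
      _ = _ := by rw [mul_pow, sq_abs]; ring
  have h3 : ‖z - σ * t‖ ≤ 2 * R * t ^ 2 := by
    rw [hz, ← mul_sub, norm_mul, ← Complex.ofReal_sub, Complex.norm_real, Real.norm_eq_abs]
    calc _ ≤ R * (2 * t ^ 2) := by gcongr
      _ = _ := by ring
  calc _ = ‖(Complex.exp z - (1 + z)) + (z - σ * t)‖ := by congr 1; ring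
    _ ≤ _ := norm_add_le _ _
    _ ≤ _ := by rw [add_mul]; linarith

/-- The defect of `osc` in the difference equation
`√(n+2) y_{n+2} + √(n+1) y_n = b_{n+1} y_{n+1}`. -/
noncomputable def defect (θ μ : ℝ) (b : ℕ → ℝ) (n : ℕ) : ℂ :=
  √((n : ℝ) + 2) * osc θ μ (n + 2 : ℕ) + √((n : ℝ) + 1) * osc θ μ n
    - b (n + 1) * osc θ μ (n + 1 : ℕ)

/-- The bound on the coefficients under which `osc` solves the difference equation to
second order. -/
def CoeffBound (θ μ B : ℝ) (b : ℕ → ℝ) (n : ℕ) : Prop :=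
  |b n - √(n : ℝ) * (2 * Real.cos θ + (Real.cos θ / 2 + 2 * μ * Real.sin θ) / n)|
    ≤ B * (n : ℝ) ^ (-(3 / 2) : ℝ)

/-- With m = n+1, dividing the defect by √m · osc(m) leaves e^{iθ}(1+1/m)^{1/4-iμ} +
e^{-iθ}(1-1/m)^{-1/4-iμ} - b/√m. The powers expand to 2 cos θ + (cos θ/2 + 2μ sin θ)/m + O(m⁻²), and
`CoeffBound` is designed to cancel the displayed terms. The prefactor has size m^{1/2-1/4}, whence
the exponent 1/4 - 2 = -7/4. -/
theorem norm_defect_le (θ R B : ℝ) : ∃ C, 0 ≤ C ∧ ∀ μ : ℝ, |μ| ≤ R → ∀ b : ℕ → ℝ, ∀ n : ℕ, 1 ≤ n →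
    CoeffBound θ μ B b (n + 1) → ‖defect θ μ b n‖ ≤ C * ((n : ℝ) + 1) ^ (-(7 / 4) : ℝ) := by
  set R' := R + 1
  set D := 4 * R' ^ 2 * Real.exp R' + 2 * R' with hD
  refine ⟨|D| + |D| + |B|, by positivity, fun μ hμ b n hn hb => ?_⟩
  have hR0 : 0 ≤ R := (abs_nonneg _).trans hμ
  have hD0 : 0 ≤ D := by positivity
  rw [abs_of_nonneg hD0]
  have hn1 : (1 : ℝ) ≤ n := by exact_mod_cast hn
  set m : ℝ := (n : ℝ) + 1 with hm
  have hm0 : 0 < m := by linarith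
  have hm2 : 2 ≤ m := by linarith
  have hs : ‖(-(1 / 4) - Complex.I * μ : ℂ)‖ ≤ R' := by
    calc _ ≤ ‖(-(1 / 4) : ℂ)‖ + ‖Complex.I * (μ : ℂ)‖ := norm_sub_le _ _
      _ ≤ _ := by
        rw [norm_mul, Complex.norm_I, Complex.norm_real, Real.norm_eq_abs]
        norm_num
        simp only [R']
        linarith
  have hs' : ‖(1 / 4 - Complex.I * μ : ℂ)‖ ≤ R' := by
    calc _ ≤ ‖(1 / 4 : ℂ)‖ + ‖Complex.I * (μ : ℂ)‖ := norm_sub_le _ _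
      _ ≤ _ := by
        rw [norm_mul, Complex.norm_I, Complex.norm_real, Real.norm_eq_abs]
        norm_num
        simp only [R']
        linarith
  have ht : |1 / m| ≤ 1 / 2 := by
    rw [abs_of_pos (by positivity)]
    exact one_div_le_one_div_of_le (by norm_num) hm2
  have ht' : |-1 / m| ≤ 1 / 2 := by rwa [neg_div, abs_neg]
  have e1 := norm_exp_mul_log_sub_le hs' ht
  have e2 := norm_exp_mul_log_sub_le hs ht'
  set X := Complex.exp ((1 / 4 - Complex.I * μ) * (Real.log (1 + 1 / m) : ℝ)) with hX
  set Y := Complex.exp ((-(1 / 4) - Complex.I * μ) * (Real.log (1 + -1 / m) : ℝ)) with hY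
  set q : ℝ := b (n + 1) / √m with hq
  have hsm : 0 < √m := Real.sqrt_pos.2 hm0
  have hsq : (√m) ^ 2 = m := Real.sq_sqrt hm0.le
  have eD : defect θ μ b n = √m * osc θ μ m * (Complex.exp (Complex.I * θ) * X
      + Complex.exp (-(Complex.I * θ)) * Y - q) := by
    have a1 : osc θ μ (n + 2 : ℕ) = osc θ μ (m + 1) := by
      congr 1; rw [hm]; push_cast; ring
    have a2 : osc θ μ n = osc θ μ (m + -1) := by
      congr 1; rw [hm]; ring
    have a3 : osc θ μ (n + 1 : ℕ) = osc θ μ m := by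
      congr 1; rw [hm]; push_cast; ring
    have a4 : √((n : ℝ) + 2) = √(m + 1) := by congr 1; rw [hm]; ring
    have a5 : (b (n + 1) : ℂ) = √m * q := by
      rw [hq, ← Complex.ofReal_mul]; congr 1; field_simp
    -- The factor √(n+2) raises the exponent from -1/4 to 1/4; the factor √(n+1) = √m of the other
    -- neighbour needs no expansion, so `Y` keeps -1/4.
    have a6 : Complex.exp ((1 / 2 * Real.log (1 + 1 / m) : ℝ)) *
        Complex.exp ((-(1 / 4) - Complex.I * μ) * (Real.log (1 + 1 / m) : ℝ)) = X := by
      rw [← Complex.exp_add, hX]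
      congr 1
      push_cast
      ring
    rw [defect, a1, a2, a3, a4, a5, osc_add θ μ hm0 (by linarith), osc_add θ μ hm0 (by linarith),
      sqrt_add_eq hm0 (by linarith), ← a6, Complex.ofReal_mul, Complex.ofReal_exp]
    have a7 : Complex.exp (Complex.I * (1 * θ : ℝ)) = Complex.exp (Complex.I * θ) := by simp
    have a8 : Complex.exp (Complex.I * (-1 * θ : ℝ)) = Complex.exp (-(Complex.I * θ)) := by simp
    rw [a7, a8, ← hY]
    ring
  have hb' : |q - (2 * Real.cos θ + (Real.cos θ / 2 + 2 * μ * Real.sin θ) / m)|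
      ≤ |B| * (1 / m) ^ 2 := by
    have hb2 : |b (n + 1) - √m * (2 * Real.cos θ + (Real.cos θ / 2 + 2 * μ * Real.sin θ) / m)|
      ≤ B * m ^ (-(3 / 2) : ℝ) := by
      have := hb
      unfold CoeffBound at this
      push_cast at this
      exact this
    have e : q - (2 * Real.cos θ + (Real.cos θ / 2 + 2 * μ * Real.sin θ) / m)
        = (b (n + 1) - √m * (2 * Real.cos θ + (Real.cos θ / 2 + 2 * μ * Real.sin θ) / m)) / √m := by
      rw [hq]; field_simp
    have e' : m ^ (-(3 / 2) : ℝ) = (1 / m) ^ 2 * √m := by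
      rw [Real.sqrt_eq_rpow, one_div, inv_pow, ← Real.rpow_natCast, ← Real.rpow_neg hm0.le,
        ← Real.rpow_add hm0]
      norm_num
    rw [e, abs_div, abs_of_pos hsm, div_le_iff₀ hsm]
    calc _ ≤ _ := hb2
      _ ≤ |B| * m ^ (-(3 / 2) : ℝ) := by gcongr; exact le_abs_self B
      _ = _ := by rw [e']; ring
  have hexp : ∀ x : ℝ, Complex.exp (Complex.I * x) = Real.cos x + Complex.I * Real.sin x := by
    intro x
    rw [mul_comm, Complex.exp_mul_I]
    push_cast
    ring
  have hE1 : Complex.exp (Complex.I * θ) = Real.cos θ + Complex.I * Real.sin θ := hexp θ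
  have hE2 : Complex.exp (-(Complex.I * θ)) = Real.cos θ - Complex.I * Real.sin θ := by
    have := hexp (-θ)
    rw [Real.cos_neg, Real.sin_neg] at this
    push_cast at this ⊢
    rw [mul_neg] at this
    rw [this]
    ring
  have hN1 : ‖Complex.exp (Complex.I * θ)‖ = 1 := by
    rw [Complex.norm_exp]; simp
  have hN2 : ‖Complex.exp (-(Complex.I * θ))‖ = 1 := by
    rw [Complex.norm_exp]; simp
  have hbr : Complex.exp (Complex.I * θ) * X + Complex.exp (-(Complex.I * θ)) * Y - q
      = Complex.exp (Complex.I * θ) * (X - 1 - (1 / 4 - Complex.I * μ) * (1 / m : ℝ))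
        + Complex.exp (-(Complex.I * θ)) * (Y - 1 - (-(1 / 4) - Complex.I * μ) * (-1 / m : ℝ))
        - ((q - (2 * Real.cos θ + (Real.cos θ / 2 + 2 * μ * Real.sin θ) / m) : ℝ) : ℂ) := by
    rw [hE1, hE2]
    push_cast
    have hmc : (m : ℂ) ≠ 0 := by exact_mod_cast hm0.ne'
    field_simp
    linear_combination (-16 * μ * Complex.sin θ) * Complex.I_sq
  have hbrn : ‖Complex.exp (Complex.I * θ) * X + Complex.exp (-(Complex.I * θ)) * Y - q‖
      ≤ (D + D + |B|) * (1 / m) ^ 2 := by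
    rw [hbr]
    refine (norm_sub_le _ _).trans ?_
    have h1 := norm_add_le
      (Complex.exp (Complex.I * θ) * (X - 1 - (1 / 4 - Complex.I * μ) * (1 / m : ℝ)))
      (Complex.exp (-(Complex.I * θ)) * (Y - 1 - (-(1 / 4) - Complex.I * μ) * (-1 / m : ℝ)))
    rw [norm_mul, norm_mul, hN1, hN2, one_mul, one_mul] at h1
    rw [Complex.norm_real, Real.norm_eq_abs]
    have : (-1 / m) ^ 2 = (1 / m) ^ 2 := by ring
    rw [this] at e2
    linarith
  rw [eD, norm_mul, norm_mul, norm_osc _ _ hm0.le, Complex.norm_real, Real.norm_eq_abs,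
    abs_of_pos hsm]
  calc _ ≤ √m * m ^ (-(1 / 4) : ℝ) * ((D + D + |B|) * (1 / m) ^ 2) := by gcongr
    _ = (D + D + |B|) * m ^ (-(7 / 4) : ℝ) := by
      have : m ^ (-(7 / 4) : ℝ) = √m * m ^ (-(1 / 4) : ℝ) * (1 / m) ^ 2 := by
        rw [Real.sqrt_eq_rpow, one_div m, inv_pow, ← Real.rpow_natCast, ← Real.rpow_neg hm0.le,
          ← Real.rpow_add hm0, ← Real.rpow_add hm0]
        norm_num
      rw [this]; ring

end Difference
-- Wronskians with the profile, Jost coefficients and uniform asymptotics.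
section Jost

/-- The Jacobi-type difference equation at the levels `n ≥ 1`. -/
def IsJacobi (b : ℕ → ℝ) (y : ℕ → ℝ) : Prop :=
  ∀ n : ℕ, √((n : ℝ) + 2) * y (n + 2) + √((n : ℝ) + 1) * y n = b (n + 1) * y (n + 1)

/-- The Wronskian of a solution with the oscillating profile. -/
noncomputable def wron (θ μ : ℝ) (y : ℕ → ℝ) (n : ℕ) : ℂ :=
  √((n : ℝ) + 1) * (y (n + 1) * osc θ μ n - y n * osc θ μ (n + 1 : ℕ))

/-- The limiting Wronskian, the Jost coefficient of a solution. -/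
noncomputable def jost (θ μ : ℝ) (y : ℕ → ℝ) : ℂ := limUnder atTop (wron θ μ y)

/-- Cross-multiplying the exact equation for y with the approximate one for `osc` cancels b; only
the defect survives. -/
theorem wron_succ_sub {b y : ℕ → ℝ} (hy : IsJacobi b y) (θ μ : ℝ) (n : ℕ) :
    wron θ μ y (n + 1) - wron θ μ y n = -(defect θ μ b n * y (n + 1)) := by
  have h : (√((n : ℝ) + 2) : ℂ) * y (n + 2) + √((n : ℝ) + 1) * y n = b (n + 1) * y (n + 1) := by
    exact_mod_cast hy n
  have h2 : √(((n + 1 : ℕ) : ℝ) + 1) = √((n : ℝ) + 2) := by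
    congr 1; push_cast; ring
  rw [wron, wron, defect, h2, add_assoc n 1 1, one_add_one_eq_two]
  linear_combination (osc θ μ (n + 1 : ℕ)) * h

/-- The Wronskian of the profile with its conjugate, up to a constant. -/
noncomputable def oscWron (θ μ : ℝ) (n : ℕ) : ℝ :=
  Real.exp (1 / 4 * Real.log (1 + 1 / n)) * Real.sin (θ - μ * Real.log (1 + 1 / n))

theorem sqrt_mul_im_osc (θ μ : ℝ) {n : ℕ} (hn : 1 ≤ n) :
    √((n : ℝ) + 1) * (osc θ μ n * conj (osc θ μ (n + 1 : ℕ))).im = -oscWron θ μ n := by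
  have hn0 : (0 : ℝ) < n := by exact_mod_cast hn
  set l := Real.log (1 + 1 / (n : ℝ)) with hl
  have h1 : osc θ μ n * conj (osc θ μ (n + 1 : ℕ)) = (((n : ℝ) ^ (-(1 / 4) : ℝ)) ^ 2 *
      Real.exp (-(1 / 4) * l) : ℝ) * Complex.exp (-((θ - μ * l : ℝ) : ℂ) * Complex.I) := by
    rw [Nat.cast_add, Nat.cast_one, osc_add θ μ hn0 (by linarith), map_mul, ← mul_assoc,
      Complex.mul_conj, Complex.normSq_eq_norm_sq, norm_osc _ _ hn0.le, Complex.ofReal_mul,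
      ← Complex.exp_add, ← Complex.exp_conj, ← hl, Complex.ofReal_mul, mul_assoc,
      Complex.ofReal_exp, ← Complex.exp_add]
    congr 2
    simp only [map_add, map_mul, map_sub, map_neg, map_div₀, Complex.conj_I, Complex.conj_ofReal,
      map_one, map_ofNat]
    push_cast
    ring
  have h2 : (Complex.exp (-((θ - μ * l : ℝ) : ℂ) * Complex.I)).im = -Real.sin (θ - μ * l) := by
    rw [← Complex.ofReal_neg, Complex.exp_ofReal_mul_I_im, Real.sin_neg]
  have h3 : √((n : ℝ) + 1) = √n * Real.exp (1 / 2 * l) := sqrt_add_eq hn0 (by linarith)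
  have h4 : √(n : ℝ) * ((n : ℝ) ^ (-(1 / 4) : ℝ)) ^ 2 = 1 := by
    rw [Real.sqrt_eq_rpow, ← Real.rpow_natCast, ← Real.rpow_mul hn0.le, ← Real.rpow_add hn0]
    norm_num
  have h5 : Real.exp (1 / 4 * l) = Real.exp (1 / 2 * l) * Real.exp (-(1 / 4) * l) := by
    rw [← Real.exp_add]; congr 1; ring
  rw [h1, Complex.im_ofReal_mul, h2, h3, oscWron, ← hl, h5]
  linear_combination (-(Real.exp (1 / 2 * l) * Real.exp (-(1 / 4) * l) *
    Real.sin (θ - μ * l))) * h4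

/-- Since y is real, multiplying the Wronskian by the conjugate profile turns one of its two terms
into a real number, and the imaginary part isolates the other. Thus one complex Wronskian determines
both y n and y (n+1), as in `succ_mul_oscWron`. -/
theorem mul_oscWron (θ μ : ℝ) (y : ℕ → ℝ) {n : ℕ} (hn : 1 ≤ n) :
    y n * oscWron θ μ n = -(wron θ μ y n * conj (osc θ μ n)).im := by
  have h := sqrt_mul_im_osc θ μ hn
  rw [← neg_eq_iff_eq_neg] at h
  rw [← h, wron]
  simp only [Complex.mul_im, Complex.mul_re, Complex.sub_im, Complex.sub_re, Complex.conj_re,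
    Complex.conj_im, Complex.ofReal_re, Complex.ofReal_im]
  ring

theorem succ_mul_oscWron (θ μ : ℝ) (y : ℕ → ℝ) {n : ℕ} (hn : 1 ≤ n) :
    y (n + 1) * oscWron θ μ n = -(wron θ μ y n * conj (osc θ μ (n + 1 : ℕ))).im := by
  have h := sqrt_mul_im_osc θ μ hn
  rw [← neg_eq_iff_eq_neg] at h
  rw [← h, wron]
  simp only [Complex.mul_im, Complex.mul_re, Complex.sub_im, Complex.sub_re, Complex.conj_re,
    Complex.conj_im, Complex.ofReal_re, Complex.ofReal_im]
  ring

/-- Passing to the limit, this ties the Jost coefficients of two solutions to their real Wronskian.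
-/
theorem im_wron_mul_conj (θ μ : ℝ) (y z : ℕ → ℝ) {n : ℕ} (hn : 1 ≤ n) :
    (wron θ μ y n * conj (wron θ μ z n)).im
      = √((n : ℝ) + 1) * (y (n + 1) * z n - y n * z (n + 1)) * oscWron θ μ n := by
  have h := sqrt_mul_im_osc θ μ hn
  rw [← neg_eq_iff_eq_neg] at h
  rw [← h, wron, wron]
  simp only [Complex.mul_im, Complex.mul_re, Complex.sub_im, Complex.sub_re, Complex.conj_re,
    Complex.conj_im, Complex.ofReal_re, Complex.ofReal_im]
  ring

theorem log_one_add_one_div_le {n : ℕ} (hn : 1 ≤ n) :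
    0 ≤ Real.log (1 + 1 / (n : ℝ)) ∧ Real.log (1 + 1 / (n : ℝ)) ≤ 1 / n := by
  have hn0 : (0 : ℝ) < n := by exact_mod_cast hn
  have h : (0 : ℝ) < 1 / n := by positivity
  exact ⟨Real.log_nonneg (by linarith), by
    have := Real.log_le_sub_one_of_pos (x := 1 + 1 / (n : ℝ)) (by linarith)
    linarith⟩

theorem abs_oscWron_sub_le (θ : ℝ) {μ R : ℝ} (hμ : |μ| ≤ R) {n : ℕ} (hn : 1 ≤ n) :
    |oscWron θ μ n - Real.sin θ| ≤ (1 + R) / n := by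
  have hn1 : (1 : ℝ) ≤ n := by exact_mod_cast hn
  obtain ⟨h0, h1⟩ := log_one_add_one_div_le hn
  set l := Real.log (1 + 1 / (n : ℝ)) with hl
  have h2 : (1 : ℝ) / n ≤ 1 := by rw [div_le_one (by linarith)]; exact hn1
  have h3 : |Real.exp (1 / 4 * l) - 1| ≤ 1 / n := by
    have := Real.abs_exp_sub_one_le (x := 1 / 4 * l) (by rw [abs_of_nonneg (by positivity)]; linarith)
    rw [abs_of_nonneg (a := 1 / 4 * l) (by positivity)] at this
    linarith
  have h4 : |Real.sin (θ - μ * l) - Real.sin θ| ≤ R / n := by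
    refine (Real.abs_sin_sub_sin_le _ _).trans ?_
    have : θ - μ * l - θ = -(μ * l) := by ring
    rw [this, abs_neg, abs_mul, abs_of_nonneg h0]
    calc |μ| * l ≤ R * (1 / n) := by gcongr; exact (abs_nonneg _).trans hμ
      _ = _ := by ring
  rw [oscWron, ← hl]
  calc _ = |(Real.exp (1 / 4 * l) - 1) * Real.sin (θ - μ * l)
        + (Real.sin (θ - μ * l) - Real.sin θ)| := by congr 1; ring
    _ ≤ |Real.exp (1 / 4 * l) - 1| * |Real.sin (θ - μ * l)| + R / n := by
        refine (abs_add_le _ _).trans ?_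
        rw [abs_mul]
        linarith
    _ ≤ 1 / n * 1 + R / n := by
        gcongr
        exact Real.abs_sin_le_one _
    _ = _ := by ring

/-- A telescoping majorant, the source of the rate 1/n in the convergence of the Wronskians. -/
theorem one_div_succ_sq_le {n : ℕ} (hn : 1 ≤ n) :
    1 / ((n : ℝ) + 1) ^ 2 ≤ 1 / n - 1 / ((n + 1 : ℕ) : ℝ) := by
  have hn0 : (0 : ℝ) < n := by exact_mod_cast hn
  push_cast
  rw [div_sub_div _ _ hn0.ne' (by positivity), div_le_div_iff₀ (by positivity) (by positivity)]
  nlinarith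

/-- Sequences with summable relative increments `O(n⁻²)` stay bounded and are Cauchy with rate
`1/n`. -/
theorem norm_le_of_relative_increments {w : ℕ → ℂ} {C : ℝ} {N : ℕ} (hC : 0 ≤ C) (hN : 1 ≤ N)
    (h : ∀ n, N ≤ n → ‖w (n + 1) - w n‖ ≤ C / ((n : ℝ) + 1) ^ 2 * ‖w n‖) {n : ℕ} (hn : N ≤ n) :
    ‖w n‖ ≤ ‖w N‖ * Real.exp C := by
  have key : ∀ n, N ≤ n → ‖w n‖ ≤ ‖w N‖ * Real.exp (C * (1 / N - 1 / n)) := by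
    intro n hn
    induction n, hn using Nat.le_induction with
    | base => simp
    | succ n hn ih =>
      have h1 : ‖w (n + 1)‖ ≤ (1 + C / ((n : ℝ) + 1) ^ 2) * ‖w n‖ := by
        have := norm_le_norm_add_norm_sub' (w (n + 1)) (w n)
        have := h n hn
        linarith
      have h2 : 1 + C / ((n : ℝ) + 1) ^ 2 ≤ Real.exp (C * (1 / n - 1 / ((n + 1 : ℕ) : ℝ))) := by
        have h3 : C / ((n : ℝ) + 1) ^ 2 ≤ C * (1 / n - 1 / ((n + 1 : ℕ) : ℝ)) := by
          rw [div_eq_mul_one_div]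
          exact mul_le_mul_of_nonneg_left (one_div_succ_sq_le (hN.trans hn)) hC
        have := Real.add_one_le_exp (C * (1 / n - 1 / ((n + 1 : ℕ) : ℝ)))
        linarith
      calc _ ≤ _ := h1
        _ ≤ Real.exp (C * (1 / n - 1 / ((n + 1 : ℕ) : ℝ))) *
            (‖w N‖ * Real.exp (C * (1 / N - 1 / n))) := by gcongr
        _ = _ := by
          rw [mul_left_comm, ← Real.exp_add]
          congr 2
          ring
  refine (key n hn).trans ?_
  gcongr
  have hN1 : (1 : ℝ) ≤ N := by exact_mod_cast hN
  have h1 : (1 : ℝ) / N ≤ 1 := by rw [div_le_one (by linarith)]; exact hN1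
  have h2 : (0 : ℝ) ≤ 1 / n := by positivity
  nlinarith

/-- The uniform bound of `norm_le_of_relative_increments` turns relative increments into absolute
ones of size C M/(n+1)². These telescope, and the far index is sent to infinity. -/
theorem norm_sub_limUnder_le {w : ℕ → ℂ} {C : ℝ} {N : ℕ} (hC : 0 ≤ C) (hN : 1 ≤ N)
    (h : ∀ n, N ≤ n → ‖w (n + 1) - w n‖ ≤ C / ((n : ℝ) + 1) ^ 2 * ‖w n‖) :
    Tendsto w atTop (𝓝 (limUnder atTop w)) ∧
      ∀ n, N ≤ n → ‖w n - limUnder atTop w‖ ≤ C * (‖w N‖ * Real.exp C) / n := by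
  set M := ‖w N‖ * Real.exp C with hM
  have hM0 : 0 ≤ M := by positivity
  have key : ∀ n m, N ≤ n → n ≤ m → ‖w m - w n‖ ≤ C * M * (1 / n - 1 / m) := by
    intro n m hn hm
    induction m, hm using Nat.le_induction with
    | base => simp
    | succ m hm ih =>
      have h1 := h m (hn.trans hm)
      have h2 := norm_le_of_relative_increments hC hN h (hn.trans hm)
      have h3 := one_div_succ_sq_le (hN.trans (hn.trans hm))
      have h4 : C / ((m : ℝ) + 1) ^ 2 * ‖w m‖ ≤ C * M * (1 / m - 1 / ((m + 1 : ℕ) : ℝ)) := by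
        calc _ = C * (1 / ((m : ℝ) + 1) ^ 2) * ‖w m‖ := by ring
          _ ≤ C * (1 / m - 1 / ((m + 1 : ℕ) : ℝ)) * M := by
            gcongr
            exact mul_nonneg hC ((by positivity : (0 : ℝ) ≤ 1 / ((m : ℝ) + 1) ^ 2).trans h3)
          _ = _ := by ring
      have h5 : ‖w (m + 1) - w n‖ ≤ ‖w (m + 1) - w m‖ + ‖w m - w n‖ :=
        norm_sub_le_norm_sub_add_norm_sub _ _ _
      linarith
  have key2 : ∀ n m, N ≤ n → n ≤ m → ‖w m - w n‖ ≤ C * M / n := by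
    intro n m hn hm
    refine (key n m hn hm).trans ?_
    have : (0 : ℝ) ≤ 1 / m := by positivity
    rw [div_eq_mul_one_div (C * M)]
    gcongr
    linarith
  have hcau : CauchySeq w := by
    -- The criterion wants a bound at every index; below N any crude one serves, as only the tail
    -- must tend to 0.
    refine cauchySeq_of_le_tendsto_0' (fun n : ℕ => if N ≤ n then C * M / n else ‖w n‖ + C * M +
      ‖w N‖ + ∑ i ∈ Finset.range N, ‖w i‖) ?_ ?_
    · intro n m hnm
      by_cases hn : N ≤ n
      · simp only [hn, if_true]
        rw [dist_comm, dist_eq_norm]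
        exact key2 n m hn hnm
      · simp only [hn, if_false]
        rw [dist_eq_norm]
        have hs : 0 ≤ ∑ i ∈ Finset.range N, ‖w i‖ := Finset.sum_nonneg fun i _ => norm_nonneg _
        by_cases hm : N ≤ m
        · have h1 := key2 N m le_rfl hm
          have hN1 : (1 : ℝ) ≤ N := by exact_mod_cast hN
          have h2 : C * M / N ≤ C * M := div_le_self (by positivity) hN1
          have h3 : ‖w n - w m‖ ≤ ‖w n‖ + ‖w m‖ := norm_sub_le _ _
          have h4 := norm_le_norm_add_norm_sub' (w m) (w N)
          linarith
        · have h1 : ‖w m‖ ≤ ∑ i ∈ Finset.range N, ‖w i‖ :=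
            Finset.single_le_sum (f := fun i => ‖w i‖) (fun i _ => norm_nonneg _)
              (Finset.mem_range.2 (not_le.1 hm))
          have h3 : ‖w n - w m‖ ≤ ‖w n‖ + ‖w m‖ := norm_sub_le _ _
          have : 0 ≤ C * M := by positivity
          have := norm_nonneg (w N)
          linarith
    · have h1 : Tendsto (fun n : ℕ => C * M / n) atTop (𝓝 0) :=
        tendsto_const_div_atTop_nhds_zero_nat _
      refine h1.congr' ?_
      filter_upwards [eventually_ge_atTop N] with n hn
      simp [hn]
  have ht := CauchySeq.tendsto_limUnder hcau
  refine ⟨ht, fun n hn => ?_⟩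
  have h1 : Tendsto (fun m => ‖w m - w n‖) atTop (𝓝 ‖limUnder atTop w - w n‖) :=
    (ht.sub_const _).norm
  rw [norm_sub_rev]
  refine le_of_tendsto h1 ?_
  filter_upwards [eventually_ge_atTop n] with m hm
  exact key2 n m hn hm

/-- Uniform convergence of the Wronskians, and the resulting asymptotics, for a family of
solutions. -/
theorem exists_uniform_jost {ι : Type*} {S : Set ι} {θ R B : ℝ} {μ : ι → ℝ} {b y : ι → ℕ → ℝ}
    (hθ : 0 < Real.sin θ) (hμ : ∀ E ∈ S, |μ E| ≤ R)
    (hb : ∃ N, ∀ n, N ≤ n → ∀ E ∈ S, CoeffBound θ (μ E) B (b E) n)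
    (hy : ∀ E ∈ S, IsJacobi (b E) (y E)) (hbd : ∀ n, ∃ M, ∀ E ∈ S, |y E n| ≤ M) :
    ∃ (C : ℝ) (N : ℕ), 0 ≤ C ∧ 1 ≤ N ∧ ∀ E ∈ S,
      Tendsto (wron θ (μ E) (y E)) atTop (𝓝 (jost θ (μ E) (y E))) ∧
      ‖jost θ (μ E) (y E)‖ ≤ C ∧
      ∀ n, N ≤ n → ‖wron θ (μ E) (y E) n - jost θ (μ E) (y E)‖ ≤ C / n ∧
        |y E n + (jost θ (μ E) (y E) * conj (osc θ (μ E) n)).im / Real.sin θ|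
          ≤ C * (n : ℝ) ^ (-(5 / 4) : ℝ) := by
  obtain ⟨N₀, hb⟩ := hb
  obtain ⟨D, hD0, hD⟩ := norm_defect_le θ R B
  set s := Real.sin θ with hs
  -- A member of S is needed to know that R is nonnegative.
  rcases S.eq_empty_or_nonempty with rfl | ⟨E₀, hE₀⟩
  · exact ⟨0, 1, le_rfl, le_rfl, by simp⟩
  have hR : 0 ≤ R := (abs_nonneg _).trans (hμ E₀ hE₀)
  -- From this index on, `oscWron` differs from sin θ by at most half of it, so it may be divided
  -- by.
  obtain ⟨N₁, hN₁⟩ := exists_nat_ge (2 * (1 + R) / s)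
  set N := max (max N₀ N₁) 1 with hN
  have hN1 : 1 ≤ N := le_max_right _ _
  have hsig : ∀ E ∈ S, ∀ n, N ≤ n → s / 2 ≤ oscWron θ (μ E) n := by
    intro E hE n hn
    have hn1 : 1 ≤ n := hN1.trans hn
    have hn0 : (0 : ℝ) < n := by exact_mod_cast hn1
    have h1 := abs_oscWron_sub_le θ (hμ E hE) hn1
    have h2 : (1 + R) / n ≤ s / 2 := by
      have h3 : (N₁ : ℝ) ≤ n := by
        exact_mod_cast (le_max_right N₀ N₁).trans ((le_max_left _ _).trans hn)
      have h4 := hN₁.trans h3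
      rw [div_le_iff₀ hθ] at h4
      rw [div_le_div_iff₀ hn0 two_pos]
      linarith
    have := (abs_le.1 h1).1
    linarith
  -- The defect contributes the exponent -7/4. Bounding y (n+1) by the Wronskian itself contributes
  -- -1/4. Together they give the summable rate -2, so the estimate closes on the Wronskian alone.
  have hstep : ∀ E ∈ S, ∀ n, N ≤ n → ‖wron θ (μ E) (y E) (n + 1) - wron θ (μ E) (y E) n‖
      ≤ D * (2 / s) / ((n : ℝ) + 1) ^ 2 * ‖wron θ (μ E) (y E) n‖ := by
    intro E hE n hn
    have hn1 : 1 ≤ n := hN1.trans hn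
    have hm0 : (0 : ℝ) < (n : ℝ) + 1 := by positivity
    have hNn : N₀ ≤ n + 1 :=
      ((le_max_left N₀ N₁).trans ((le_max_left _ _).trans hn)).trans (Nat.le_succ n)
    have h1 := hD (μ E) (hμ E hE) (b E) n hn1 (hb (n + 1) hNn E hE)
    have h2 : |y E (n + 1)| ≤ (2 / s) * (‖wron θ (μ E) (y E) n‖ *
        ((n : ℝ) + 1) ^ (-(1 / 4) : ℝ)) := by
      have h3 := succ_mul_oscWron θ (μ E) (y E) hn1
      have h4 := hsig E hE n hn
      have h5 : |y E (n + 1)| * (s / 2) ≤ ‖wron θ (μ E) (y E) n‖ *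
          ((n : ℝ) + 1) ^ (-(1 / 4) : ℝ) := by
        calc _ ≤ |y E (n + 1)| * oscWron θ (μ E) n := by gcongr
          _ = |y E (n + 1) * oscWron θ (μ E) n| := by
            rw [abs_mul, abs_of_pos (a := oscWron θ (μ E) n) (by linarith)]
          _ ≤ ‖wron θ (μ E) (y E) n * conj (osc θ (μ E) (n + 1 : ℕ))‖ := by
            rw [h3, abs_neg]
            exact Complex.abs_im_le_norm _
          _ = _ := by
            rw [norm_mul, RCLike.norm_conj, norm_osc _ _ (Nat.cast_nonneg _)]
            push_cast
            rfl
      rw [← div_le_iff₀' (by positivity)]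
      rw [div_div_eq_mul_div]
      linarith
    rw [wron_succ_sub (hy E hE), norm_neg, norm_mul, Complex.norm_real, Real.norm_eq_abs]
    calc _ ≤ D * ((n : ℝ) + 1) ^ (-(7 / 4) : ℝ) * ((2 / s) * (‖wron θ (μ E) (y E) n‖ *
        ((n : ℝ) + 1) ^ (-(1 / 4) : ℝ))) := by gcongr
      _ = D * (2 / s) * ‖wron θ (μ E) (y E) n‖ *
          (((n : ℝ) + 1) ^ (-(7 / 4) : ℝ) * ((n : ℝ) + 1) ^ (-(1 / 4) : ℝ)) := by ring
      _ = D * (2 / s) * ‖wron θ (μ E) (y E) n‖ * (1 / ((n : ℝ) + 1) ^ 2) := by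
        congr 1
        rw [← Real.rpow_add hm0, show (-(7 / 4) + -(1 / 4) : ℝ) = -((2 : ℕ) : ℝ) by norm_num,
          Real.rpow_neg hm0.le, Real.rpow_natCast, one_div]
      _ = _ := by ring
  set C₁ := D * (2 / s) with hC₁
  have hC₁0 : 0 ≤ C₁ := by positivity
  -- Uniform bounds at the two levels N and N+1 control the initial Wronskian, and hence all later
  -- ones.
  obtain ⟨M₁, hM₁⟩ := hbd N
  obtain ⟨M₂, hM₂⟩ := hbd (N + 1)
  set M := √((N : ℝ) + 1) * (|M₂| + |M₁|) * Real.exp C₁ with hM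
  have hM0 : 0 ≤ M := by positivity
  have hWN : ∀ E ∈ S, ‖wron θ (μ E) (y E) N‖ * Real.exp C₁ ≤ M := by
    intro E hE
    have hosc : ∀ k : ℕ, 1 ≤ k → ‖osc θ (μ E) k‖ ≤ 1 := by
      intro k hk
      rw [norm_osc _ _ (Nat.cast_nonneg _)]
      exact Real.rpow_le_one_of_one_le_of_nonpos (by exact_mod_cast hk) (by norm_num)
    rw [hM]
    gcongr
    rw [wron, norm_mul, Complex.norm_real, Real.norm_eq_abs, abs_of_nonneg (Real.sqrt_nonneg _)]
    gcongr
    refine (norm_sub_le _ _).trans ?_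
    rw [norm_mul, norm_mul, Complex.norm_real, Complex.norm_real, Real.norm_eq_abs,
      Real.norm_eq_abs]
    have h1 := hosc N hN1
    have h2 := hosc (N + 1) (by omega)
    have h3 : |y E (N + 1)| * ‖osc θ (μ E) N‖ ≤ |M₂| * 1 := by
      exact mul_le_mul ((hM₂ E hE).trans (le_abs_self _)) h1 (norm_nonneg _) (abs_nonneg _)
    have h4 : |y E N| * ‖osc θ (μ E) (N + 1 : ℕ)‖ ≤ |M₁| * 1 := by
      exact mul_le_mul ((hM₁ E hE).trans (le_abs_self _)) h2 (norm_nonneg _) (abs_nonneg _)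
    linarith
  set C := M + C₁ * M + (2 / s) * (C₁ * M + (1 + R) * (M + C₁ * M) / s) with hC
  have hCM : M + C₁ * M ≤ C := by
    have : 0 ≤ (2 / s) * (C₁ * M + (1 + R) * (M + C₁ * M) / s) := by positivity
    linarith
  refine ⟨C, N, by positivity, hN1, fun E hE => ?_⟩
  obtain ⟨ht, hr⟩ := norm_sub_limUnder_le hC₁0 hN1 (hstep E hE)
  change Tendsto _ _ (𝓝 (jost θ (μ E) (y E))) at ht
  change ∀ n, N ≤ n → ‖wron θ (μ E) (y E) n - jost θ (μ E) (y E)‖ ≤ _ at hr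
  have hr' : ∀ n, N ≤ n → ‖wron θ (μ E) (y E) n - jost θ (μ E) (y E)‖ ≤ C₁ * M / n := by
    intro n hn
    refine (hr n hn).trans ?_
    gcongr
    exact hWN E hE
  have hΛ : ‖jost θ (μ E) (y E)‖ ≤ M := by
    refine le_of_tendsto ht.norm ?_
    filter_upwards [eventually_ge_atTop N] with n hn
    exact (norm_le_of_relative_increments hC₁0 hN1 (hstep E hE) hn).trans (hWN E hE)
  refine ⟨ht, ?_, fun n hn => ⟨?_, ?_⟩⟩
  · have : 0 ≤ C₁ * M := by positivity
    linarith
  · refine (hr' n hn).trans ?_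
    gcongr
    linarith
  · have hn1 : 1 ≤ n := hN1.trans hn
    have hn0 : (0 : ℝ) < n := by exact_mod_cast hn1
    set Λ := jost θ (μ E) (y E)
    set W := wron θ (μ E) (y E) n
    set a := osc θ (μ E) n
    set σ := oscWron θ (μ E) n
    have hσ : s / 2 ≤ σ := hsig E hE n hn
    have hσ0 : 0 < σ := by linarith
    have h1 : y E n * σ = -(W * conj a).im := mul_oscWron θ (μ E) (y E) hn1
    have h2 : |σ - s| ≤ (1 + R) / n := abs_oscWron_sub_le θ (hμ E hE) hn1
    have ha : ‖a‖ = (n : ℝ) ^ (-(1 / 4) : ℝ) := norm_osc _ _ hn0.le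
    -- Two errors of equal order: replacing the Wronskian by its limit, and replacing `oscWron` by
    -- sin θ. Each is O(1/n), against a profile of size n^(-1/4).
    have e : y E n + (Λ * conj a).im / s
        = (-((W - Λ) * conj a).im + (σ - s) * (Λ * conj a).im / s) / σ := by
      have h3 : ((W - Λ) * conj a).im = (W * conj a).im - (Λ * conj a).im := by
        rw [sub_mul, Complex.sub_im]
      rw [eq_div_iff hσ0.ne', add_mul, h1, h3]
      field_simp
      ring
    have b1 : |((W - Λ) * conj a).im| ≤ C₁ * M / n * (n : ℝ) ^ (-(1 / 4) : ℝ) := by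
      refine (Complex.abs_im_le_norm _).trans ?_
      rw [norm_mul, RCLike.norm_conj, ha]
      gcongr
      exact hr' n hn
    have b2 : |(Λ * conj a).im| ≤ (M + C₁ * M) * (n : ℝ) ^ (-(1 / 4) : ℝ) := by
      refine (Complex.abs_im_le_norm _).trans ?_
      rw [norm_mul, RCLike.norm_conj, ha]
      gcongr
      have : 0 ≤ C₁ * M := by positivity
      linarith
    rw [e, abs_div, abs_of_pos hσ0, div_le_iff₀ hσ0]
    have hpow : (n : ℝ) ^ (-(5 / 4) : ℝ) = 1 / n * (n : ℝ) ^ (-(1 / 4) : ℝ) := by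
      rw [one_div, ← Real.rpow_neg_one, ← Real.rpow_add hn0]
      norm_num
    calc _ ≤ |((W - Λ) * conj a).im| + |σ - s| * |(Λ * conj a).im| / s := by
          refine (abs_add_le _ _).trans ?_
          rw [abs_neg, abs_div, abs_mul, abs_of_pos hθ]
      _ ≤ C₁ * M / n * (n : ℝ) ^ (-(1 / 4) : ℝ) +
          (1 + R) / n * ((M + C₁ * M) * (n : ℝ) ^ (-(1 / 4) : ℝ)) / s := by gcongr
      _ = (C₁ * M + (1 + R) * (M + C₁ * M) / s) * (n : ℝ) ^ (-(5 / 4) : ℝ) := by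
          rw [hpow]; ring
      _ = (2 / s) * (C₁ * M + (1 + R) * (M + C₁ * M) / s) * (n : ℝ) ^ (-(5 / 4) : ℝ) * (s / 2) := by
          field_simp
      _ ≤ _ := by
          gcongr
          have : 0 ≤ C₁ * M := by positivity
          linarith

end Jost
-- The transversal solutions v_n: normalization and Green's formula.
section Profile

/-- The even solution of `p'' = -κ p` about `π` with value `1` at `π`. -/
noncomputable def prof (κ x : ℝ) : ℝ :=
  if 0 ≤ κ then Real.cos (√κ * (x - Real.pi)) else Real.cosh (√(-κ) * (x - Real.pi))

/-- The derivative of `prof`. -/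
noncomputable def profDeriv (κ x : ℝ) : ℝ :=
  if 0 ≤ κ then -(√κ * Real.sin (√κ * (x - Real.pi)))
  else √(-κ) * Real.sinh (√(-κ) * (x - Real.pi))

/-- The square of the `L²` norm of `prof κ |x|` over the circle. -/
noncomputable def profNormSq (κ : ℝ) : ℝ :=
  if 0 ≤ κ then Real.pi + Real.sin (2 * √κ * Real.pi) / (2 * √κ)
  else Real.pi + Real.sinh (2 * √(-κ) * Real.pi) / (2 * √(-κ))

/-- The normalization constant of `prof`. -/
noncomputable def rho (κ : ℝ) : ℝ := profNormSq κ ^ (-(1 / 2) : ℝ)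

theorem v_eq (ω : ℝ) (n : ℕ) (x E : ℝ) :
    v ω n x E = rho (kSq ω n E) * prof (kSq ω n E) |x| := by
  unfold v rho prof profNormSq
  split_ifs <;> rfl

theorem hasDerivAt_prof (κ x : ℝ) : HasDerivAt (prof κ) (profDeriv κ x) x := by
  by_cases h : 0 ≤ κ
  · have e : prof κ = fun x => Real.cos (√κ * (x - Real.pi)) := by ext; simp [prof, h]
    rw [e, profDeriv, if_pos h]
    have := (((hasDerivAt_id x).sub_const Real.pi).const_mul √κ).cos
    refine this.congr_deriv ?_
    simp only [id_eq, mul_one]; ring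
  · have e : prof κ = fun x => Real.cosh (√(-κ) * (x - Real.pi)) := by ext; simp [prof, h]
    rw [e, profDeriv, if_neg h]
    have := (((hasDerivAt_id x).sub_const Real.pi).const_mul √(-κ)).cosh
    refine this.congr_deriv ?_
    simp only [id_eq, mul_one]; ring

theorem hasDerivAt_profDeriv (κ x : ℝ) : HasDerivAt (profDeriv κ) (-κ * prof κ x) x := by
  by_cases h : 0 ≤ κ
  · have e : profDeriv κ = fun x => -(√κ * Real.sin (√κ * (x - Real.pi))) := by
      ext; simp [profDeriv, h]
    rw [e, prof, if_pos h]
    have := ((((hasDerivAt_id x).sub_const Real.pi).const_mul √κ).sin.const_mul √κ).neg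
    refine this.congr_deriv ?_
    simp only [id_eq, mul_one]
    linear_combination (-Real.cos (√κ * (x - Real.pi))) * Real.mul_self_sqrt h
  · have e : profDeriv κ = fun x => √(-κ) * Real.sinh (√(-κ) * (x - Real.pi)) := by
      ext; simp [profDeriv, h]
    rw [e, prof, if_neg h]
    have := (((hasDerivAt_id x).sub_const Real.pi).const_mul √(-κ)).sinh.const_mul √(-κ)
    refine this.congr_deriv ?_
    simp only [id_eq, mul_one]
    linear_combination (Real.cosh (√(-κ) * (x - Real.pi))) *
      Real.mul_self_sqrt (by linarith : 0 ≤ -κ)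

@[simp] theorem prof_pi (κ : ℝ) : prof κ Real.pi = 1 := by simp [prof]

@[simp] theorem profDeriv_pi (κ : ℝ) : profDeriv κ Real.pi = 0 := by simp [profDeriv]

theorem continuous_prof (κ : ℝ) : Continuous (prof κ) :=
  continuous_iff_continuousAt.2 fun x => (hasDerivAt_prof κ x).continuousAt

theorem profNormSq_pos (κ : ℝ) : 0 < profNormSq κ := by
  unfold profNormSq
  have hpi := Real.pi_pos
  split_ifs with h
  · rcases (Real.sqrt_nonneg κ).eq_or_lt with h0 | h0
    -- At κ = 0 the quotient is 0/0 = 0, so the value is π.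
    · rw [← h0]; simp [hpi]
    · have h1 : 0 < 2 * √κ * Real.pi := by positivity
      have h2 : -(2 * √κ * Real.pi) < Real.sin (2 * √κ * Real.pi) := by
        have := Real.sin_lt h1
        have h3 := Real.neg_one_le_sin (2 * √κ * Real.pi)
        by_cases h5 : 2 * √κ * Real.pi ≤ 1
        · have := Real.sin_pos_of_pos_of_le_one h1 h5
          linarith
        · linarith
      have h3 : -Real.pi < Real.sin (2 * √κ * Real.pi) / (2 * √κ) := by
        rw [lt_div_iff₀ (by positivity)]
        linarith
      linarith
  · have : 0 < √(-κ) := Real.sqrt_pos.2 (by linarith)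
    have h1 : 0 < Real.sinh (2 * √(-κ) * Real.pi) := Real.sinh_pos_iff.2 (by positivity)
    positivity

theorem rho_pos (κ : ℝ) : 0 < rho κ := Real.rpow_pos_of_pos (profNormSq_pos κ) _

theorem rho_sq (κ : ℝ) : rho κ ^ 2 = 1 / profNormSq κ := by
  rw [rho, ← Real.rpow_natCast, ← Real.rpow_mul (profNormSq_pos κ).le, one_div (profNormSq κ),
    ← Real.rpow_neg_one]
  norm_num

/-- The boundary value that `integral_prof_sq` produces, identified with the closed form by the
double-angle formulas. -/
theorem prof_mul_profDeriv_zero {κ : ℝ} (hκ : κ ≠ 0) :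
    Real.pi * κ + prof κ 0 * profDeriv κ 0 = κ * profNormSq κ := by
  unfold prof profDeriv profNormSq
  split_ifs with h
  · have h0 : 0 < √κ := Real.sqrt_pos.2 (lt_of_le_of_ne h hκ.symm)
    have h1 : √κ * √κ = κ := Real.mul_self_sqrt h
    have h2 : √κ * (0 - Real.pi) = -(√κ * Real.pi) := by ring
    have h3 : 2 * √κ * Real.pi = 2 * (√κ * Real.pi) := by ring
    rw [h2, h3, Real.cos_neg, Real.sin_neg, Real.sin_two_mul]
    generalize Real.cos (√κ * Real.pi) = c
    generalize Real.sin (√κ * Real.pi) = s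
    field_simp
    linear_combination (c * s) * h1
  · have h0 : 0 < √(-κ) := Real.sqrt_pos.2 (by linarith)
    have h1 : √(-κ) * √(-κ) = -κ := Real.mul_self_sqrt (by linarith)
    have h2 : √(-κ) * (0 - Real.pi) = -(√(-κ) * Real.pi) := by ring
    have h3 : 2 * √(-κ) * Real.pi = 2 * (√(-κ) * Real.pi) := by ring
    rw [h2, h3, Real.cosh_neg, Real.sinh_neg, Real.sinh_two_mul]
    generalize Real.cosh (√(-κ) * Real.pi) = c
    generalize Real.sinh (√(-κ) * Real.pi) = s
    field_simp
    linear_combination (-c * s) * h1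

/-- Green's formula for two profiles. -/
theorem integral_prof_mul_prof (κ₁ κ₂ : ℝ) :
    (κ₁ - κ₂) * ∫ x in (0 : ℝ)..Real.pi, prof κ₁ x * prof κ₂ x
      = profDeriv κ₁ 0 * prof κ₂ 0 - prof κ₁ 0 * profDeriv κ₂ 0 := by
  have h : ∀ x ∈ Set.uIcc 0 Real.pi, HasDerivAt
      (fun x => prof κ₁ x * profDeriv κ₂ x - profDeriv κ₁ x * prof κ₂ x)
      ((κ₁ - κ₂) * (prof κ₁ x * prof κ₂ x)) x := by
    intro x _
    have := ((hasDerivAt_prof κ₁ x).mul (hasDerivAt_profDeriv κ₂ x)).sub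
      ((hasDerivAt_profDeriv κ₁ x).mul (hasDerivAt_prof κ₂ x))
    refine this.congr_deriv ?_
    ring
  rw [← intervalIntegral.integral_const_mul, intervalIntegral.integral_eq_sub_of_hasDerivAt h]
  · simp
  · exact (continuous_const.mul ((continuous_prof κ₁).mul
      (continuous_prof κ₂))).intervalIntegrable _ _

/-- The energy p'² + κp² is conserved and equals κ, so (x-π)(p'² + κp²) - pp' is a primitive of 2κp²
which vanishes at π. At κ = 0 the identity fails: the left side is 2π, while `profNormSq` takes the
value π. -/
theorem integral_prof_sq {κ : ℝ} (hκ : κ ≠ 0) :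
    2 * ∫ x in (0 : ℝ)..Real.pi, prof κ x * prof κ x = profNormSq κ := by
  have h : ∀ x ∈ Set.uIcc 0 Real.pi, HasDerivAt
      (fun x => (x - Real.pi) * (profDeriv κ x * profDeriv κ x + κ * (prof κ x * prof κ x))
        - prof κ x * profDeriv κ x)
      (2 * κ * (prof κ x * prof κ x)) x := by
    intro x _
    have hp := hasDerivAt_prof κ x
    have hd := hasDerivAt_profDeriv κ x
    have := (((hasDerivAt_id x).sub_const Real.pi).mul
      ((hd.mul hd).add ((hp.mul hp).const_mul κ))).sub (hp.mul hd)
    refine this.congr_deriv ?_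
    simp only [id_eq, Pi.add_apply, Pi.mul_apply]
    ring
  have h2 : 2 * κ * ∫ x in (0 : ℝ)..Real.pi, prof κ x * prof κ x
      = κ * profNormSq κ := by
    rw [← intervalIntegral.integral_const_mul, intervalIntegral.integral_eq_sub_of_hasDerivAt h]
    · rw [← prof_mul_profDeriv_zero hκ]
      have hc : profDeriv κ 0 * profDeriv κ 0 + κ * (prof κ 0 * prof κ 0) = κ := by
        unfold prof profDeriv
        split_ifs with h
        · have h1 : √κ * √κ = κ := Real.mul_self_sqrt h
          have h2 := Real.sin_sq_add_cos_sq (√κ * (0 - Real.pi))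
          linear_combination (Real.sin (√κ * (0 - Real.pi))) ^ 2 * h1 + κ * h2
        · have h1 : √(-κ) * √(-κ) = -κ := Real.mul_self_sqrt (by linarith)
          have h2 := Real.cosh_sq (√(-κ) * (0 - Real.pi))
          linear_combination (Real.sinh (√(-κ) * (0 - Real.pi))) ^ 2 * h1 + κ * h2
      rw [hc]
      simp
      ring
    · exact (continuous_const.mul ((continuous_prof κ).mul
        (continuous_prof κ))).intervalIntegrable _ _
  have h3 : κ * (2 * ∫ x in (0 : ℝ)..Real.pi, prof κ x * prof κ x) = κ * profNormSq κ := by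
    rw [← h2]; ring
  exact mul_left_cancel₀ hκ h3

theorem integral_circle_abs {g : ℝ → ℝ} (hg : Continuous g) :
    ∫ x, g |x| ∂circleMeasure = 2 * ∫ x in (0 : ℝ)..Real.pi, g x := by
  have hpi := Real.pi_pos
  have hc : Continuous fun x : ℝ => g |x| := hg.comp continuous_abs
  rw [circleMeasure, integral_Icc_eq_integral_Ioc,
    ← intervalIntegral.integral_of_le (by linarith),
    ← intervalIntegral.integral_add_adjacent_intervals (b := 0) (hc.intervalIntegrable _ _)
      (hc.intervalIntegrable _ _)]
  have h1 : ∫ x in (-Real.pi)..0, g |x| = ∫ x in (0 : ℝ)..Real.pi, g |x| := by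
    have := intervalIntegral.integral_comp_neg (fun x => g |x|) (a := 0) (b := Real.pi)
    simp only [abs_neg, neg_zero] at this
    exact this.symm
  have h2 : ∫ x in (0 : ℝ)..Real.pi, g |x| = ∫ x in (0 : ℝ)..Real.pi, g x := by
    refine intervalIntegral.integral_congr fun x hx => ?_
    rw [Set.uIcc_of_le hpi.le] at hx
    simp only [abs_of_nonneg hx.1]
  rw [h1, h2]
  ring

theorem integral_v_mul_v (ω : ℝ) (n : ℕ) (E₁ E₂ : ℝ) :
    ∫ x, v ω n x E₁ * v ω n x E₂ ∂circleMeasure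
      = rho (kSq ω n E₁) * rho (kSq ω n E₂) *
        (2 * ∫ x in (0 : ℝ)..Real.pi, prof (kSq ω n E₁) x * prof (kSq ω n E₂) x) := by
  rw [← integral_circle_abs (g := fun x => prof (kSq ω n E₁) x * prof (kSq ω n E₂) x)
    ((continuous_prof _).mul (continuous_prof _)), ← integral_const_mul]
  refine integral_congr_ae (ae_of_all _ fun x => ?_)
  simp only [v_eq]
  ring

theorem hasDerivWithinAt_v_zero (ω : ℝ) (n : ℕ) (E : ℝ) :
    HasDerivWithinAt (fun x => v ω n x E) (rho (kSq ω n E) * profDeriv (kSq ω n E) 0)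
      (Set.Ici 0) 0 := by
  have h := ((hasDerivAt_prof (kSq ω n E) 0).const_mul (rho (kSq ω n E))).hasDerivWithinAt
    (s := Set.Ici 0)
  refine h.congr (fun x hx => ?_) ?_
  · rw [v_eq, abs_of_nonneg hx]
  · rw [v_eq, abs_zero]

theorem vPrime_eq (ω : ℝ) (n : ℕ) (E : ℝ) :
    vPrime ω n E = rho (kSq ω n E) * profDeriv (kSq ω n E) 0 :=
  (hasDerivWithinAt_v_zero ω n E).derivWithin (uniqueDiffOn_Ici 0 0 Set.self_mem_Ici)

theorem v_zero_eq (ω : ℝ) (n : ℕ) (E : ℝ) :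
    v ω n 0 E = rho (kSq ω n E) * prof (kSq ω n E) 0 := by
  rw [v_eq, abs_zero]

/-- Green's formula for the normalized solutions. -/
theorem sub_mul_integral_v_mul_v (ω : ℝ) (n : ℕ) (E₁ E₂ : ℝ) :
    (E₁ - E₂) * ∫ x, v ω n x E₁ * v ω n x E₂ ∂circleMeasure
      = vPrime ω n E₁ * v ω n 0 E₂ - v ω n 0 E₁ * vPrime ω n E₂ := by
  have h := integral_prof_mul_prof (kSq ω n E₁) (kSq ω n E₂)
  have hk : kSq ω n E₁ - kSq ω n E₂ = 2 * (E₁ - E₂) := by unfold kSq; ring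
  rw [hk] at h
  rw [integral_v_mul_v, vPrime_eq, vPrime_eq, v_zero_eq, v_zero_eq]
  linear_combination rho (kSq ω n E₁) * rho (kSq ω n E₂) * h

theorem continuous_v (ω : ℝ) (n : ℕ) (E : ℝ) : Continuous fun x => v ω n x E := by
  simp only [v_eq]
  exact continuous_const.mul ((continuous_prof _).comp continuous_abs)

instance : IsFiniteMeasure circleMeasure := by unfold circleMeasure; infer_instance

theorem integrable_circle {g : ℝ → ℝ} (hg : Continuous g) : Integrable g circleMeasure :=
  hg.continuousOn.integrableOn_Icc

theorem integral_v_sq {ω : ℝ} {n : ℕ} {E : ℝ} (hκ : kSq ω n E ≠ 0) :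
    ∫ x, v ω n x E * v ω n x E ∂circleMeasure = 1 := by
  rw [integral_v_mul_v, integral_prof_sq hκ, ← sq, rho_sq, one_div,
    inv_mul_cancel₀ (profNormSq_pos _).ne']

/-- Cauchy–Schwarz for unit vectors, through 2|ab| ≤ a² + b². -/
theorem abs_integral_v_mul_v_le {ω : ℝ} {n : ℕ} {E₁ E₂ : ℝ} (h₁ : kSq ω n E₁ ≠ 0)
    (h₂ : kSq ω n E₂ ≠ 0) : |∫ x, v ω n x E₁ * v ω n x E₂ ∂circleMeasure| ≤ 1 := by
  have c₁ := continuous_v ω n E₁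
  have c₂ := continuous_v ω n E₂
  calc _ ≤ ∫ x, |v ω n x E₁ * v ω n x E₂| ∂circleMeasure := abs_integral_le_integral_abs
    _ ≤ ∫ x, (1 / 2) * (v ω n x E₁ * v ω n x E₁) + (1 / 2) * (v ω n x E₂ * v ω n x E₂)
        ∂circleMeasure := by
      refine integral_mono (integrable_circle (c₁.mul c₂).abs)
        (integrable_circle ((continuous_const.mul (c₁.mul c₁)).add
          (continuous_const.mul (c₂.mul c₂)))) fun x => ?_
      simp only
      rw [abs_le]
      constructor <;> nlinarith [sq_nonneg (v ω n x E₁ + v ω n x E₂),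
        sq_nonneg (v ω n x E₁ - v ω n x E₂)]
    _ = 1 := by
      rw [integral_add (integrable_circle (by fun_prop)) (integrable_circle (by fun_prop)),
        integral_const_mul, integral_const_mul, integral_v_sq h₁, integral_v_sq h₂]
      norm_num

end Profile

/-! ### From the recursion to formal eigenfunctions. -/

section Eigenfunction

variable {κ A : ℝ}

theorem hasDerivAt_prof_abs_of_pos {x : ℝ} (hx : 0 < x) :
    HasDerivAt (fun x => A * prof κ |x|) (A * profDeriv κ x) x := by
  refine ((hasDerivAt_prof κ x).const_mul A).congr_of_eventuallyEq ?_
  filter_upwards [eventually_gt_nhds hx] with y hy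
  rw [abs_of_pos hy]

theorem hasDerivAt_prof_abs_of_neg {x : ℝ} (hx : x < 0) :
    HasDerivAt (fun x => A * prof κ |x|) (-(A * profDeriv κ (-x))) x := by
  have h : HasDerivAt (fun x => prof κ (-x)) (profDeriv κ (-x) * -1) x :=
    (hasDerivAt_prof κ (-x)).comp x (hasDerivAt_neg x)
  have h2 := h.const_mul A
  rw [show A * (profDeriv κ (-x) * -1) = -(A * profDeriv κ (-x)) by ring] at h2
  refine h2.congr_of_eventuallyEq ?_
  filter_upwards [eventually_lt_nhds hx] with y hy
  rw [abs_of_neg hy]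

theorem hasDerivAt_deriv_prof_abs {x : ℝ} (hx : x ≠ 0) :
    HasDerivAt (deriv fun x => A * prof κ |x|) (-κ * (A * prof κ |x|)) x := by
  rcases lt_or_gt_of_ne hx with hx | hx
  · have h : HasDerivAt (fun x => profDeriv κ (-x)) (-κ * prof κ (-x) * -1) x :=
      (hasDerivAt_profDeriv κ (-x)).comp x (hasDerivAt_neg x)
    have h2 := (h.const_mul A).neg
    rw [show -(A * (-κ * prof κ (-x) * -1)) = -κ * (A * prof κ |x|) by
      rw [abs_of_neg hx]; ring] at h2
    refine h2.congr_of_eventuallyEq ?_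
    filter_upwards [eventually_lt_nhds hx] with y hy
    exact (hasDerivAt_prof_abs_of_neg hy).deriv
  · have h2 := (hasDerivAt_profDeriv κ x).const_mul A
    rw [show A * (-κ * prof κ x) = -κ * (A * prof κ |x|) by rw [abs_of_pos hx]; ring] at h2
    refine h2.congr_of_eventuallyEq ?_
    filter_upwards [eventually_gt_nhds hx] with y hy
    exact (hasDerivAt_prof_abs_of_pos hy).deriv

theorem hasDerivWithinAt_prof_abs_Ici :
    HasDerivWithinAt (fun x => A * prof κ |x|) (A * profDeriv κ 0) (Set.Ici 0) 0 := by
  refine ((hasDerivAt_prof κ 0).const_mul A).hasDerivWithinAt.congr (fun x hx => ?_) ?_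
  · rw [abs_of_nonneg hx]
  · rw [abs_zero]

theorem hasDerivWithinAt_prof_abs_Iic :
    HasDerivWithinAt (fun x => A * prof κ |x|) (-(A * profDeriv κ 0)) (Set.Iic 0) 0 := by
  have h : HasDerivAt (fun x => prof κ (-x)) (profDeriv κ (-0) * -1) 0 :=
    (hasDerivAt_prof κ (-0)).comp 0 (hasDerivAt_neg 0)
  have h2 := h.const_mul A
  rw [show A * (profDeriv κ (-0) * -1) = -(A * profDeriv κ 0) by rw [neg_zero]; ring] at h2
  refine h2.hasDerivWithinAt.congr (fun x hx => ?_) ?_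
  · rw [abs_of_nonpos hx]
  · rw [abs_zero, neg_zero]

/-- Coefficients which satisfy the difference equation give formal eigenfunctions. -/
theorem isFormalEigenfunction_of_coeff {α ω E : ℝ} (hω : 0 < ω) {c : ℕ → ℝ} (h0 : c 0 ≠ 0)
    (hinit : α * v ω 1 0 E * c 1 = √(2 * ω) * vPrime ω 0 E * c 0)
    (hrec : ∀ n : ℕ, α * √((n : ℝ) + 2) * v ω (n + 2) 0 E * c (n + 2)
      - √(2 * ω) * vPrime ω (n + 1) E * c (n + 1) + α * √((n : ℝ) + 1) * v ω n 0 E * c n = 0) :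
    IsFormalEigenfunction α ω E fun n x => c n * v ω n x E := by
  have hpi := Real.pi_pos
  have hw : ∀ n, (fun x => c n * v ω n x E)
      = fun x => (c n * rho (kSq ω n E)) * prof (kSq ω n E) |x| := by
    intro n; ext x; rw [v_eq]; ring
  -- Nonvanishing is tested at π, where the unnormalized profile is 1 for every κ. Its derivative
  -- there is 0, which gives the C¹ gluing at ±π.
  refine ⟨⟨0, Real.pi, ⟨by linarith, le_rfl⟩, ?_⟩, fun n x => ?_, fun n => ?_, fun n => ?_,
    fun n => ⟨0, ?_, ?_⟩, fun n x _ hx => ?_, fun n x _ hx => ?_, fun n x _ hx => ?_, fun n => ?_⟩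
  · rw [v_eq, abs_of_pos hpi, prof_pi, mul_one]
    exact mul_ne_zero h0 (rho_pos _).ne'
  · simp only [v_eq, abs_neg]
  · exact (continuous_const.mul (continuous_v ω n E)).continuousOn
  · simp only [v_eq, abs_neg]
  · simp only [hw]
    have := hasDerivAt_prof_abs_of_pos (A := c n * rho (kSq ω n E)) (κ := kSq ω n E) hpi
    rw [profDeriv_pi, mul_zero] at this
    exact this.hasDerivWithinAt
  · simp only [hw]
    have := hasDerivAt_prof_abs_of_neg (A := c n * rho (kSq ω n E)) (κ := kSq ω n E)
      (neg_lt_zero.2 hpi)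
    rw [neg_neg, profDeriv_pi, mul_zero, neg_zero] at this
    exact this.hasDerivWithinAt
  · simp only [hw]
    rcases lt_or_gt_of_ne hx with hx | hx
    · exact (hasDerivAt_prof_abs_of_neg hx).differentiableAt
    · exact (hasDerivAt_prof_abs_of_pos hx).differentiableAt
  · simp only [hw]
    exact (hasDerivAt_deriv_prof_abs hx).differentiableAt
  · have h2 := congrFun (hw n) x
    rw [h2]
    simp only [hw]
    rw [(hasDerivAt_deriv_prof_abs hx).deriv]
    have : kSq ω n E = 2 * E - (2 * n + 1) * ω := rfl
    linear_combination (1 / 2) * c n * rho (kSq ω n E) * prof (kSq ω n E) |x| * this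
  -- By evenness the left derivative is minus the right one, so the jump is twice the right
  -- derivative; this accounts for the factor -2 in the combinations below.
  · refine ⟨c n * vPrime ω n E, -(c n * vPrime ω n E), ?_, ?_, ?_⟩
    · simp only [hw, vPrime_eq, ← mul_assoc]
      exact hasDerivWithinAt_prof_abs_Ici
    · simp only [hw, vPrime_eq, ← mul_assoc]
      exact hasDerivWithinAt_prof_abs_Iic
    · have hs : (2 * ω) ^ (-(1 / 2) : ℝ) = (√(2 * ω))⁻¹ := by
        rw [Real.rpow_neg (by positivity), Real.sqrt_eq_rpow]
      have hs0 : 0 < √(2 * ω) := Real.sqrt_pos.2 (by positivity)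
      rw [hs]
      rcases n with _ | n
      · simp only [if_true, CharP.cast_eq_zero, zero_add, Real.sqrt_one]
        field_simp
        linear_combination (-2) * hinit
      · have h := hrec n
        simp only [Nat.succ_ne_zero, if_false, Nat.add_sub_cancel]
        have e1 : ((n + 1 : ℕ) : ℝ) = (n : ℝ) + 1 := by push_cast; ring
        have e2 : (n : ℝ) + 1 + 1 = n + 2 := by ring
        rw [e1, e2, add_assoc n 1 1, one_add_one_eq_two]
        field_simp
        linear_combination (-2) * h

end Eigenfunction
-- The exceptional set and continuity in the energy away from it.
section Energies

theorem kSq_ne_zero {ω E : ℝ} (hE : E ∉ exceptional ω) (n : ℕ) : kSq ω n E ≠ 0 := by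
  intro h
  refine hE (Or.inr ⟨n, ?_⟩)
  unfold kSq at h
  linarith

theorem prof_zero_of_pos {κ : ℝ} (h : 0 ≤ κ) : prof κ 0 = Real.cos (√κ * Real.pi) := by
  rw [prof, if_pos h, ← Real.cos_neg]
  congr 1; ring

theorem prof_zero_of_neg {κ : ℝ} (h : κ < 0) : prof κ 0 = Real.cosh (√(-κ) * Real.pi) := by
  rw [prof, if_neg (not_le.2 h), ← Real.cosh_neg]
  congr 1; ring

theorem profDeriv_zero_of_neg {κ : ℝ} (h : κ < 0) :
    profDeriv κ 0 = -(√(-κ) * Real.sinh (√(-κ) * Real.pi)) := by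
  rw [profDeriv, if_neg (not_le.2 h), ← mul_neg, ← Real.sinh_neg]
  congr 2; ring

/-- Zeros of cos(kπ) are exactly the half-integers k, and cosh has none. In this form membership is
a condition on each level separately, open in the energy. -/
theorem notMem_exceptional_iff {ω E : ℝ} :
    E ∉ exceptional ω ↔ ∀ n : ℕ, kSq ω n E ≠ 0 ∧ prof (kSq ω n E) 0 ≠ 0 := by
  constructor
  · intro hE n
    refine ⟨kSq_ne_zero hE n, fun h0 => ?_⟩
    rcases lt_or_ge (kSq ω n E) 0 with h | h
    · rw [prof_zero_of_neg h] at h0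
      exact (Real.cosh_pos _).ne' h0
    · rw [prof_zero_of_pos h, Real.cos_eq_zero_iff] at h0
      obtain ⟨k, hk⟩ := h0
      have h1 : √(kSq ω n E) = k + 1 / 2 := by
        have hpi := Real.pi_pos.ne'
        field_simp at hk
        linarith
      have h2 := Real.sq_sqrt h
      rw [h1] at h2
      refine hE (Or.inl ⟨n, k, ?_⟩)
      rw [h2]
      unfold kSq
      ring
  · rintro h (⟨n, r, hr⟩ | ⟨n, hn⟩)
    · have h1 : kSq ω n E = ((r : ℝ) + 1 / 2) ^ 2 := by unfold kSq; linarith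
      refine (h n).2 ?_
      rw [h1, prof_zero_of_pos (sq_nonneg _), Real.sqrt_sq_eq_abs, ← abs_of_pos Real.pi_pos,
        ← abs_mul, Real.cos_abs, Real.cos_eq_zero_iff]
      exact ⟨r, by ring⟩
    · refine (h n).1 ?_
      unfold kSq
      rw [hn]; ring

theorem v_zero_ne_zero {ω E : ℝ} (hE : E ∉ exceptional ω) (n : ℕ) : v ω n 0 E ≠ 0 := by
  rw [v_zero_eq]
  exact mul_ne_zero (rho_pos _).ne' (notMem_exceptional_iff.1 hE n).2

/-- Off κ = 0 only one branch of the definition is active nearby; excluding the thresholds from the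
energies is what makes this enough. -/
theorem continuousAt_prof {κ : ℝ} (hκ : κ ≠ 0) (x : ℝ) :
    ContinuousAt (fun p : ℝ × ℝ => prof p.1 p.2) (κ, x) := by
  rcases lt_or_gt_of_ne hκ with h | h
  · have hc : Continuous fun p : ℝ × ℝ => Real.cosh (√(-p.1) * (p.2 - Real.pi)) := by fun_prop
    refine hc.continuousAt.congr ?_
    filter_upwards [(continuous_fst.tendsto (κ, x)).eventually (eventually_lt_nhds h)] with p hp
    rw [prof, if_neg (not_le.2 hp)]
  · have hc : Continuous fun p : ℝ × ℝ => Real.cos (√p.1 * (p.2 - Real.pi)) := by fun_prop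
    refine hc.continuousAt.congr ?_
    filter_upwards [(continuous_fst.tendsto (κ, x)).eventually (eventually_gt_nhds h)] with p hp
    rw [prof, if_pos (le_of_lt hp)]

theorem continuousAt_profDeriv_zero {κ : ℝ} (hκ : κ ≠ 0) :
    ContinuousAt (fun κ => profDeriv κ 0) κ := by
  rcases lt_or_gt_of_ne hκ with h | h
  · have hc : Continuous fun κ : ℝ => √(-κ) * Real.sinh (√(-κ) * (0 - Real.pi)) := by fun_prop
    refine hc.continuousAt.congr ?_
    filter_upwards [eventually_lt_nhds h] with p hp
    rw [profDeriv, if_neg (not_le.2 hp)]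
  · have hc : Continuous fun κ : ℝ => -(√κ * Real.sin (√κ * (0 - Real.pi))) := by fun_prop
    refine hc.continuousAt.congr ?_
    filter_upwards [eventually_gt_nhds h] with p hp
    rw [profDeriv, if_pos (le_of_lt hp)]

theorem continuousAt_rho {κ : ℝ} (hκ : κ ≠ 0) : ContinuousAt rho κ := by
  have h : ContinuousAt profNormSq κ := by
    rcases lt_or_gt_of_ne hκ with h | h
    · have hc : ContinuousAt
          (fun κ : ℝ => Real.pi + Real.sinh (2 * √(-κ) * Real.pi) / (2 * √(-κ))) κ := by
        have : 2 * √(-κ) ≠ 0 := by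
          have := Real.sqrt_pos.2 (neg_pos.2 h); positivity
        refine ContinuousAt.add (by fun_prop) (ContinuousAt.div (by fun_prop) (by fun_prop) this)
      refine hc.congr ?_
      filter_upwards [eventually_lt_nhds h] with p hp
      rw [profNormSq, if_neg (not_le.2 hp)]
    · have hc : ContinuousAt
          (fun κ : ℝ => Real.pi + Real.sin (2 * √κ * Real.pi) / (2 * √κ)) κ := by
        have : 2 * √κ ≠ 0 := by
          have := Real.sqrt_pos.2 h; positivity
        refine ContinuousAt.add (by fun_prop) (ContinuousAt.div (by fun_prop) (by fun_prop) this)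
      refine hc.congr ?_
      filter_upwards [eventually_gt_nhds h] with p hp
      rw [profNormSq, if_pos (le_of_lt hp)]
  exact h.rpow_const (Or.inl (profNormSq_pos κ).ne')

theorem continuous_kSq (ω : ℝ) (n : ℕ) : Continuous (kSq ω n) := by
  unfold kSq; fun_prop

theorem isOpen_setOf_prof_ne_zero : IsOpen {κ : ℝ | κ ≠ 0 ∧ prof κ 0 ≠ 0} := by
  rw [isOpen_iff_mem_nhds]
  rintro κ ⟨h1, h2⟩
  have hc : ContinuousAt (fun κ => prof κ 0) κ :=
    (continuousAt_prof h1 0).comp (f := fun κ : ℝ => (κ, (0 : ℝ))) (by fun_prop)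
  exact (eventually_ne_nhds h1).and (hc.eventually_ne h2)

theorem kSq_neg {ω E : ℝ} {n : ℕ} (hω : 0 < ω) (h : E / ω ≤ n) : kSq ω n E < 0 := by
  rw [div_le_iff₀ hω] at h
  unfold kSq
  linarith

/-- Locally in E all but finitely many levels are hyperbolic, hence never exceptional; the remaining
ones impose finitely many open conditions. -/
theorem isClosed_exceptional {ω : ℝ} (hω : 0 < ω) : IsClosed (exceptional ω) := by
  rw [← isOpen_compl_iff, isOpen_iff_mem_nhds]
  intro E hE
  -- The margin 1 makes the levels n ≥ N hyperbolic for every E' < E + 1.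
  obtain ⟨N, hN⟩ := exists_nat_ge ((E + 1) / ω)
  have h1 : ∀ᶠ E' in 𝓝 E, ∀ n ∈ Finset.range N, kSq ω n E' ≠ 0 ∧ prof (kSq ω n E') 0 ≠ 0 := by
    rw [Finset.eventually_all]
    intro n _
    exact ((isOpen_setOf_prof_ne_zero.preimage (continuous_kSq ω n)).mem_nhds
      (notMem_exceptional_iff.1 hE n))
  filter_upwards [h1, eventually_lt_nhds (lt_add_one E)] with E' h2 h3
  rw [Set.mem_compl_iff, notMem_exceptional_iff]
  intro n
  by_cases hn : n < N
  · exact h2 n (Finset.mem_range.2 hn)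
  · have h4 : kSq ω n E' < 0 := by
      refine kSq_neg hω (le_trans ?_ (hN.trans (by exact_mod_cast not_lt.1 hn)))
      gcongr
    refine ⟨h4.ne, ?_⟩
    rw [prof_zero_of_neg h4]
    exact (Real.cosh_pos _).ne'

theorem countable_exceptional (ω : ℝ) : (exceptional ω).Countable := by
  refine Set.Countable.union ?_ ?_
  · have : {E : ℝ | ∃ (n : ℕ) (r : ℤ), 2 * E = (2 * n + 1) * ω + ((r : ℝ) + 1 / 2) ^ 2}
        ⊆ Set.range fun p : ℕ × ℤ => ((2 * p.1 + 1) * ω + ((p.2 : ℝ) + 1 / 2) ^ 2) / 2 := by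
      rintro E ⟨n, r, h⟩
      exact ⟨(n, r), by simp only; linarith⟩
    exact (Set.countable_range _).mono this
  · have : {E : ℝ | ∃ n : ℕ, E = ((n : ℝ) + 1 / 2) * ω}
        ⊆ Set.range fun n : ℕ => ((n : ℝ) + 1 / 2) * ω := by
      rintro E ⟨n, h⟩
      exact ⟨n, h.symm⟩
    exact (Set.countable_range _).mono this

theorem continuousOn_v (ω : ℝ) (n : ℕ) :
    ContinuousOn (fun p : ℝ × ℝ => v ω n p.1 p.2) (Set.univ ×ˢ (exceptional ω)ᶜ) := by
  rintro ⟨x, E⟩ ⟨-, hE⟩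
  refine ContinuousAt.continuousWithinAt ?_
  have hκ := kSq_ne_zero hE n
  have hk : ContinuousAt (fun p : ℝ × ℝ => kSq ω n p.2) (x, E) :=
    ((continuous_kSq ω n).comp continuous_snd).continuousAt
  simp only [v_eq]
  refine ContinuousAt.mul ?_ ?_
  · exact ContinuousAt.comp (g := rho) (continuousAt_rho hκ) hk
  · exact ContinuousAt.comp (g := fun p : ℝ × ℝ => prof p.1 p.2)
      (f := fun p : ℝ × ℝ => (kSq ω n p.2, |p.1|)) (continuousAt_prof hκ |x|)
      (hk.prodMk (by fun_prop))

theorem continuousOn_v_zero (ω : ℝ) (n : ℕ) :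
    ContinuousOn (fun E => v ω n 0 E) (exceptional ω)ᶜ :=
  (continuousOn_v ω n).comp (f := fun E : ℝ => ((0 : ℝ), E)) (by fun_prop)
    fun _ hE => ⟨Set.mem_univ _, hE⟩

theorem continuousOn_vPrime (ω : ℝ) (n : ℕ) : ContinuousOn (vPrime ω n) (exceptional ω)ᶜ := by
  intro E hE
  refine ContinuousAt.continuousWithinAt ?_
  have hκ := kSq_ne_zero hE n
  have hk : ContinuousAt (kSq ω n) E := (continuous_kSq ω n).continuousAt
  have e : vPrime ω n = fun E => rho (kSq ω n E) * profDeriv (kSq ω n E) 0 :=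
    funext fun E => vPrime_eq ω n E
  rw [e]
  exact ContinuousAt.mul (ContinuousAt.comp (g := rho) (continuousAt_rho hκ) hk)
    (ContinuousAt.comp (g := fun κ => profDeriv κ 0) (continuousAt_profDeriv_zero hκ) hk)

end Energies

/-! ### Expansion of the recursion coefficients and of v_n(0) at high levels. -/

section LargeLevels

theorem exp_neg_two_mul_le {z : ℝ} (hz : 0 < z) (k : ℕ) :
    Real.exp (-(2 * z)) ≤ k.factorial / (2 * z) ^ k := by
  have h := Real.pow_div_factorial_le_exp (2 * z) (by positivity) k
  rw [Real.exp_neg, inv_le_comm₀ (Real.exp_pos _) (by positivity), inv_div]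
  exact h

theorem one_sub_tanh_le {z : ℝ} : 0 ≤ 1 - Real.sinh z / Real.cosh z ∧
    1 - Real.sinh z / Real.cosh z ≤ 2 * Real.exp (-(2 * z)) := by
  have hc := Real.cosh_pos z
  have h1 : 1 - Real.sinh z / Real.cosh z = Real.exp (-z) / Real.cosh z := by
    rw [← Real.cosh_sub_sinh]; field_simp
  rw [h1]
  refine ⟨by positivity, ?_⟩
  rw [div_le_iff₀ hc]
  have h2 : Real.exp z / 2 ≤ Real.cosh z := by
    rw [Real.cosh_eq]; have := Real.exp_pos (-z); linarith
  calc Real.exp (-z) = 2 * Real.exp (-(2 * z)) * (Real.exp z / 2) := by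
        rw [show -z = -(2 * z) + z by ring, Real.exp_add]; ring
    _ ≤ _ := by gcongr

/-- The quotient is -χ tanh(χπ), so the error is exponentially small. Only χ⁻³ is kept, since it
matches the n^(-3/2) of `CoeffBound`. -/
theorem logDeriv_prof_add_le {χ : ℝ} (hχ : 0 < χ) :
    |profDeriv (-χ ^ 2) 0 / prof (-χ ^ 2) 0 + χ| ≤ 3 / χ ^ 3 := by
  have hκ : -χ ^ 2 < 0 := by have : 0 < χ ^ 2 := by positivity
                             linarith
  have hs : √(-(-χ ^ 2)) = χ := by rw [neg_neg, Real.sqrt_sq hχ.le]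
  rw [profDeriv_zero_of_neg hκ, prof_zero_of_neg hκ, hs]
  have hpi : 1 ≤ Real.pi := by linarith [Real.pi_gt_three]
  have hz : 0 < χ * Real.pi := by positivity
  obtain ⟨h0, h1⟩ := one_sub_tanh_le (z := χ * Real.pi)
  have h2 := exp_neg_two_mul_le hz 4
  have h3 : (Nat.factorial 4 : ℝ) / (2 * (χ * Real.pi)) ^ 4 ≤ 3 / 2 / χ ^ 4 := by
    have : (Nat.factorial 4 : ℝ) = 24 := by norm_num [Nat.factorial]
    rw [this, div_le_div_iff₀ (by positivity) (by positivity)]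
    have : (1 : ℝ) ≤ Real.pi ^ 4 := one_le_pow₀ hpi
    have h4 : (0 : ℝ) ≤ χ ^ 4 := by positivity
    nlinarith
  have e : -(χ * Real.sinh (χ * Real.pi)) / Real.cosh (χ * Real.pi) + χ
      = χ * (1 - Real.sinh (χ * Real.pi) / Real.cosh (χ * Real.pi)) := by ring
  rw [e, abs_of_nonneg (by positivity)]
  calc _ ≤ χ * (2 * (3 / 2 / χ ^ 4)) := by gcongr; linarith
    _ = _ := by field_simp

/-- With z = χπ the squared norm is (z + sinh z cosh z)/χ. Hence v² X = χ for X = z/cosh² z + tanh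
z, which is exponentially close to 1. -/
theorem v_zero_sq_eq {ω E χ : ℝ} {n : ℕ} (hχ : 0 < χ) (h : kSq ω n E = -χ ^ 2) :
    0 < v ω n 0 E ∧ ∃ X : ℝ, |X - 1| ≤ 4 / χ ^ 2 ∧ v ω n 0 E ^ 2 * X = χ := by
  have hκ : -χ ^ 2 < 0 := by have : 0 < χ ^ 2 := by positivity
                             linarith
  have hs : √(-(-χ ^ 2)) = χ := by rw [neg_neg, Real.sqrt_sq hχ.le]
  have hc := Real.cosh_pos (χ * Real.pi)
  rw [v_zero_eq, h, prof_zero_of_neg hκ, hs]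
  refine ⟨mul_pos (rho_pos _) hc, ?_⟩
  have hpi : 1 ≤ Real.pi := by linarith [Real.pi_gt_three]
  have hz : 0 < χ * Real.pi := by positivity
  set z := χ * Real.pi with hzdef
  obtain ⟨h0, h1⟩ := one_sub_tanh_le (z := z)
  have hz2 : χ ≤ z := by nlinarith
  have hN : profNormSq (-χ ^ 2) = (z + Real.sinh z * Real.cosh z) / χ := by
    rw [profNormSq, if_neg (not_le.2 hκ), hs, show 2 * χ * Real.pi = 2 * z by rw [hzdef]; ring,
      Real.sinh_two_mul]
    rw [hzdef]
    field_simp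
  have hNp : 0 < z + Real.sinh z * Real.cosh z := by
    have := Real.sinh_pos_iff.2 hz; positivity
  refine ⟨z / Real.cosh z ^ 2 + Real.sinh z / Real.cosh z, ?_, ?_⟩
  · have h2 : z / Real.cosh z ^ 2 ≤ 4 * z * Real.exp (-(2 * z)) := by
      rw [div_le_iff₀ (by positivity)]
      have h3 : Real.exp z / 2 ≤ Real.cosh z := by
        rw [Real.cosh_eq]; have := Real.exp_pos (-z); linarith
      calc z = 4 * z * Real.exp (-(2 * z)) * (Real.exp z / 2) ^ 2 := by
            rw [div_pow, ← Real.exp_nat_mul, mul_div_assoc', mul_assoc, ← Real.exp_add]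
            push_cast
            rw [show -(2 * z) + 2 * z = 0 by ring, Real.exp_zero]
            ring
        _ ≤ _ := by gcongr
    -- Power 3 absorbs the extra factor z in z/cosh² z; power 2 suffices for 1 - tanh z.
    have h4 := exp_neg_two_mul_le hz 3
    have h5 := exp_neg_two_mul_le hz 2
    have f3 : (Nat.factorial 3 : ℝ) = 6 := by norm_num [Nat.factorial]
    have f2 : (Nat.factorial 2 : ℝ) = 2 := by norm_num [Nat.factorial]
    rw [f3] at h4
    rw [f2] at h5
    have h6 : 4 * z * Real.exp (-(2 * z)) ≤ 3 / χ ^ 2 := by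
      calc _ ≤ 4 * z * (6 / (2 * z) ^ 3) := by gcongr
        _ = 3 / z ^ 2 := by ring_nf; field_simp
        _ ≤ _ := by gcongr
    have h7 : 2 * Real.exp (-(2 * z)) ≤ 1 / χ ^ 2 := by
      calc _ ≤ 2 * (2 / (2 * z) ^ 2) := by gcongr
        _ = 1 / z ^ 2 := by field_simp
        _ ≤ _ := by gcongr
    have h8 : 0 ≤ z / Real.cosh z ^ 2 := by positivity
    have h9 : (0 : ℝ) ≤ 1 / χ ^ 2 := by positivity
    have e3 : 3 / χ ^ 2 = 3 * (1 / χ ^ 2) := by ring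
    have e4 : 4 / χ ^ 2 = 4 * (1 / χ ^ 2) := by ring
    rw [abs_le]
    constructor <;> linarith
  · rw [mul_pow, rho_sq, hN]
    field_simp

theorem abs_sqrt_one_add_sub_le {s : ℝ} (hs : -1 ≤ s) : |√(1 + s) - 1 - s / 2| ≤ s ^ 2 / 2 := by
  have h1 : √(1 + s) ^ 2 = 1 + s := Real.sq_sqrt (by linarith)
  have h0 := Real.sqrt_nonneg (1 + s)
  have h2 : |√(1 + s) - 1| ≤ |s| := by
    have : (√(1 + s) - 1) * (√(1 + s) + 1) = s := by linear_combination h1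
    calc |√(1 + s) - 1| ≤ |√(1 + s) - 1| * |√(1 + s) + 1| := by
          refine le_mul_of_one_le_right (abs_nonneg _) ?_
          rw [abs_of_nonneg (a := √(1 + s) + 1) (by linarith)]
          linarith
      _ = |s| := by rw [← abs_mul, this]
  have e : √(1 + s) - 1 - s / 2 = -((√(1 + s) - 1) ^ 2 / 2) := by linear_combination (1 / 2) * h1
  rw [e, abs_neg, abs_of_nonneg (by positivity)]
  have := sq_le_sq.2 h2
  linarith

/-- The coefficients of the difference equation for `v_n(0) C(n)`. -/
noncomputable def jacobiCoeff (α ω : ℝ) (E : ℝ) (n : ℕ) : ℝ :=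
  √(2 * ω) / α * (vPrime ω n E / v ω n 0 E)

theorem jacobiCoeff_eq (α ω E : ℝ) (n : ℕ) : jacobiCoeff α ω E n =
    √(2 * ω) / α * (profDeriv (kSq ω n E) 0 / prof (kSq ω n E) 0) := by
  rw [jacobiCoeff, vPrime_eq, v_zero_eq, mul_div_mul_left _ _ (rho_pos _).ne']

/-- All dependence on the energy at high levels is carried by the small parameter s in χ² =
2ωn(1+s). The bounds are uniform for |E| ≤ R. -/
theorem exists_chi {ω : ℝ} (hω : 0 < ω) (R : ℝ) : ∃ N : ℕ, 1 ≤ N ∧ ∀ n, N ≤ n → ∀ E : ℝ, |E| ≤ R →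
    ∃ χ s : ℝ, 0 < χ ∧ kSq ω n E = -χ ^ 2 ∧ s = (ω - 2 * E) / (2 * ω * n) ∧
      χ ^ 2 = 2 * ω * n * (1 + s) ∧ |s| ≤ (ω + 2 * R) / (2 * ω) / n ∧ |s| ≤ 1 / 2 := by
  obtain ⟨N, hN⟩ := exists_nat_ge ((ω + 2 * R) / ω)
  refine ⟨max N 1, le_max_right _ _, fun n hn E hE => ?_⟩
  have hn0 : (0 : ℝ) < n := by exact_mod_cast (le_max_right N 1).trans hn
  have hNn : (ω + 2 * R) / ω ≤ n := hN.trans (by exact_mod_cast (le_max_left N 1).trans hn)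
  rw [div_le_iff₀ hω] at hNn
  have hs1 : |(ω - 2 * E) / (2 * ω * n)| ≤ (ω + 2 * R) / (2 * ω) / n := by
    rw [abs_div, abs_of_pos (a := 2 * ω * n) (by positivity), div_div]
    gcongr
    have := abs_le.1 hE
    rw [abs_le]; constructor <;> linarith
  have hs2 : (ω + 2 * R) / (2 * ω) / n ≤ 1 / 2 := by
    rw [div_div, div_le_div_iff₀ (by positivity) two_pos]
    linarith
  have hs3 := hs1.trans hs2
  have hpos : 0 < 2 * ω * n * (1 + (ω - 2 * E) / (2 * ω * n)) := by
    have := (abs_le.1 hs3).1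
    have : 0 < 1 + (ω - 2 * E) / (2 * ω * n) := by linarith
    positivity
  refine ⟨√(2 * ω * n * (1 + (ω - 2 * E) / (2 * ω * n))), _, Real.sqrt_pos.2 hpos, ?_, rfl,
    Real.sq_sqrt hpos.le, hs1, hs3⟩
  rw [Real.sq_sqrt hpos.le]
  unfold kSq
  field_simp
  ring

theorem cos_theta {α ω : ℝ} (hω : 0 < ω) (hα : ω < α) : Real.cos (theta α ω) = -(ω / α) := by
  have h0 : 0 < α := hω.trans hα
  have h1 : ω / α ≤ 1 := by rw [div_le_one h0]; exact hα.le
  have h2 : 0 ≤ ω / α := by positivity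
  exact Real.cos_arccos (by linarith) (by linarith)

theorem sqrt_sq_sub_pos {α ω : ℝ} (hω : 0 < ω) (hα : ω < α) : 0 < √(α ^ 2 - ω ^ 2) :=
  Real.sqrt_pos.2 (by nlinarith)

theorem sin_theta {α ω : ℝ} (hω : 0 < ω) (hα : ω < α) :
    Real.sin (theta α ω) = √(α ^ 2 - ω ^ 2) / α := by
  have h0 : 0 < α := hω.trans hα
  rw [theta, Real.sin_arccos]
  have : 1 - (-(ω / α)) ^ 2 = (α ^ 2 - ω ^ 2) / α ^ 2 := by field_simp
  rw [this, Real.sqrt_div' _ (by positivity), Real.sqrt_sq h0.le]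

theorem sin_theta_pos {α ω : ℝ} (hω : 0 < ω) (hα : ω < α) : 0 < Real.sin (theta α ω) := by
  rw [sin_theta hω hα]
  exact div_pos (sqrt_sq_sub_pos hω hα) (hω.trans hα)

/-- This explains θ and λ: b_n is close to -(√(2ω)/α) χ = -(2ω/α) √n √(1+s), and √(1+s) is 1 + s/2 +
O(n⁻²). The constant term forces cos θ = -ω/α. The 1/n term splits into cos θ/2 and E/α, and 2λ sin
θ = 1/α. -/
theorem exists_coeffBound {α ω : ℝ} (hω : 0 < ω) (hα : ω < α) (R : ℝ) :
    ∃ (B : ℝ) (N : ℕ), ∀ n, N ≤ n → ∀ E : ℝ, |E| ≤ R →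
      CoeffBound (theta α ω) (lam α ω * E) B (jacobiCoeff α ω E) n := by
  have hα0 : 0 < α := hω.trans hα
  obtain ⟨N, hN1, hN⟩ := exists_chi hω R
  set S := (ω + 2 * R) / (2 * ω)
  refine ⟨√(2 * ω) / α * (3 / ω ^ (3 / 2 : ℝ)) + ω / α * S ^ 2, N, fun n hn E hE => ?_⟩
  obtain ⟨χ, s, hχ, hκ, hs, hχ2, hs1, hs2⟩ := hN n hn E hE
  have hn0 : (0 : ℝ) < n := by exact_mod_cast hN1.trans hn
  have hsn := abs_le.1 hs2
  have hlin : 2 * Real.cos (theta α ω) + (Real.cos (theta α ω) / 2 +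
      2 * (lam α ω * E) * Real.sin (theta α ω)) / n = -(2 * ω / α) * (1 + s / 2) := by
    have hq := (sqrt_sq_sub_pos hω hα).ne'
    rw [cos_theta hω hα, sin_theta hω hα, lam, hs]
    field_simp
    ring
  have hχe : √(2 * ω) * χ = 2 * ω * √n * √(1 + s) := by
    have h1 : χ = √(2 * ω * n * (1 + s)) := by rw [← hχ2, Real.sqrt_sq hχ.le]
    rw [h1, Real.sqrt_mul (x := 2 * ω * n) (by positivity),
      Real.sqrt_mul (x := 2 * ω) (by positivity)]
    have := Real.mul_self_sqrt (show 0 ≤ 2 * ω by positivity)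
    linear_combination (√n * √(1 + s)) * this
  have hχ3 : 3 / χ ^ 3 ≤ 3 / ω ^ (3 / 2 : ℝ) * (n : ℝ) ^ (-(3 / 2) : ℝ) := by
    have h1 : ω * n ≤ χ ^ 2 := by
      rw [hχ2]
      have : 0 < ω * n := by positivity
      nlinarith
    have h2 : (ω * n) ^ (3 / 2 : ℝ) ≤ χ ^ 3 := by
      calc _ ≤ (χ ^ 2) ^ (3 / 2 : ℝ) := by gcongr
        _ = χ ^ 3 := by
          rw [← Real.rpow_natCast, ← Real.rpow_mul hχ.le, ← Real.rpow_natCast]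
          norm_num
    rw [Real.mul_rpow hω.le hn0.le] at h2
    rw [Real.rpow_neg hn0.le, ← div_eq_mul_inv, div_div]
    gcongr
  have h1 := logDeriv_prof_add_le hχ
  have h2 := abs_sqrt_one_add_sub_le (by linarith : -1 ≤ s)
  unfold CoeffBound
  rw [hlin, jacobiCoeff_eq, hκ]
  set τ := profDeriv (-χ ^ 2) 0 / prof (-χ ^ 2) 0
  have e : √(2 * ω) / α * τ - √n * (-(2 * ω / α) * (1 + s / 2))
      = √(2 * ω) / α * (τ + χ) - 2 * ω / α * √n * (√(1 + s) - 1 - s / 2) := by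
    linear_combination (-1 / α) * hχe
  have hs3 : s ^ 2 ≤ (S / n) ^ 2 := by
    rw [← sq_abs s]; gcongr
  have hp : √(n : ℝ) * (1 / n) ^ 2 = (n : ℝ) ^ (-(3 / 2) : ℝ) := by
    rw [Real.sqrt_eq_rpow, one_div (n : ℝ), inv_pow, ← Real.rpow_natCast, ← Real.rpow_neg hn0.le,
      ← Real.rpow_add hn0]
    norm_num
  rw [e]
  calc _ ≤ |√(2 * ω) / α * (τ + χ)| + |2 * ω / α * √n * (√(1 + s) - 1 - s / 2)| := abs_sub _ _
    _ = √(2 * ω) / α * |τ + χ| + 2 * ω / α * √n * |√(1 + s) - 1 - s / 2| := by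
      rw [abs_mul, abs_mul, abs_of_nonneg (a := √(2 * ω) / α) (by positivity),
        abs_of_nonneg (a := 2 * ω / α * √n) (by positivity)]
    _ ≤ √(2 * ω) / α * (3 / ω ^ (3 / 2 : ℝ) * (n : ℝ) ^ (-(3 / 2) : ℝ)) +
        2 * ω / α * √n * ((S / n) ^ 2 / 2) := by
      gcongr
      · exact h1.trans hχ3
      · linarith
    _ = _ := by
      rw [add_mul, ← hp]
      ring

theorem abs_rpow_quarter_sub_le {q : ℝ} (hq : 0 ≤ q) : |q ^ (1 / 4 : ℝ) - 1| ≤ |q - 1| := by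
  set r := q ^ (1 / 4 : ℝ) with hr
  have h0 : 0 ≤ r := Real.rpow_nonneg hq _
  have h4 : r ^ 4 = q := by
    rw [hr, ← Real.rpow_natCast, ← Real.rpow_mul hq]; norm_num
  have e : q - 1 = (r - 1) * (r ^ 3 + r ^ 2 + r + 1) := by rw [← h4]; ring
  rw [e, abs_mul]
  refine le_mul_of_one_le_right (abs_nonneg _) ?_
  rw [abs_of_nonneg (by positivity)]
  have : 0 ≤ r ^ 3 + r ^ 2 + r := by positivity
  linarith

/-- By v² X = χ, the number q = 2ωn · v⁻⁴ equals X²/(1+s), which is 1 + O(1/n); its fourth root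
compares v⁻¹ with (2ωn)^(-1/4). -/
theorem exists_v_zero_asymptotics {ω : ℝ} (hω : 0 < ω) (R : ℝ) :
    ∃ (C : ℝ) (N : ℕ), 0 ≤ C ∧ 1 ≤ N ∧ ∀ n, N ≤ n → ∀ E : ℝ, |E| ≤ R →
      0 < v ω n 0 E ∧
      |(v ω n 0 E)⁻¹ - (2 * ω) ^ (-(1 / 4) : ℝ) * (n : ℝ) ^ (-(1 / 4) : ℝ)|
        ≤ C * (n : ℝ) ^ (-(5 / 4) : ℝ) ∧
      (v ω n 0 E)⁻¹ ≤ C * (n : ℝ) ^ (-(1 / 4) : ℝ) ∧ v ω n 0 E ≤ C * (n : ℝ) ^ (1 / 4 : ℝ) := by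
  obtain ⟨N₀, hN₀1, hN₀⟩ := exists_chi hω R
  set S := |(ω + 2 * R) / (2 * ω)| with hS
  set D := 2 * (3 * (4 / ω) + S) with hD
  have hD0 : 0 ≤ D := by positivity
  obtain ⟨N₁, hN₁⟩ := exists_nat_ge (4 / ω)
  obtain ⟨N₂, hN₂⟩ := exists_nat_ge (2 * D)
  set K := (2 * ω) ^ (-(1 / 4) : ℝ) with hK
  have hK0 : 0 < K := by positivity
  refine ⟨K * D + 2 * K + 2 / K, max N₀ (max N₁ N₂), by positivity,
    hN₀1.trans (le_max_left _ _), fun n hn E hE => ?_⟩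
  obtain ⟨χ, s, hχ, hκ, hs, hχ2, hs1, hs2⟩ := hN₀ n ((le_max_left _ _).trans hn) E hE
  have hn0 : (0 : ℝ) < n := by exact_mod_cast hN₀1.trans ((le_max_left _ _).trans hn)
  have hn1 : 4 / ω ≤ n := hN₁.trans (by
    exact_mod_cast (le_max_left N₁ N₂).trans ((le_max_right _ _).trans hn))
  have hn2 : 2 * D ≤ n := hN₂.trans (by
    exact_mod_cast (le_max_right N₁ N₂).trans ((le_max_right _ _).trans hn))
  have hsn := abs_le.1 hs2
  obtain ⟨hv, X, hX, hvX⟩ := v_zero_sq_eq hχ hκ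
  set w := v ω n 0 E with hw
  have hχn : ω * n ≤ χ ^ 2 := by
    rw [hχ2]
    have : 0 < ω * n := by positivity
    nlinarith
  have hX1 : |X - 1| ≤ 4 / ω / n := by
    refine hX.trans ?_
    rw [div_div]
    gcongr
  have hX2 : |X - 1| ≤ 1 := by
    refine hX1.trans ?_
    rw [div_le_one hn0]
    exact hn1
  have hX3 := abs_le.1 hX2
  set q := X ^ 2 / (1 + s) with hq
  have hq0 : 0 ≤ q := div_nonneg (sq_nonneg _) (by linarith)
  have hqw : q = (w⁻¹) ^ 4 * (2 * ω * n) := by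
    have h1 : w ^ 4 * X ^ 2 = 2 * ω * n * (1 + s) := by
      rw [← hχ2, ← hvX]; ring
    have h2 : (1 + s) ≠ 0 := by linarith
    rw [hq, div_eq_iff h2]
    field_simp
    linear_combination h1
  have hq1 : |q - 1| ≤ D / n := by
    have e : q - 1 = ((X - 1) * (X + 1) - s) / (1 + s) := by
      have h2 : (1 + s) ≠ 0 := by linarith
      rw [hq]; field_simp; ring
    rw [e, abs_div, abs_of_pos (a := 1 + s) (by linarith), div_le_iff₀ (by linarith)]
    have h3 : |X + 1| ≤ 3 := by rw [abs_le]; constructor <;> linarith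
    have h4 : |s| ≤ S / n := hs1.trans (by gcongr; exact le_abs_self _)
    calc _ ≤ |(X - 1) * (X + 1)| + |s| := abs_sub _ _
      _ ≤ 4 / ω / n * 3 + S / n := by
        rw [abs_mul]; gcongr
      _ = D / n * (1 / 2) := by rw [hD]; ring
      _ ≤ _ := by
        have : 0 ≤ D / n := by positivity
        gcongr
        linarith
  have hr := (abs_rpow_quarter_sub_le hq0).trans hq1
  set r := q ^ (1 / 4 : ℝ) with hrdef
  have hwr : w⁻¹ = K * (n : ℝ) ^ (-(1 / 4) : ℝ) * r := by
    rw [hrdef, hqw, Real.mul_rpow (by positivity) (by positivity),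
      ← Real.rpow_natCast, ← Real.rpow_mul (by positivity), hK, Real.mul_rpow (by positivity)
      hn0.le, Real.rpow_neg (by positivity), Real.rpow_neg hn0.le]
    norm_num
    field_simp
  have hDn : D / n ≤ 1 / 2 := by
    rw [div_le_div_iff₀ hn0 two_pos]; linarith
  have hr2 := abs_le.1 (hr.trans hDn)
  have hnp : (0 : ℝ) < (n : ℝ) ^ (-(1 / 4) : ℝ) := by positivity
  have hKn : 0 < K * (n : ℝ) ^ (-(1 / 4) : ℝ) := by positivity
  refine ⟨hv, ?_, ?_, ?_⟩
  · have e : w⁻¹ - K * (n : ℝ) ^ (-(1 / 4) : ℝ) = K * (n : ℝ) ^ (-(1 / 4) : ℝ) * (r - 1) := by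
      rw [hwr]; ring
    have hp : (n : ℝ) ^ (-(5 / 4) : ℝ) = (n : ℝ) ^ (-(1 / 4) : ℝ) * (1 / n) := by
      rw [one_div (n : ℝ), ← Real.rpow_neg_one, ← Real.rpow_add hn0]; norm_num
    rw [e, abs_mul, abs_of_pos hKn]
    calc _ ≤ K * (n : ℝ) ^ (-(1 / 4) : ℝ) * (D / n) := by gcongr
      _ = K * D * (n : ℝ) ^ (-(5 / 4) : ℝ) := by rw [hp]; ring
      _ ≤ _ := by
        gcongr
        have : 0 ≤ 2 * K + 2 / K := by positivity
        linarith
  · rw [hwr]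
    calc _ ≤ K * (n : ℝ) ^ (-(1 / 4) : ℝ) * 2 := by gcongr; linarith
      _ = 2 * K * (n : ℝ) ^ (-(1 / 4) : ℝ) := by ring
      _ ≤ _ := by
        gcongr
        have : 0 ≤ K * D + 2 / K := by positivity
        linarith
  · have hwi : w = (w⁻¹)⁻¹ := (inv_inv w).symm
    rw [hwi, inv_le_iff_one_le_mul₀ (by positivity)]
    have h5 : (n : ℝ) ^ (1 / 4 : ℝ) * (n : ℝ) ^ (-(1 / 4) : ℝ) = 1 := by
      rw [← Real.rpow_add hn0]; norm_num
    have h6 : K * (n : ℝ) ^ (-(1 / 4) : ℝ) * (1 / 2) ≤ w⁻¹ := by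
      rw [hwr]; gcongr; linarith
    calc (1 : ℝ) = 2 / K * (n : ℝ) ^ (1 / 4 : ℝ) * (K * (n : ℝ) ^ (-(1 / 4) : ℝ) * (1 / 2)) := by
          have : 2 / K * (n : ℝ) ^ (1 / 4 : ℝ) * (K * (n : ℝ) ^ (-(1 / 4) : ℝ) * (1 / 2))
            = (n : ℝ) ^ (1 / 4 : ℝ) * (n : ℝ) ^ (-(1 / 4) : ℝ) := by field_simp
          rw [this, h5]
      _ ≤ (K * D + 2 * K + 2 / K) * (n : ℝ) ^ (1 / 4 : ℝ) * w⁻¹ := by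
          gcongr
          have : 0 ≤ K * D + 2 * K := by positivity
          linarith

end LargeLevels
-- The two real solutions, their Jost coefficients and nondegeneracy.
section Solutions

/-- The solution of the difference equation with given initial values. -/
noncomputable def jacobiSol (b : ℕ → ℝ) (y₀ y₁ : ℝ) : ℕ → ℝ
  | 0 => y₀
  | 1 => y₁
  | n + 2 => (b (n + 1) * jacobiSol b y₀ y₁ (n + 1) - √((n : ℝ) + 1) * jacobiSol b y₀ y₁ n) /
      √((n : ℝ) + 2)

theorem isJacobi_jacobiSol (b : ℕ → ℝ) (y₀ y₁ : ℝ) : IsJacobi b (jacobiSol b y₀ y₁) := by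
  intro n
  have h : (0 : ℝ) < √((n : ℝ) + 2) := Real.sqrt_pos.2 (by positivity)
  rw [jacobiSol]
  field_simp
  ring

theorem IsJacobi.ext {b y z : ℕ → ℝ} (hy : IsJacobi b y) (hz : IsJacobi b z) (h0 : y 0 = z 0)
    (h1 : y 1 = z 1) : y = z := by
  have key : ∀ n, y n = z n ∧ y (n + 1) = z (n + 1) := by
    intro n
    induction n with
    | zero => exact ⟨h0, h1⟩
    | succ n ih =>
      refine ⟨ih.2, ?_⟩
      have h : (0 : ℝ) < √((n : ℝ) + 2) := Real.sqrt_pos.2 (by positivity)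
      have e := hy n
      have f := hz n
      rw [ih.1, ih.2] at e
      exact mul_left_cancel₀ h.ne' (by linarith : √((n : ℝ) + 2) * y (n + 2) = _ * z (n + 2))
  exact funext fun n => (key n).1

theorem IsJacobi.linear {b y z : ℕ → ℝ} (hy : IsJacobi b y) (hz : IsJacobi b z) (c d : ℝ) :
    IsJacobi b fun n => c * y n + d * z n := by
  intro n
  simp only
  linear_combination c * hy n + d * hz n

theorem wron_linear (θ μ : ℝ) (y z : ℕ → ℝ) (c d : ℝ) (n : ℕ) :
    wron θ μ (fun n => c * y n + d * z n) n = c * wron θ μ y n + d * wron θ μ z n := by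
  unfold wron
  push_cast
  ring

theorem real_wron_const {b y z : ℕ → ℝ} (hy : IsJacobi b y) (hz : IsJacobi b z) (n : ℕ) :
    √((n : ℝ) + 1) * (y (n + 1) * z n - y n * z (n + 1)) = y 1 * z 0 - y 0 * z 1 := by
  induction n with
  | zero => simp
  | succ n ih =>
    rw [← ih]
    have h2 : √(((n + 1 : ℕ) : ℝ) + 1) = √((n : ℝ) + 2) := by
      congr 1; push_cast; ring
    rw [h2, add_assoc n 1 1, one_add_one_eq_two]
    linear_combination z (n + 1) * hy n - y (n + 1) * hz n

variable {α ω : ℝ}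

theorem continuousOn_jacobiCoeff (α ω : ℝ) (n : ℕ) :
    ContinuousOn (fun E => jacobiCoeff α ω E n) (exceptional ω)ᶜ :=
  continuousOn_const.mul ((continuousOn_vPrime ω n).div (continuousOn_v_zero ω n)
    fun _ hE => v_zero_ne_zero hE n)

theorem continuousOn_jacobiSol {y₀ y₁ : ℝ → ℝ} (h₀ : ContinuousOn y₀ (exceptional ω)ᶜ)
    (h₁ : ContinuousOn y₁ (exceptional ω)ᶜ) (n : ℕ) :
    ContinuousOn (fun E => jacobiSol (jacobiCoeff α ω E) (y₀ E) (y₁ E) n) (exceptional ω)ᶜ := by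
  have key : ∀ n, ContinuousOn (fun E => jacobiSol (jacobiCoeff α ω E) (y₀ E) (y₁ E) n)
      (exceptional ω)ᶜ ∧ ContinuousOn (fun E => jacobiSol (jacobiCoeff α ω E) (y₀ E) (y₁ E) (n + 1))
      (exceptional ω)ᶜ := by
    intro n
    induction n with
    | zero => exact ⟨h₀, h₁⟩
    | succ n ih =>
      refine ⟨ih.2, ?_⟩
      have : ∀ E, jacobiSol (jacobiCoeff α ω E) (y₀ E) (y₁ E) (n + 1 + 1) =
        (jacobiCoeff α ω E (n + 1) * jacobiSol (jacobiCoeff α ω E) (y₀ E) (y₁ E) (n + 1) -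
          √((n : ℝ) + 1) * jacobiSol (jacobiCoeff α ω E) (y₀ E) (y₁ E) n) / √((n : ℝ) + 2) :=
        fun E => rfl
      simp only [this]
      exact (((continuousOn_jacobiCoeff α ω (n + 1)).mul ih.2).sub
        (continuousOn_const.mul ih.1)).div_const _
  exact (key n).1

/-- Uniform asymptotics over compact sets of non-exceptional energies. -/
theorem exists_uniform_asymptotics (hω : 0 < ω) (hα : ω < α) {K : Set ℝ} (hK : IsCompact K)
    (hKe : K ⊆ (exceptional ω)ᶜ) {y₀ y₁ : ℝ → ℝ} (h₀ : ContinuousOn y₀ (exceptional ω)ᶜ)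
    (h₁ : ContinuousOn y₁ (exceptional ω)ᶜ) :
    ∃ (C : ℝ) (N : ℕ), 0 ≤ C ∧ 1 ≤ N ∧ ∀ E ∈ K, ∀ y : ℕ → ℝ,
      y = jacobiSol (jacobiCoeff α ω E) (y₀ E) (y₁ E) →
      Tendsto (wron (theta α ω) (lam α ω * E) y) atTop (𝓝 (jost (theta α ω) (lam α ω * E) y)) ∧
      ‖jost (theta α ω) (lam α ω * E) y‖ ≤ C ∧
      ∀ n, N ≤ n → ‖wron (theta α ω) (lam α ω * E) y n - jost (theta α ω) (lam α ω * E) y‖ ≤ C / n ∧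
        |y n + (jost (theta α ω) (lam α ω * E) y *
          conj (osc (theta α ω) (lam α ω * E) n)).im / Real.sin (theta α ω)|
          ≤ C * (n : ℝ) ^ (-(5 / 4) : ℝ) := by
  obtain ⟨R, hR⟩ := hK.isBounded.exists_norm_le
  obtain ⟨B, N, hB⟩ := exists_coeffBound hω hα R
  obtain ⟨C, N', hC, hN', h⟩ := exists_uniform_jost (ι := ℝ) (S := K) (θ := theta α ω)
    (R := |lam α ω| * R) (B := B) (μ := fun E => lam α ω * E) (b := jacobiCoeff α ω)
    (y := fun E => jacobiSol (jacobiCoeff α ω E) (y₀ E) (y₁ E)) (sin_theta_pos hω hα)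
    (fun E hE => by rw [abs_mul]; gcongr; exact hR E hE)
    ⟨N, fun n hn E hE => hB n hn E (hR E hE)⟩
    (fun E _ => isJacobi_jacobiSol _ _ _)
    (fun n => by
      obtain ⟨M, hM⟩ := hK.exists_bound_of_continuousOn
        ((continuousOn_jacobiSol (α := α) h₀ h₁ n).mono hKe)
      exact ⟨M, hM⟩)
  refine ⟨C, N', hC, hN', fun E hE y hy => ?_⟩
  rw [hy]
  exact h E hE

/-- The solution of the difference equation which satisfies the matching condition at level `0`,
normalized to `1` there. -/
noncomputable def regSol (α ω E : ℝ) : ℕ → ℝ :=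
  jacobiSol (jacobiCoeff α ω E) 1 (jacobiCoeff α ω E 0)

/-- A second solution, with Wronskian `1` against `regSol`. -/
noncomputable def auxSol (α ω E : ℝ) : ℕ → ℝ := jacobiSol (jacobiCoeff α ω E) 0 (-1)

/-- The Jost coefficient of `regSol`. -/
noncomputable def regJost (α ω E : ℝ) : ℂ := jost (theta α ω) (lam α ω * E) (regSol α ω E)

/-- The Jost coefficient of `auxSol`. -/
noncomputable def auxJost (α ω E : ℝ) : ℂ := jost (theta α ω) (lam α ω * E) (auxSol α ω E)

theorem exists_regSol_asymptotics (hω : 0 < ω) (hα : ω < α) {K : Set ℝ} (hK : IsCompact K)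
    (hKe : K ⊆ (exceptional ω)ᶜ) :
    ∃ (C : ℝ) (N : ℕ), 0 ≤ C ∧ 1 ≤ N ∧ ∀ E ∈ K,
      Tendsto (wron (theta α ω) (lam α ω * E) (regSol α ω E)) atTop (𝓝 (regJost α ω E)) ∧
      ‖regJost α ω E‖ ≤ C ∧
      ∀ n, N ≤ n → ‖wron (theta α ω) (lam α ω * E) (regSol α ω E) n - regJost α ω E‖ ≤ C / n ∧
        |regSol α ω E n + (regJost α ω E *
          conj (osc (theta α ω) (lam α ω * E) n)).im / Real.sin (theta α ω)|
          ≤ C * (n : ℝ) ^ (-(5 / 4) : ℝ) := by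
  obtain ⟨C, N, hC, hN, h⟩ := exists_uniform_asymptotics hω hα hK hKe (y₀ := fun _ => 1)
    (y₁ := fun E => jacobiCoeff α ω E 0) continuousOn_const (continuousOn_jacobiCoeff α ω 0)
  exact ⟨C, N, hC, hN, fun E hE => h E hE _ rfl⟩

theorem exists_auxSol_asymptotics (hω : 0 < ω) (hα : ω < α) {K : Set ℝ} (hK : IsCompact K)
    (hKe : K ⊆ (exceptional ω)ᶜ) :
    ∃ (C : ℝ) (N : ℕ), 0 ≤ C ∧ 1 ≤ N ∧ ∀ E ∈ K,
      Tendsto (wron (theta α ω) (lam α ω * E) (auxSol α ω E)) atTop (𝓝 (auxJost α ω E)) ∧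
      ‖auxJost α ω E‖ ≤ C ∧
      ∀ n, N ≤ n → ‖wron (theta α ω) (lam α ω * E) (auxSol α ω E) n - auxJost α ω E‖ ≤ C / n ∧
        |auxSol α ω E n + (auxJost α ω E *
          conj (osc (theta α ω) (lam α ω * E) n)).im / Real.sin (theta α ω)|
          ≤ C * (n : ℝ) ^ (-(5 / 4) : ℝ) := by
  obtain ⟨C, N, hC, hN, h⟩ := exists_uniform_asymptotics hω hα hK hKe (y₀ := fun _ => 0)
    (y₁ := fun E => -1) continuousOn_const continuousOn_const
  exact ⟨C, N, hC, hN, fun E hE => h E hE _ rfl⟩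

theorem continuousOn_regSol (α ω : ℝ) (n : ℕ) :
    ContinuousOn (fun E => regSol α ω E n) (exceptional ω)ᶜ :=
  continuousOn_jacobiSol (y₀ := fun _ => 1) continuousOn_const (continuousOn_jacobiCoeff α ω 0) n

theorem continuousOn_osc (θ μ x : ℝ) (s : Set ℝ) :
    ContinuousOn (fun E => osc θ (μ * E) x) s := by
  unfold osc
  fun_prop

/-- The Wronskians at a finite level are continuous in E and converge with rate C/n uniformly on
compact sets. -/
theorem continuousOn_regJost (hω : 0 < ω) (hα : ω < α) :
    ContinuousOn (regJost α ω) (exceptional ω)ᶜ := by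
  have hopen : IsOpen (exceptional ω)ᶜ := (isClosed_exceptional hω).isOpen_compl
  have hloc : TendstoLocallyUniformlyOn
      (fun n E => wron (theta α ω) (lam α ω * E) (regSol α ω E) n) (regJost α ω) atTop
      (exceptional ω)ᶜ := by
    rw [tendstoLocallyUniformlyOn_iff_forall_isCompact hopen]
    intro K hKe hK
    obtain ⟨C, N, hC, hN, h⟩ := exists_regSol_asymptotics hω hα hK hKe
    rw [Metric.tendstoUniformlyOn_iff]
    intro ε hε
    have h1 : Tendsto (fun n : ℕ => C / n) atTop (𝓝 0) := tendsto_const_div_atTop_nhds_zero_nat _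
    filter_upwards [h1.eventually_lt_const hε, eventually_ge_atTop N] with n hn hnN E hE
    rw [dist_comm, dist_eq_norm]
    exact ((h E hE).2.2 n hnN).1.trans_lt hn
  refine hloc.continuousOn (Frequently.of_forall fun n => ?_)
  unfold wron
  refine continuousOn_const.mul (ContinuousOn.sub ?_ ?_)
  · exact (Complex.continuous_ofReal.comp_continuousOn (continuousOn_regSol α ω (n + 1))).mul
      (continuousOn_osc _ _ _ _)
  · exact (Complex.continuous_ofReal.comp_continuousOn (continuousOn_regSol α ω n)).mul
      (continuousOn_osc _ _ _ _)

/-- Let n tend to infinity in `im_wron_mul_conj`: the real Wronskian is constantly 1 and `oscWron`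
tends to sin θ. So the two Jost coefficients are linearly independent over ℝ, which underlies every
uniqueness claim below. -/
theorem im_regJost_mul_conj_auxJost (hω : 0 < ω) (hα : ω < α) {E : ℝ} (hE : E ∉ exceptional ω) :
    (regJost α ω E * conj (auxJost α ω E)).im = Real.sin (theta α ω) := by
  have hKe : ({E} : Set ℝ) ⊆ (exceptional ω)ᶜ := by simpa using hE
  obtain ⟨_, _, _, _, h1⟩ := exists_regSol_asymptotics hω hα isCompact_singleton hKe
  obtain ⟨_, _, _, _, h2⟩ := exists_auxSol_asymptotics hω hα isCompact_singleton hKe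
  have t1 := (h1 E rfl).1
  have t2 := (h2 E rfl).1
  have t3 := (Complex.continuous_im.tendsto _).comp
    (t1.mul ((Complex.continuous_conj.tendsto _).comp t2))
  refine tendsto_nhds_unique t3 ?_
  have t4 : Tendsto (oscWron (theta α ω) (lam α ω * E)) atTop (𝓝 (Real.sin (theta α ω))) := by
    have h0 : Tendsto (fun n : ℕ => (1 + |lam α ω * E|) / n) atTop (𝓝 0) :=
      tendsto_const_div_atTop_nhds_zero_nat _
    rw [tendsto_iff_dist_tendsto_zero]
    refine squeeze_zero' (Eventually.of_forall fun _ => dist_nonneg) ?_ h0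
    filter_upwards [eventually_ge_atTop 1] with n hn
    exact abs_oscWron_sub_le _ le_rfl hn
  refine t4.congr' ?_
  filter_upwards [eventually_ge_atTop 1] with n hn
  simp only [Function.comp_apply]
  have hw : √((n : ℝ) + 1) * (regSol α ω E (n + 1) * auxSol α ω E n
      - regSol α ω E n * auxSol α ω E (n + 1)) = _ :=
    real_wron_const (b := jacobiCoeff α ω E) (isJacobi_jacobiSol _ _ _) (isJacobi_jacobiSol _ _ _) n
  rw [im_wron_mul_conj _ _ _ _ hn, hw]
  simp [jacobiSol]

theorem regJost_ne_zero (hω : 0 < ω) (hα : ω < α) {E : ℝ} (hE : E ∉ exceptional ω) :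
    regJost α ω E ≠ 0 := by
  intro h
  have := im_regJost_mul_conj_auxJost hω hα hE
  rw [h] at this
  simp only [zero_mul, Complex.zero_im] at this
  exact (sin_theta_pos hω hα).ne this

/-- A real solution which decays faster than `n^(-1/4)` vanishes. -/
theorem eq_zero_of_decay (hω : 0 < ω) (hα : ω < α) {E : ℝ} (hE : E ∉ exceptional ω) {y : ℕ → ℝ}
    (hy : IsJacobi (jacobiCoeff α ω E) y) {C : ℝ} {N : ℕ}
    (hd : ∀ n : ℕ, N ≤ n → |y n| ≤ C * (n : ℝ) ^ (-(5 / 4) : ℝ)) : y = 0 := by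
  have hKe : ({E} : Set ℝ) ⊆ (exceptional ω)ᶜ := by simpa using hE
  obtain ⟨_, _, _, _, h1⟩ := exists_regSol_asymptotics hω hα isCompact_singleton hKe
  obtain ⟨_, _, _, _, h2⟩ := exists_auxSol_asymptotics hω hα isCompact_singleton hKe
  have t1 := (h1 E rfl).1
  have t2 := (h2 E rfl).1
  set c := y 0 with hc
  set d := jacobiCoeff α ω E 0 * y 0 - y 1 with hd'
  have hyl : y = fun n => c * regSol α ω E n + d * auxSol α ω E n := by
    refine hy.ext ((isJacobi_jacobiSol _ _ _).linear (isJacobi_jacobiSol _ _ _) c d) ?_ ?_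
    · simp [regSol, auxSol, jacobiSol, hc]
    · simp [regSol, auxSol, jacobiSol, hc, hd']; ring
  have t3 : Tendsto (wron (theta α ω) (lam α ω * E) y) atTop
      (𝓝 (c * regJost α ω E + d * auxJost α ω E)) := by
    refine ((t1.const_mul (c : ℂ)).add (t2.const_mul (d : ℂ))).congr fun n => ?_
    rw [hyl, wron_linear]
  -- The weight √(n+1) costs n^(1/2) and the profile is bounded by 1, so the Wronskian is
  -- O(n^(1/2-5/4)).
  have t4 : Tendsto (wron (theta α ω) (lam α ω * E) y) atTop (𝓝 0) := by
    have h0 : Tendsto (fun n : ℕ => 4 * |C| * (n : ℝ) ^ (-(3 / 4) : ℝ)) atTop (𝓝 (4 * |C| * 0)) :=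
      ((tendsto_rpow_neg_atTop (by norm_num : (0 : ℝ) < 3 / 4)).comp
        tendsto_natCast_atTop_atTop).const_mul _
    rw [mul_zero] at h0
    refine squeeze_zero_norm' ?_ h0
    filter_upwards [eventually_ge_atTop N, eventually_ge_atTop 1] with n hn hn1
    have hn0 : (1 : ℝ) ≤ n := by exact_mod_cast hn1
    have hosc : ∀ k : ℕ, 1 ≤ k → ‖osc (theta α ω) (lam α ω * E) k‖ ≤ 1 := by
      intro k hk
      rw [norm_osc _ _ (Nat.cast_nonneg _)]
      exact Real.rpow_le_one_of_one_le_of_nonpos (by exact_mod_cast hk) (by norm_num)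
    have b1 : |y n| ≤ |C| * (n : ℝ) ^ (-(5 / 4) : ℝ) :=
      (hd n hn).trans (by gcongr; exact le_abs_self C)
    have b2 : |y (n + 1)| ≤ |C| * (n : ℝ) ^ (-(5 / 4) : ℝ) := by
      refine (hd (n + 1) (hn.trans (Nat.le_succ n))).trans ?_
      refine mul_le_mul (le_abs_self C) ?_ (by positivity) (abs_nonneg C)
      exact Real.rpow_le_rpow_of_nonpos (by linarith) (by push_cast; linarith) (by norm_num)
    have b3 : √((n : ℝ) + 1) ≤ 2 * (n : ℝ) ^ (1 / 2 : ℝ) := by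
      rw [← Real.sqrt_eq_rpow]
      have : √((n : ℝ) + 1) ≤ √(2 ^ 2 * n) := Real.sqrt_le_sqrt (by linarith)
      rwa [Real.sqrt_mul (by norm_num), Real.sqrt_sq (by norm_num)] at this
    have hp : (n : ℝ) ^ (1 / 2 : ℝ) * (n : ℝ) ^ (-(5 / 4) : ℝ) = (n : ℝ) ^ (-(3 / 4) : ℝ) := by
      rw [← Real.rpow_add (by linarith)]; norm_num
    rw [wron, norm_mul, Complex.norm_real, Real.norm_eq_abs, abs_of_nonneg (Real.sqrt_nonneg _)]
    calc _ ≤ 2 * (n : ℝ) ^ (1 / 2 : ℝ) * (|C| * (n : ℝ) ^ (-(5 / 4) : ℝ) * 1 +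
          |C| * (n : ℝ) ^ (-(5 / 4) : ℝ) * 1) := by
          gcongr
          refine (norm_sub_le _ _).trans ?_
          rw [norm_mul, norm_mul, Complex.norm_real, Complex.norm_real, Real.norm_eq_abs,
            Real.norm_eq_abs]
          exact add_le_add (mul_le_mul b2 (hosc n hn1) (norm_nonneg _) (by positivity))
            (mul_le_mul b1 (hosc (n + 1) (by omega)) (norm_nonneg _) (by positivity))
      _ = _ := by rw [← hp]; ring
  have hz := tendsto_nhds_unique t3 t4
  have him := im_regJost_mul_conj_auxJost hω hα hE
  have hs := (sin_theta_pos hω hα).ne'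
  have hr := congrArg Complex.re hz
  have hi := congrArg Complex.im hz
  simp only [Complex.add_re, Complex.add_im, Complex.re_ofReal_mul, Complex.im_ofReal_mul,
    Complex.zero_re, Complex.zero_im] at hr hi
  simp only [Complex.mul_im, Complex.conj_re, Complex.conj_im] at him
  -- Cramer's rule for c Λ₁ + d Λ₂ = 0 with real c, d; the determinant is sin θ.
  have hc0 : c = 0 := by
    have : c * Real.sin (theta α ω) = 0 := by
      rw [← him]
      linear_combination (auxJost α ω E).re * hi - (auxJost α ω E).im * hr
    exact (mul_eq_zero.1 this).resolve_right hs
  have hd0 : d = 0 := by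
    have : d * Real.sin (theta α ω) = 0 := by
      rw [← him]
      linear_combination (regJost α ω E).im * hr - (regJost α ω E).re * hi
    exact (mul_eq_zero.1 this).resolve_right hs
  rw [hyl, hc0, hd0]
  ext n
  simp

end Solutions

/-! ### The normal solution, the amplitude and the eigenfunction coefficients. -/

section Normal

variable {α ω E : ℝ}

/-- The substitution y_n = v_n(0) c_n makes the recursion symmetric; it is reversible because no
v_n(0) vanishes. -/
theorem isJacobi_iff (hα : 0 < α) (hE : E ∉ exceptional ω) (c : ℕ → ℝ) :
    IsJacobi (jacobiCoeff α ω E) (fun n => v ω n 0 E * c n) ↔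
      ∀ n : ℕ, α * √((n : ℝ) + 2) * v ω (n + 2) 0 E * c (n + 2)
        - √(2 * ω) * vPrime ω (n + 1) E * c (n + 1) + α * √((n : ℝ) + 1) * v ω n 0 E * c n = 0 := by
  refine forall_congr' fun n => ?_
  have hv := v_zero_ne_zero hE (n + 1)
  have e : α * (jacobiCoeff α ω E (n + 1) * (v ω (n + 1) 0 E * c (n + 1)))
      = √(2 * ω) * vPrime ω (n + 1) E * c (n + 1) := by
    rw [jacobiCoeff]
    field_simp
  constructor
  · intro h
    linear_combination α * h + e
  · intro h
    refine mul_left_cancel₀ hα.ne' ?_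
    rw [e]
    linear_combination h

theorem solvesRecursion_iff (hα : 0 < α) (hE : E ∉ exceptional ω) (D : ℕ → ℂ) :
    SolvesRecursion α ω E D ↔
      IsJacobi (jacobiCoeff α ω E) (fun n => v ω n 0 E * (D n).re) ∧
      IsJacobi (jacobiCoeff α ω E) (fun n => v ω n 0 E * (D n).im) := by
  rw [isJacobi_iff hα hE fun n => (D n).re, isJacobi_iff hα hE fun n => (D n).im, ← forall_and]
  refine forall_congr' fun n => ?_
  rw [Complex.ext_iff]
  simp only [Complex.add_re, Complex.sub_re, Complex.re_ofReal_mul, Complex.add_im, Complex.sub_im,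
    Complex.im_ofReal_mul, Complex.zero_re, Complex.zero_im]

/-- The explicit normal solution. -/
noncomputable def jostSol (α ω E : ℝ) (n : ℕ) : ℂ :=
  -(((2 * ω) ^ (1 / 4 : ℝ) : ℝ) : ℂ) *
    (auxJost α ω E * regSol α ω E n - regJost α ω E * auxSol α ω E n) / v ω n 0 E

theorem v_mul_jostSol (hE : E ∉ exceptional ω) (n : ℕ) :
    v ω n 0 E * jostSol α ω E n = -(((2 * ω) ^ (1 / 4 : ℝ) : ℝ) : ℂ) *
      (auxJost α ω E * regSol α ω E n - regJost α ω E * auxSol α ω E n) := by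
  have : (v ω n 0 E : ℂ) ≠ 0 := by exact_mod_cast v_zero_ne_zero hE n
  rw [jostSol]
  field_simp

theorem solvesRecursion_jostSol (hα : 0 < α) (hE : E ∉ exceptional ω) :
    SolvesRecursion α ω E (jostSol α ω E) := by
  rw [solvesRecursion_iff hα hE]
  constructor
  · have h : (fun n => v ω n 0 E * (jostSol α ω E n).re) = fun n =>
        (-((2 * ω) ^ (1 / 4 : ℝ)) * (auxJost α ω E).re) * regSol α ω E n +
          ((2 * ω) ^ (1 / 4 : ℝ) * (regJost α ω E).re) * auxSol α ω E n := by
      ext n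
      have := congrArg Complex.re (v_mul_jostSol (α := α) hE n)
      rw [Complex.re_ofReal_mul, ← Complex.ofReal_neg, Complex.re_ofReal_mul, Complex.sub_re,
        Complex.re_mul_ofReal, Complex.re_mul_ofReal] at this
      rw [this]; ring
    rw [h]
    exact (isJacobi_jacobiSol _ _ _).linear (isJacobi_jacobiSol _ _ _) _ _
  · have h : (fun n => v ω n 0 E * (jostSol α ω E n).im) = fun n =>
        (-((2 * ω) ^ (1 / 4 : ℝ)) * (auxJost α ω E).im) * regSol α ω E n +
          ((2 * ω) ^ (1 / 4 : ℝ) * (regJost α ω E).im) * auxSol α ω E n := by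
      ext n
      have := congrArg Complex.im (v_mul_jostSol (α := α) hE n)
      rw [Complex.im_ofReal_mul, ← Complex.ofReal_neg, Complex.im_ofReal_mul, Complex.sub_im,
        Complex.im_mul_ofReal, Complex.im_mul_ofReal] at this
      rw [this]; ring
    rw [h]
    exact (isJacobi_jacobiSol _ _ _).linear (isJacobi_jacobiSol _ _ _) _ _

/-- For the profile a, Λ₂ Im(Λ₁ā) - Λ₁ Im(Λ₂ā) = a Im(Λ₁ conj Λ₂) = a sin θ. Hence -(Λ₂ `regSol` -
Λ₁ `auxSol`) is asymptotic to a itself, with no conjugate part. Dividing by v_n(0), which is close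
to (2ωn)^(1/4), gives the amplitude n^(-1/2). -/
theorem isNormalSolution_jostSol (hω : 0 < ω) (hα : ω < α) (hE : E ∉ exceptional ω) :
    IsNormalSolution α ω E (jostSol α ω E) := by
  refine ⟨solvesRecursion_jostSol (hω.trans hα) hE, ?_⟩
  have hKe : ({E} : Set ℝ) ⊆ (exceptional ω)ᶜ := by simpa using hE
  obtain ⟨C₁, N₁, hC₁, hN₁, h1⟩ := exists_regSol_asymptotics hω hα isCompact_singleton hKe
  obtain ⟨C₂, N₂, hC₂, hN₂, h2⟩ := exists_auxSol_asymptotics hω hα isCompact_singleton hKe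
  obtain ⟨C₃, N₃, hC₃, hN₃, h3⟩ := exists_v_zero_asymptotics hω |E|
  have hs := sin_theta_pos hω hα
  set Λ₁ := regJost α ω E with hΛ₁
  set Λ₂ := auxJost α ω E with hΛ₂
  have him : (Λ₁ * conj Λ₂).im = Real.sin (theta α ω) := im_regJost_mul_conj_auxJost hω hα hE
  set c : ℝ := (2 * ω) ^ (1 / 4 : ℝ) with hc
  have hc0 : 0 < c := by positivity
  refine IsBigO.of_bound (c * (‖Λ₂‖ * C₁ + ‖Λ₁‖ * C₂) * C₃ + c * C₃) ?_
  filter_upwards [eventually_ge_atTop N₁, eventually_ge_atTop N₂, eventually_ge_atTop N₃]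
    with n hn1 hn2 hn3
  have hn0 : (0 : ℝ) < n := by exact_mod_cast hN₁.trans hn1
  have r1 := ((h1 E rfl).2.2 n hn1).2
  have r2 := ((h2 E rfl).2.2 n hn2).2
  obtain ⟨hv, r3, r4, -⟩ := h3 n hn3 E le_rfl
  set a := osc (theta α ω) (lam α ω * E) n with ha
  have hna : ‖a‖ = (n : ℝ) ^ (-(1 / 4) : ℝ) := norm_osc _ _ hn0.le
  set w := v ω n 0 E
  set s := Real.sin (theta α ω)
  set δ₁ := regSol α ω E n + (Λ₁ * conj a).im / s with hδ₁
  set δ₂ := auxSol α ω E n + (Λ₂ * conj a).im / s with hδ₂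
  set δ₃ := w⁻¹ - (2 * ω) ^ (-(1 / 4) : ℝ) * (n : ℝ) ^ (-(1 / 4) : ℝ) with hδ₃
  have hpl : Λ₂ * ((Λ₁ * conj a).im : ℝ) - Λ₁ * ((Λ₂ * conj a).im : ℝ) = a * (s : ℝ) := by
    rw [← him]
    apply Complex.ext <;>
    simp only [Complex.mul_im, Complex.mul_re, Complex.sub_im, Complex.sub_re, Complex.conj_re,
      Complex.conj_im, Complex.ofReal_re, Complex.ofReal_im] <;> ring
  have hsc : (s : ℂ) ≠ 0 := by exact_mod_cast hs.ne'
  have hwc : (w : ℂ) ≠ 0 := by exact_mod_cast hv.ne'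
  have hcc : c * (2 * ω) ^ (-(1 / 4) : ℝ) = 1 := by
    rw [hc, ← Real.rpow_add (by positivity)]; norm_num
  have hlead : (((n : ℝ) ^ (-(1 / 2) : ℝ) : ℝ) : ℂ) *
      Complex.exp (Complex.I * ((n * theta α ω - lam α ω * E * Real.log n : ℝ) : ℂ))
      = (((n : ℝ) ^ (-(1 / 4) : ℝ) : ℝ) : ℂ) * a := by
    rw [ha, osc, ← mul_assoc, ← Complex.ofReal_mul, ← Real.rpow_add hn0]
    norm_num
  have hj : jostSol α ω E n - (((n : ℝ) ^ (-(1 / 4) : ℝ) : ℝ) : ℂ) * a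
      = -(c : ℂ) * (Λ₂ * δ₁ - Λ₁ * δ₂) * (w⁻¹ : ℝ) + c * a * (δ₃ : ℝ) := by
    have e1 : jostSol α ω E n = -(c : ℂ) * (Λ₂ * δ₁ - Λ₁ * δ₂) * (w⁻¹ : ℝ) + c * a * (w⁻¹ : ℝ) := by
      have hpl' : Λ₂ * (((Λ₁ * conj a).im / s : ℝ) : ℂ) - Λ₁ * (((Λ₂ * conj a).im / s : ℝ) : ℂ)
          = a := by
        rw [Complex.ofReal_div, Complex.ofReal_div, mul_div_assoc', mul_div_assoc', ← sub_div, hpl,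
          mul_div_assoc, div_self hsc, mul_one]
      rw [jostSol, hδ₁, hδ₂, div_eq_mul_inv, ← Complex.ofReal_inv, Complex.ofReal_add,
        Complex.ofReal_add]
      linear_combination ((c : ℂ) * (w⁻¹ : ℝ)) * hpl'
    have e2 : (c : ℂ) * ((2 * ω) ^ (-(1 / 4) : ℝ) : ℝ) = 1 := by exact_mod_cast hcc
    rw [e1, hδ₃, Complex.ofReal_sub, Complex.ofReal_mul]
    linear_combination ((((n : ℝ) ^ (-(1 / 4) : ℝ) : ℝ) : ℂ) * a) * e2
  have hp1 : (n : ℝ) ^ (-(5 / 4) : ℝ) * (n : ℝ) ^ (-(1 / 4) : ℝ) = (n : ℝ) ^ (-(3 / 2) : ℝ) := by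
    rw [← Real.rpow_add hn0]; norm_num
  rw [hlead, hj, Real.norm_eq_abs, abs_of_nonneg (Real.rpow_nonneg hn0.le _)]
  have hb : ‖Λ₂ * (δ₁ : ℂ) - Λ₁ * (δ₂ : ℂ)‖
      ≤ (‖Λ₂‖ * C₁ + ‖Λ₁‖ * C₂) * (n : ℝ) ^ (-(5 / 4) : ℝ) := by
    refine (norm_sub_le _ _).trans ?_
    rw [norm_mul, norm_mul, Complex.norm_real, Complex.norm_real, Real.norm_eq_abs,
      Real.norm_eq_abs, add_mul, mul_assoc, mul_assoc]
    gcongr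
  calc _ ≤ ‖-(c : ℂ) * (Λ₂ * δ₁ - Λ₁ * δ₂) * (w⁻¹ : ℝ)‖ + ‖(c : ℂ) * a * (δ₃ : ℝ)‖ :=
        norm_add_le _ _
    _ = c * ‖Λ₂ * (δ₁ : ℂ) - Λ₁ * (δ₂ : ℂ)‖ * w⁻¹ + c * (n : ℝ) ^ (-(1 / 4) : ℝ) * |δ₃| := by
        rw [norm_mul, norm_mul, norm_mul, norm_mul, norm_neg, Complex.norm_real, Complex.norm_real,
          Complex.norm_real, Real.norm_eq_abs, Real.norm_eq_abs, Real.norm_eq_abs, abs_of_pos hc0,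
          abs_of_pos (inv_pos.2 hv), hna]
    _ ≤ c * ((‖Λ₂‖ * C₁ + ‖Λ₁‖ * C₂) * (n : ℝ) ^ (-(5 / 4) : ℝ)) *
          (C₃ * (n : ℝ) ^ (-(1 / 4) : ℝ)) +
          c * (n : ℝ) ^ (-(1 / 4) : ℝ) * (C₃ * (n : ℝ) ^ (-(5 / 4) : ℝ)) := by
        gcongr
    _ = _ := by rw [← hp1]; ring

/-- The difference of two normal solutions is O(n^(-3/2)). Times v_n(0) = O(n^(1/4)) its real and
imaginary parts are real solutions of size O(n^(-5/4)), to which `eq_zero_of_decay` applies. -/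
theorem isNormalSolution_unique (hω : 0 < ω) (hα : ω < α) (hE : E ∉ exceptional ω) {D D' : ℕ → ℂ}
    (hD : IsNormalSolution α ω E D) (hD' : IsNormalSolution α ω E D') : D = D' := by
  have hα0 := hω.trans hα
  obtain ⟨C₃, N₃, hC₃, hN₃, h3⟩ := exists_v_zero_asymptotics hω |E|
  have hO := hD.2.sub hD'.2
  simp only [sub_sub_sub_cancel_right] at hO
  obtain ⟨C, hC⟩ := hO.bound
  obtain ⟨N, hN⟩ := eventually_atTop.1 hC
  have hb : ∀ n : ℕ, max N N₃ ≤ n →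
      |v ω n 0 E| * ‖D n - D' n‖ ≤ (C₃ * |C|) * (n : ℝ) ^ (-(5 / 4) : ℝ) := by
    intro n hn
    obtain ⟨hv, -, -, r4⟩ := h3 n ((le_max_right _ _).trans hn) E le_rfl
    have hn0 : (0 : ℝ) < n := by exact_mod_cast hN₃.trans ((le_max_right _ _).trans hn)
    have h5 := hN n ((le_max_left _ _).trans hn)
    rw [Real.norm_eq_abs, abs_of_nonneg (Real.rpow_nonneg hn0.le _)] at h5
    have hp : (n : ℝ) ^ (-(5 / 4) : ℝ) = (n : ℝ) ^ (1 / 4 : ℝ) * (n : ℝ) ^ (-(3 / 2) : ℝ) := by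
      rw [← Real.rpow_add hn0]; norm_num
    rw [abs_of_pos hv, hp]
    calc _ ≤ C₃ * (n : ℝ) ^ (1 / 4 : ℝ) * (|C| * (n : ℝ) ^ (-(3 / 2) : ℝ)) := by
          gcongr
          exact h5.trans (by gcongr; exact le_abs_self C)
      _ = _ := by ring
  obtain ⟨r, i⟩ := (solvesRecursion_iff hα0 hE D).1 hD.1
  obtain ⟨r', i'⟩ := (solvesRecursion_iff hα0 hE D').1 hD'.1
  have hr := eq_zero_of_decay hω hα hE (r.linear r' 1 (-1)) (N := max N N₃) fun n hn => by
    refine le_trans ?_ (hb n hn)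
    have : 1 * (v ω n 0 E * (D n).re) + -1 * (v ω n 0 E * (D' n).re)
      = v ω n 0 E * (D n - D' n).re := by rw [Complex.sub_re]; ring
    rw [this, abs_mul]
    gcongr
    exact Complex.abs_re_le_norm _
  have hi := eq_zero_of_decay hω hα hE (i.linear i' 1 (-1)) (N := max N N₃) fun n hn => by
    refine le_trans ?_ (hb n hn)
    have : 1 * (v ω n 0 E * (D n).im) + -1 * (v ω n 0 E * (D' n).im)
      = v ω n 0 E * (D n - D' n).im := by rw [Complex.sub_im]; ring
    rw [this, abs_mul]
    gcongr
    exact Complex.abs_im_le_norm _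
  ext n
  have hv := v_zero_ne_zero hE n
  have a1 := congrFun hr n
  have a2 := congrFun hi n
  simp only [Pi.zero_apply] at a1 a2
  refine Complex.ext (mul_left_cancel₀ hv (by linarith)) (mul_left_cancel₀ hv (by linarith))

theorem normalSolution_eq (hω : 0 < ω) (hα : ω < α) (hE : E ∉ exceptional ω) :
    normalSolution α ω E = jostSol α ω E :=
  isNormalSolution_unique hω hα hE
    (Classical.epsilon_spec ⟨_, isNormalSolution_jostSol hω hα hE⟩)
    (isNormalSolution_jostSol hω hα hE)

/-- The explicit amplitude. -/
noncomputable def jostAmplitude (α ω E : ℝ) : ℂ :=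
  Complex.I * ((-(v ω 0 0 E / ((2 * ω) ^ (1 / 4 : ℝ) * Real.sin (theta α ω))) : ℝ) : ℂ) *
    conj (regJost α ω E)

/-- The factor conj Λ₁ makes the coefficient of `auxSol` real, so the factor i removes it from the
real part; what remains is Im(Λ₁ conj Λ₂) = sin θ times `regSol`. -/
theorem v_mul_re_jostAmplitude (hω : 0 < ω) (hα : ω < α) (hE : E ∉ exceptional ω) (n : ℕ) :
    v ω n 0 E * (jostAmplitude α ω E * jostSol α ω E n).re = v ω 0 0 E * regSol α ω E n := by
  have hs := sin_theta_pos hω hα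
  have him := im_regJost_mul_conj_auxJost hω hα hE
  have hc : 0 < (2 * ω) ^ (1 / 4 : ℝ) := by positivity
  rw [← Complex.re_ofReal_mul, mul_left_comm, v_mul_jostSol hE, jostAmplitude]
  set c := (2 * ω) ^ (1 / 4 : ℝ)
  set s := Real.sin (theta α ω)
  have e : Complex.I * ((-(v ω 0 0 E / (c * s)) : ℝ) : ℂ) * conj (regJost α ω E) *
      (-(c : ℂ) * (auxJost α ω E * regSol α ω E n - regJost α ω E * auxSol α ω E n))
      = ((v ω 0 0 E / s : ℝ) : ℂ) * (Complex.I * (conj (regJost α ω E) *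
      (auxJost α ω E * regSol α ω E n - regJost α ω E * auxSol α ω E n))) := by
    have hcc : (c : ℂ) ≠ 0 := by exact_mod_cast hc.ne'
    have hsc : (s : ℂ) ≠ 0 := by exact_mod_cast hs.ne'
    push_cast
    field_simp
  rw [e, Complex.re_ofReal_mul, Complex.I_mul_re]
  have e2 : -(conj (regJost α ω E) *
      (auxJost α ω E * regSol α ω E n - regJost α ω E * auxSol α ω E n)).im
      = (regJost α ω E * conj (auxJost α ω E)).im * regSol α ω E n := by
    simp only [Complex.mul_im, Complex.mul_re, Complex.sub_im, Complex.sub_re, Complex.conj_re,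
      Complex.conj_im, Complex.ofReal_re, Complex.ofReal_im]
    ring
  rw [e2, him]
  field_simp

/-- The difference d of two amplitudes satisfies Re(d Λ₂) = Re(d Λ₁) = 0, from levels 0 and 1, and
Λ₁, Λ₂ are independent over ℝ. -/
theorem isAmplitude_iff (hω : 0 < ω) (hα : ω < α) (hE : E ∉ exceptional ω) (z : ℂ) :
    IsAmplitude α ω E z ↔ z = jostAmplitude α ω E := by
  have hα0 := hω.trans hα
  have hv0 := v_zero_ne_zero hE 0
  have hc : 0 < (2 * ω) ^ (1 / 4 : ℝ) := by positivity
  have key : IsAmplitude α ω E (jostAmplitude α ω E) := by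
    have h0 := v_mul_re_jostAmplitude hω hα hE 0
    have h1 := v_mul_re_jostAmplitude hω hα hE 1
    rw [IsAmplitude, normalSolution_eq hω hα hE]
    refine ⟨?_, ?_⟩
    · refine mul_left_cancel₀ hv0 ?_
      rw [h0]; simp [regSol, jacobiSol]
    · rw [mul_assoc, h1]
      simp only [regSol, jacobiSol, jacobiCoeff]
      field_simp
  refine ⟨fun h => ?_, fun h => h ▸ key⟩
  obtain ⟨p, q⟩ := h
  obtain ⟨p', q'⟩ := key
  rw [normalSolution_eq hω hα hE] at p q p' q'
  set d := z - jostAmplitude α ω E with hd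
  have r0 : (d * jostSol α ω E 0).re = 0 := by
    rw [hd, sub_mul, Complex.sub_re, p, p', sub_self]
  have r1 : (d * jostSol α ω E 1).re = 0 := by
    have : α * v ω 1 0 E * (d * jostSol α ω E 1).re = 0 := by
      rw [hd, sub_mul, Complex.sub_re, mul_sub, q, q', sub_self]
    exact (mul_eq_zero.1 this).resolve_left (mul_ne_zero hα0.ne' (v_zero_ne_zero hE 1))
  have f : ∀ n, (d * jostSol α ω E n).re = 0 →
      (d * (auxJost α ω E * regSol α ω E n - regJost α ω E * auxSol α ω E n)).re = 0 := by
    intro n hn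
    have h1 : (v ω n 0 E * (d * jostSol α ω E n) : ℂ).re = 0 := by
      rw [Complex.re_ofReal_mul, hn, mul_zero]
    rw [mul_left_comm, v_mul_jostSol hE, mul_left_comm, ← Complex.ofReal_neg,
      Complex.re_ofReal_mul] at h1
    exact (mul_eq_zero.1 h1).resolve_left (neg_ne_zero.2 hc.ne')
  have s0 := f 0 r0
  have s1 := f 1 r1
  simp only [regSol, auxSol, jacobiSol, Complex.ofReal_one, Complex.ofReal_zero, mul_one, mul_zero,
    sub_zero, Complex.ofReal_neg, mul_neg, sub_neg_eq_add] at s0 s1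
  have s2 : (d * regJost α ω E).re = 0 := by
    rw [mul_add, ← mul_assoc, Complex.add_re, Complex.re_mul_ofReal, s0] at s1
    linarith
  have him := im_regJost_mul_conj_auxJost hω hα hE
  have hs := (sin_theta_pos hω hα).ne'
  simp only [Complex.mul_re] at s0 s2
  simp only [Complex.mul_im, Complex.conj_re, Complex.conj_im] at him
  have dre : d.re = 0 := by
    have : d.re * Real.sin (theta α ω) = 0 := by
      rw [← him]
      linear_combination (regJost α ω E).im * s0 - (auxJost α ω E).im * s2
    exact (mul_eq_zero.1 this).resolve_right hs
  have dim : d.im = 0 := by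
    have : d.im * Real.sin (theta α ω) = 0 := by
      rw [← him]
      linear_combination (regJost α ω E).re * s0 - (auxJost α ω E).re * s2
    exact (mul_eq_zero.1 this).resolve_right hs
  exact sub_eq_zero.1 (Complex.ext dre dim)

theorem Z_eq (hω : 0 < ω) (hα : ω < α) (hE : E ∉ exceptional ω) :
    Z α ω E = jostAmplitude α ω E :=
  (isAmplitude_iff hω hα hE _).1
    (Classical.epsilon_spec ⟨_, (isAmplitude_iff hω hα hE _).2 rfl⟩)

/-- The factor between the coefficients of the eigenfunction and `regSol`. -/
noncomputable def gain (α ω E : ℝ) : ℝ :=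
  (Real.pi * √(α ^ 2 - ω ^ 2)) ^ (-(1 / 2) : ℝ) * (2 * ω) ^ (1 / 4 : ℝ) * Real.sin (theta α ω) *
    (v ω 0 0 E / (|v ω 0 0 E| * ‖regJost α ω E‖))

theorem normFactor_mul_v (hω : 0 < ω) (hα : ω < α) (hE : E ∉ exceptional ω) :
    normFactor α ω E * v ω 0 0 E = gain α ω E := by
  have hs := sin_theta_pos hω hα
  have hc : 0 < (2 * ω) ^ (1 / 4 : ℝ) := by positivity
  have hv := abs_pos.2 (v_zero_ne_zero hE 0)
  have hr := norm_pos_iff.2 (regJost_ne_zero hω hα hE)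
  have hZ : ‖Z α ω E‖ = |v ω 0 0 E| * ‖regJost α ω E‖ /
      ((2 * ω) ^ (1 / 4 : ℝ) * Real.sin (theta α ω)) := by
    rw [Z_eq hω hα hE, jostAmplitude, norm_mul, norm_mul, Complex.norm_I, Complex.norm_real,
      Real.norm_eq_abs, abs_neg, abs_div, abs_of_pos (mul_pos hc hs), RCLike.norm_conj]
    ring
  rw [normFactor, hZ, gain]
  field_simp

theorem normFactor_pos (hω : 0 < ω) (hα : ω < α) (hE : E ∉ exceptional ω) :
    0 < normFactor α ω E := by
  have hZ : Z α ω E ≠ 0 := by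
    intro h
    have := ((isAmplitude_iff hω hα hE (Z α ω E)).2 (Z_eq hω hα hE)).1
    rw [h] at this
    simp at this
  have := sqrt_sq_sub_pos hω hα
  have := Real.pi_pos
  rw [normFactor]
  exact div_pos (Real.rpow_pos_of_pos (by positivity) _) (norm_pos_iff.2 hZ)

theorem v_mul_coeff (hω : 0 < ω) (hα : ω < α) (hE : E ∉ exceptional ω) (n : ℕ) :
    v ω n 0 E * coeff α ω n E = gain α ω E * regSol α ω E n := by
  rw [coeff, Z_eq hω hα hE, normalSolution_eq hω hα hE, mul_left_comm,
    v_mul_re_jostAmplitude hω hα hE, ← mul_assoc, normFactor_mul_v hω hα hE]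

theorem u_zero_eq (hω : 0 < ω) (hα : ω < α) (hE : E ∉ exceptional ω) (n : ℕ) :
    u α ω n 0 E = gain α ω E * regSol α ω E n := by
  rw [u, mul_comm, v_mul_coeff hω hα hE]

theorem coeff_recursion (hω : 0 < ω) (hα : ω < α) (hE : E ∉ exceptional ω) (n : ℕ) :
    α * √((n : ℝ) + 2) * v ω (n + 2) 0 E * coeff α ω (n + 2) E
      - √(2 * ω) * vPrime ω (n + 1) E * coeff α ω (n + 1) E
      + α * √((n : ℝ) + 1) * v ω n 0 E * coeff α ω n E = 0 := by
  revert n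
  rw [← isJacobi_iff (hω.trans hα) hE fun n => coeff α ω n E]
  have : (fun n => v ω n 0 E * coeff α ω n E)
      = fun n => gain α ω E * regSol α ω E n + 0 * regSol α ω E n := by
    ext n; rw [v_mul_coeff hω hα hE]; ring
  rw [this]
  exact (isJacobi_jacobiSol _ _ _).linear (isJacobi_jacobiSol _ _ _) _ _

theorem coeff_initial (hω : 0 < ω) (hα : ω < α) (hE : E ∉ exceptional ω) :
    α * v ω 1 0 E * coeff α ω 1 E = √(2 * ω) * vPrime ω 0 E * coeff α ω 0 E := by
  have h0 := v_mul_coeff hω hα hE 0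
  have h1 := v_mul_coeff hω hα hE 1
  have hv0 := v_zero_ne_zero hE 0
  have hα0 := (hω.trans hα).ne'
  simp only [regSol, jacobiSol, mul_one] at h0 h1
  rw [mul_assoc, h1, ← h0, jacobiCoeff]
  field_simp

theorem coeff_zero_ne_zero (hω : 0 < ω) (hα : ω < α) (hE : E ∉ exceptional ω) :
    coeff α ω 0 E ≠ 0 := by
  have := ((isAmplitude_iff hω hα hE (Z α ω E)).2 (Z_eq hω hα hE)).1
  rw [coeff, this, mul_one]
  exact (normFactor_pos hω hα hE).ne'

theorem eigenfunctions_well_defined (hω : 0 < ω) (hα : ω < α) (hE : E ∉ exceptional ω) :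
    (∃! D : ℕ → ℂ, IsNormalSolution α ω E D) ∧ (∃! z : ℂ, IsAmplitude α ω E z) ∧
      IsFormalEigenfunction α ω E (fun n x => u α ω n x E) :=
  ⟨⟨_, isNormalSolution_jostSol hω hα hE, fun _ hD =>
      isNormalSolution_unique hω hα hE hD (isNormalSolution_jostSol hω hα hE)⟩,
    ⟨_, (isAmplitude_iff hω hα hE _).2 rfl, fun _ hz => (isAmplitude_iff hω hα hE _).1 hz⟩,
    isFormalEigenfunction_of_coeff hω (coeff_zero_ne_zero hω hα hE) (coeff_initial hω hα hE)
      (coeff_recursion hω hα hE)⟩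

end Normal
-- Partial sums of the orthogonality kernel: Christoffel–Darboux and asymptotics.
section Kernel

variable {α ω : ℝ}

theorem P_eq (α ω : ℝ) (n : ℕ) (x y : ℝ) : P α ω n x y =
    coeff α ω n x * coeff α ω n y * ∫ t, v ω n t x * v ω n t y ∂circleMeasure := by
  rw [P, ← integral_const_mul]
  refine integral_congr_ae (ae_of_all _ fun t => ?_)
  simp only [u]
  ring

theorem sub_mul_P (α ω : ℝ) (n : ℕ) (x y : ℝ) : (x - y) * P α ω n x y =
    coeff α ω n x * coeff α ω n y *
      (vPrime ω n x * v ω n 0 y - v ω n 0 x * vPrime ω n y) := by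
  rw [P_eq, ← sub_mul_integral_v_mul_v]
  ring

/-- The partial sums of the orthogonality kernel. -/
noncomputable def partialKernel (α ω : ℝ) (N : ℕ) (x y : ℝ) : ℝ :=
  ∑ n ∈ Finset.range (N + 1), P α ω n x y

/-- The Christoffel–Darboux formula. -/
theorem sub_mul_partialKernel (hω : 0 < ω) (hα : ω < α) {x y : ℝ} (hx : x ∉ exceptional ω)
    (hy : y ∉ exceptional ω) (N : ℕ) :
    √(2 * ω) * ((x - y) * partialKernel α ω N x y) = α * √((N : ℝ) + 1) *
      (u α ω (N + 1) 0 x * u α ω N 0 y - u α ω N 0 x * u α ω (N + 1) 0 y) := by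
  -- Green's formula makes each (x-y) P_n a boundary term at 0, and the recursion rewrites it as a
  -- difference of consecutive Wronskian terms. The condition at level 0 starts the telescoping.
  induction N with
  | zero =>
    have hix := coeff_initial hω hα hx
    have hiy := coeff_initial hω hα hy
    simp only [partialKernel, zero_add, Finset.range_one, Finset.sum_singleton, sub_mul_P, u,
      CharP.cast_eq_zero, Real.sqrt_one]
    linear_combination (-(v ω 0 0 y * coeff α ω 0 y)) * hix + (v ω 0 0 x * coeff α ω 0 x) * hiy
  | succ N ih =>
    have hrx := coeff_recursion hω hα hx N
    have hry := coeff_recursion hω hα hy N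
    have hs : partialKernel α ω (N + 1) x y = partialKernel α ω N x y + P α ω (N + 1) x y :=
      Finset.sum_range_succ _ _
    have e2 : √(((N + 1 : ℕ) : ℝ) + 1) = √((N : ℝ) + 2) := by congr 1; push_cast; ring
    rw [hs, mul_add, mul_add, ih, sub_mul_P, e2]
    simp only [u, add_assoc N 1 1, one_add_one_eq_two]
    linear_combination (-(v ω (N + 1) 0 y * coeff α ω (N + 1) y)) * hrx +
      (v ω (N + 1) 0 x * coeff α ω (N + 1) x) * hry

/-- The asymptotic phase factor of the eigenfunctions. -/
noncomputable def phase (α ω E : ℝ) : ℂ :=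
  ((v ω 0 0 E / (|v ω 0 0 E| * ‖regJost α ω E‖) : ℝ) : ℂ) * regJost α ω E

theorem norm_phase (hω : 0 < ω) (hα : ω < α) {E : ℝ} (hE : E ∉ exceptional ω) :
    ‖phase α ω E‖ = 1 := by
  have hv := abs_pos.2 (v_zero_ne_zero hE 0)
  have hr := norm_pos_iff.2 (regJost_ne_zero hω hα hE)
  rw [phase, norm_mul, Complex.norm_real, Real.norm_eq_abs, abs_div, abs_mul, abs_abs, abs_norm]
  field_simp

theorem continuousOn_signRatio (hω : 0 < ω) (hα : ω < α) :
    ContinuousOn (fun E => v ω 0 0 E / (|v ω 0 0 E| * ‖regJost α ω E‖)) (exceptional ω)ᶜ :=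
  (continuousOn_v_zero ω 0).div
    ((continuousOn_v_zero ω 0).abs.mul (continuousOn_regJost hω hα).norm) fun _ hE =>
      mul_ne_zero (abs_ne_zero.2 (v_zero_ne_zero hE 0))
        (norm_ne_zero_iff.2 (regJost_ne_zero hω hα hE))

theorem continuousOn_phase (hω : 0 < ω) (hα : ω < α) :
    ContinuousOn (phase α ω) (exceptional ω)ᶜ :=
  (Complex.continuous_ofReal.comp_continuousOn (continuousOn_signRatio hω hα)).mul
    (continuousOn_regJost hω hα)

theorem continuousOn_gain (hω : 0 < ω) (hα : ω < α) :
    ContinuousOn (gain α ω) (exceptional ω)ᶜ :=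
  continuousOn_const.mul (continuousOn_signRatio hω hα)

theorem coeff_eq (hω : 0 < ω) (hα : ω < α) {E : ℝ} (hE : E ∉ exceptional ω) (n : ℕ) :
    coeff α ω n E = gain α ω E * regSol α ω E n / v ω n 0 E := by
  rw [← v_mul_coeff hω hα hE, mul_div_cancel_left₀ _ (v_zero_ne_zero hE n)]

theorem continuousOn_coeff (hω : 0 < ω) (hα : ω < α) (n : ℕ) :
    ContinuousOn (coeff α ω n) (exceptional ω)ᶜ := by
  have h : ContinuousOn (fun E => gain α ω E * regSol α ω E n / v ω n 0 E) (exceptional ω)ᶜ :=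
    ((continuousOn_gain hω hα).mul (continuousOn_regSol α ω n)).div (continuousOn_v_zero ω n)
      fun _ hE => v_zero_ne_zero hE n
  exact h.congr fun E hE => coeff_eq hω hα hE n

/-- The amplitude of the eigenfunctions at the interaction point. -/
noncomputable def amp (α ω : ℝ) : ℝ :=
  (Real.pi * √(α ^ 2 - ω ^ 2)) ^ (-(1 / 2) : ℝ) * (2 * ω) ^ (1 / 4 : ℝ)

theorem amp_pos (hω : 0 < ω) (hα : ω < α) : 0 < amp α ω := by
  have := sqrt_sq_sub_pos hω hα
  have := Real.pi_pos
  unfold amp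
  positivity

/-- This is where the prescribed value of C(0,E)|Z(E)| matters: it makes the leading coefficient of
the kernel exactly 1/π, so that the limiting delta function has mass 1. -/
theorem amp_sq (hω : 0 < ω) (hα : ω < α) :
    α * amp α ω ^ 2 * Real.sin (theta α ω) = √(2 * ω) / Real.pi := by
  have h := sqrt_sq_sub_pos hω hα
  have hpi := Real.pi_pos
  have hα0 := hω.trans hα
  have e1 : ((Real.pi * √(α ^ 2 - ω ^ 2)) ^ (-(1 / 2) : ℝ)) ^ 2
      = (Real.pi * √(α ^ 2 - ω ^ 2))⁻¹ := by
    rw [← Real.rpow_natCast, ← Real.rpow_mul (by positivity), ← Real.rpow_neg_one]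
    norm_num
  have e2 : ((2 * ω) ^ (1 / 4 : ℝ)) ^ 2 = √(2 * ω) := by
    rw [← Real.rpow_natCast, ← Real.rpow_mul (by positivity), Real.sqrt_eq_rpow]
    norm_num
  rw [amp, mul_pow, e1, e2, sin_theta hω hα]
  field_simp

theorem gain_mul_eq (E : ℝ) (z : ℂ) (h : 0 < Real.sin (theta α ω)) :
    gain α ω E * ((regJost α ω E * z).im / Real.sin (theta α ω))
      = amp α ω * (phase α ω E * z).im := by
  rw [gain, phase, mul_assoc (Complex.ofReal _), Complex.im_ofReal_mul, amp]
  field_simp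

/-- Uniform asymptotics of the eigenfunctions at the interaction point. -/
theorem exists_u_zero_asymptotics (hω : 0 < ω) (hα : ω < α) {K : Set ℝ} (hK : IsCompact K)
    (hKe : K ⊆ (exceptional ω)ᶜ) :
    ∃ (C : ℝ) (N : ℕ), 0 ≤ C ∧ 1 ≤ N ∧ ∀ E ∈ K, ∀ n, N ≤ n →
      |u α ω n 0 E - amp α ω * (conj (phase α ω E) * osc (theta α ω) (lam α ω * E) n).im|
        ≤ C * (n : ℝ) ^ (-(5 / 4) : ℝ) := by
  obtain ⟨C, N, hC, hN, h⟩ := exists_regSol_asymptotics hω hα hK hKe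
  obtain ⟨M, hM⟩ := hK.exists_bound_of_continuousOn ((continuousOn_gain hω hα).mono hKe)
  refine ⟨|M| * C, N, by positivity, hN, fun E hE n hn => ?_⟩
  have h1 := ((h E hE).2.2 n hn).2
  have hg : |gain α ω E| ≤ |M| := (hM E hE).trans (le_abs_self M)
  have h2 := gain_mul_eq E (conj (osc (theta α ω) (lam α ω * E) n)) (sin_theta_pos hω hα)
  have h3 : (conj (phase α ω E) * osc (theta α ω) (lam α ω * E) n).im
      = -(phase α ω E * conj (osc (theta α ω) (lam α ω * E) n)).im := by
    rw [← Complex.conj_im, map_mul, Complex.conj_conj]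
  rw [u_zero_eq hω hα (hKe hE), h3, mul_neg, sub_neg_eq_add, ← h2, ← mul_add, abs_mul, mul_assoc]
  gcongr

/-- To leading order one step merely rotates the profile by θ. The lower bound on n keeps the
remaining exponent within the unit disc. -/
theorem norm_osc_succ_sub_le (θ : ℝ) {μ R : ℝ} (hμ : |μ| ≤ R) {n : ℕ} (hn : 1 + R ≤ n) :
    ‖osc θ μ (n + 1 : ℕ) - Complex.exp (Complex.I * θ) * osc θ μ n‖
      ≤ 2 * (1 + R) * (n : ℝ) ^ (-(5 / 4) : ℝ) := by
  have hR : 0 ≤ R := (abs_nonneg _).trans hμ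
  have hn0 : (0 : ℝ) < n := by linarith
  have hn1 : 1 ≤ n := by exact_mod_cast (by linarith : (1 : ℝ) ≤ n)
  obtain ⟨l0, l1⟩ := log_one_add_one_div_le hn1
  set l := Real.log (1 + 1 / (n : ℝ)) with hl
  have hz : ‖(-(1 / 4) - Complex.I * μ : ℂ) * l‖ ≤ (1 + R) * (1 / n) := by
    rw [norm_mul, Complex.norm_real, Real.norm_eq_abs, abs_of_nonneg l0]
    gcongr
    refine (norm_sub_le _ _).trans ?_
    rw [norm_mul, Complex.norm_I, Complex.norm_real, Real.norm_eq_abs]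
    norm_num
    linarith
  have hz1 : ‖(-(1 / 4) - Complex.I * μ : ℂ) * l‖ ≤ 1 := by
    refine hz.trans ?_
    rw [mul_one_div, div_le_one hn0]
    exact hn
  have he := Complex.norm_exp_sub_one_le hz1
  have e : osc θ μ (n + 1 : ℕ) - Complex.exp (Complex.I * θ) * osc θ μ n
      = osc θ μ n * Complex.exp (Complex.I * θ) *
        (Complex.exp ((-(1 / 4) - Complex.I * μ : ℂ) * l) - 1) := by
    rw [Nat.cast_add, Nat.cast_one, osc_add θ μ hn0 (by linarith), ← hl]
    push_cast
    ring_nf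
  have hN : ‖Complex.exp (Complex.I * θ)‖ = 1 := by rw [Complex.norm_exp]; simp
  have hp : (n : ℝ) ^ (-(5 / 4) : ℝ) = (n : ℝ) ^ (-(1 / 4) : ℝ) * (1 / n) := by
    rw [one_div (n : ℝ), ← Real.rpow_neg_one, ← Real.rpow_add hn0]; norm_num
  rw [e, norm_mul, norm_mul, hN, mul_one, norm_osc _ _ hn0.le, hp]
  calc _ ≤ (n : ℝ) ^ (-(1 / 4) : ℝ) * (2 * ((1 + R) * (1 / n))) := by
        gcongr
        exact he.trans (by gcongr)
    _ = _ := by ring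

/-- The leading part of the kernel, up to the factor `1/π`. -/
noncomputable def oscKernel (α ω : ℝ) (N : ℕ) (x y : ℝ) : ℝ :=
  (phase α ω x * conj (phase α ω y) *
    Complex.exp (Complex.I * ((lam α ω * Real.log N) * (x - y) : ℝ))).im

theorem abs_oscKernel_le (hω : 0 < ω) (hα : ω < α) {x y : ℝ} (hx : x ∉ exceptional ω)
    (hy : y ∉ exceptional ω) (N : ℕ) : |oscKernel α ω N x y| ≤ 1 := by
  refine (Complex.abs_im_le_norm _).trans ?_
  rw [norm_mul, norm_mul, RCLike.norm_conj, norm_phase hω hα hx, norm_phase hω hα hy,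
    Complex.norm_exp_I_mul_ofReal, one_mul, one_mul]

/-- The bracket is antisymmetric, so the cos θ part drops out and it equals -sin θ Im(w_x conj w_y).
In this product the fast phase Nθ cancels; only λ log N · (x-y) is left. -/
theorem osc_bracket (α ω : ℝ) (N : ℕ) (x y : ℝ) {w : ℝ → ℂ}
    (hw : ∀ E, w E = conj (phase α ω E) * osc (theta α ω) (lam α ω * E) N) :
    (Complex.exp (Complex.I * theta α ω) * w x).im * (w y).im
      - (Complex.exp (Complex.I * theta α ω) * w y).im * (w x).im
      = Real.sin (theta α ω) * (((N : ℝ) ^ (-(1 / 4) : ℝ)) ^ 2 * oscKernel α ω N x y) := by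
  set p := (N : ℝ) ^ (-(1 / 4) : ℝ) with hp
  have hex : Complex.exp (Complex.I * theta α ω)
      = Real.cos (theta α ω) + Complex.I * Real.sin (theta α ω) := by
    rw [mul_comm Complex.I, Complex.exp_mul_I]
    push_cast
    ring
  have h1 : p ^ 2 * oscKernel α ω N x y = -(w x * conj (w y)).im := by
    have h2 : conj (w x * conj (w y)) = ((p ^ 2 : ℝ) : ℂ) * (phase α ω x * conj (phase α ω y) *
        Complex.exp (Complex.I * ((lam α ω * Real.log N) * (x - y) : ℝ))) := by
      have h5 : (((lam α ω * Real.log N) * (x - y) : ℝ) : ℂ)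
          = ((N * theta α ω - lam α ω * y * Real.log N : ℝ) : ℂ)
            - ((N * theta α ω - lam α ω * x * Real.log N : ℝ) : ℂ) := by
        rw [← Complex.ofReal_sub]
        congr 1
        ring
      rw [h5, hw, hw, osc, osc, ← hp]
      generalize ((N * theta α ω - lam α ω * y * Real.log N : ℝ)) = ty
      generalize ((N * theta α ω - lam α ω * x * Real.log N : ℝ)) = tx
      have h6 : Complex.exp (Complex.I * (ty - tx))
          = Complex.exp (-Complex.I * tx) * Complex.exp (Complex.I * ty) := by
        rw [← Complex.exp_add]
        congr 1
        ring
      rw [h6]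
      simp only [map_mul, Complex.conj_conj, Complex.conj_ofReal, ← Complex.exp_conj,
        Complex.conj_I, map_neg, neg_neg]
      push_cast
      ring
    rw [← Complex.conj_im, h2, Complex.im_ofReal_mul, oscKernel]
  rw [h1, hex]
  simp only [Complex.mul_im, Complex.add_re, Complex.add_im, Complex.mul_re, Complex.I_re,
    Complex.I_im, Complex.ofReal_re, Complex.ofReal_im, Complex.conj_re, Complex.conj_im]
  ring

theorem sqrt_add_one_mul_rpow_sq_bounds {N : ℕ} (hN : 1 ≤ N) :
    1 ≤ √((N : ℝ) + 1) * ((N : ℝ) ^ (-(1 / 4) : ℝ)) ^ 2 ∧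
      √((N : ℝ) + 1) * ((N : ℝ) ^ (-(1 / 4) : ℝ)) ^ 2 ≤ 1 + 1 / N := by
  have hN0 : (0 : ℝ) < N := by exact_mod_cast hN
  have e1 : ((N : ℝ) ^ (-(1 / 4) : ℝ)) ^ 2 = (√(N : ℝ))⁻¹ := by
    rw [Real.sqrt_eq_rpow, ← Real.rpow_natCast, ← Real.rpow_mul hN0.le, ← Real.rpow_neg hN0.le]
    norm_num
  have e2 : ((N : ℝ) + 1) / N = 1 + 1 / N := by field_simp
  have h0 : (0 : ℝ) ≤ 1 / N := by positivity
  rw [e1, ← div_eq_mul_inv, ← Real.sqrt_div (by positivity), e2]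
  exact ⟨Real.one_le_sqrt.2 (by linarith),
    Real.sqrt_le_left (by positivity) |>.2 (by nlinarith)⟩

theorem abs_mul_sub_mul_le {a b a' b' A B ε : ℝ} (ha : |a| ≤ A) (hb' : |b'| ≤ B)
    (hda : |a - a'| ≤ ε) (hdb : |b - b'| ≤ ε) : |a * b - a' * b'| ≤ (A + B) * ε := by
  have hA := (abs_nonneg _).trans ha
  have hε := (abs_nonneg _).trans hda
  calc |a * b - a' * b'| = |a * (b - b') + (a - a') * b'| := by congr 1; ring
    _ ≤ |a| * |b - b'| + |a - a'| * |b'| := by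
      rw [← abs_mul, ← abs_mul]; exact abs_add_le _ _
    _ ≤ A * ε + ε * B := by gcongr
    _ = _ := by ring

/-- Insert the asymptotics of u_N(0) and u_{N+1}(0) into Christoffel–Darboux. Main terms have size
N^(-1/4) and errors N^(-5/4), so products err by N^(-3/2), and the weight √(N+1) leaves O(1/N). -/
theorem exists_kernel_asymptotics (hω : 0 < ω) (hα : ω < α) {K : Set ℝ} (hK : IsCompact K)
    (hKe : K ⊆ (exceptional ω)ᶜ) :
    ∃ (C : ℝ) (N₀ : ℕ), 0 ≤ C ∧ ∀ x ∈ K, ∀ y ∈ K, ∀ N, N₀ ≤ N →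
      |(x - y) * partialKernel α ω N x y - oscKernel α ω N x y / Real.pi| ≤ C / N := by
  obtain ⟨C, N₁, hC, hN₁, h⟩ := exists_u_zero_asymptotics hω hα hK hKe
  obtain ⟨R', hR'⟩ := hK.isBounded.exists_norm_le
  set R := |lam α ω| * |R'| with hR
  have hR0 : 0 ≤ R := by positivity
  obtain ⟨N₂, hN₂⟩ := exists_nat_ge (1 + R)
  have hA := amp_pos hω hα
  set A := amp α ω with hAdef
  set s := Real.sin (theta α ω) with hs
  have hs0 : 0 < s := sin_theta_pos hω hα
  have hα0 := hω.trans hα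
  have hq : 0 < √(2 * ω) := Real.sqrt_pos.2 (by positivity)
  set ε' := C + A * (2 * (1 + R)) with hε'
  have hε'0 : 0 ≤ ε' := by positivity
  -- The leading 2 bounds r = √(N+1) · N^(-1/2), and the final 1 pays for replacing r by 1 in the
  -- main term.
  refine ⟨2 / √(2 * ω) * α * (2 * ((2 * A + ε') * ε')) + 1, max N₁ N₂, by positivity,
    fun x hx y hy N hN => ?_⟩
  have hn1 : N₁ ≤ N := (le_max_left _ _).trans hN
  have hN1 : 1 ≤ N := hN₁.trans hn1
  have hN0 : (0 : ℝ) < N := by exact_mod_cast hN1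
  have hN1' : (1 : ℝ) ≤ N := by exact_mod_cast hN1
  have hn2 : 1 + R ≤ N := hN₂.trans (by exact_mod_cast (le_max_right _ _).trans hN)
  set p := (N : ℝ) ^ (-(1 / 4) : ℝ) with hp
  have hp0 : 0 < p := by positivity
  set ε := ε' * (N : ℝ) ^ (-(5 / 4) : ℝ) with hε
  have hpe : (N : ℝ) ^ (-(5 / 4) : ℝ) = p * (1 / N) := by
    rw [hp, one_div (N : ℝ), ← Real.rpow_neg_one, ← Real.rpow_add hN0]; norm_num
  have hεp : ε ≤ ε' * p := by
    rw [hε, hpe]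
    gcongr
    exact mul_le_of_le_one_right hp0.le (by rw [div_le_one hN0]; exact hN1')
  -- the two components at energy `E`
  set w : ℝ → ℂ := fun E => conj (phase α ω E) * osc (theta α ω) (lam α ω * E) N with hw
  set e := Complex.exp (Complex.I * theta α ω) with he
  have hne : ‖e‖ = 1 := by rw [he, Complex.norm_exp]; simp
  have hnw : ∀ E ∈ K, ‖w E‖ = p := by
    intro E hE
    simp only [hw]
    rw [norm_mul, RCLike.norm_conj, norm_phase hω hα (hKe hE), one_mul, norm_osc _ _ hN0.le]
  have u0 : ∀ E ∈ K, |u α ω N 0 E - A * (w E).im| ≤ ε := by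
    intro E hE
    refine (h E hE N hn1).trans ?_
    rw [hε, hε']
    gcongr
    have : 0 ≤ A * (2 * (1 + R)) := by positivity
    linarith
  have u1 : ∀ E ∈ K, |u α ω (N + 1) 0 E - A * (e * w E).im| ≤ ε := by
    intro E hE
    have h1 := h E hE (N + 1) (hn1.trans (Nat.le_succ N))
    have hμ : |lam α ω * E| ≤ R := by
      rw [abs_mul]
      exact mul_le_mul_of_nonneg_left ((hR' E hE).trans (le_abs_self _)) (abs_nonneg _)
    have h2 := norm_osc_succ_sub_le (theta α ω) hμ hn2
    have h3 : ((N + 1 : ℕ) : ℝ) ^ (-(5 / 4) : ℝ) ≤ (N : ℝ) ^ (-(5 / 4) : ℝ) :=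
      Real.rpow_le_rpow_of_nonpos hN0 (by push_cast; linarith) (by norm_num)
    have h4 : |A * (conj (phase α ω E) * osc (theta α ω) (lam α ω * E) (N + 1 : ℕ)).im
        - A * (e * w E).im| ≤ A * (2 * (1 + R) * (N : ℝ) ^ (-(5 / 4) : ℝ)) := by
      rw [← mul_sub, abs_mul, abs_of_pos hA, ← Complex.sub_im]
      gcongr
      refine (Complex.abs_im_le_norm _).trans ?_
      have : conj (phase α ω E) * osc (theta α ω) (lam α ω * E) (N + 1 : ℕ) - e * w E
          = conj (phase α ω E) * (osc (theta α ω) (lam α ω * E) (N + 1 : ℕ)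
            - e * osc (theta α ω) (lam α ω * E) N) := by
        simp only [hw]; ring
      rw [this, norm_mul, RCLike.norm_conj, norm_phase hω hα (hKe hE), one_mul]
      exact h2
    calc _ ≤ C * ((N + 1 : ℕ) : ℝ) ^ (-(5 / 4) : ℝ) + A * (2 * (1 + R) * (N : ℝ) ^ (-(5 / 4) : ℝ)) :=
          (abs_sub_le _ _ _).trans (add_le_add h1 h4)
      _ ≤ C * (N : ℝ) ^ (-(5 / 4) : ℝ) + A * (2 * (1 + R) * (N : ℝ) ^ (-(5 / 4) : ℝ)) := by gcongr
      _ = _ := by rw [hε, hε']; ring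
  have m0 : ∀ E ∈ K, |A * (w E).im| ≤ A * p := by
    intro E hE
    rw [abs_mul, abs_of_pos hA, ← hnw E hE]
    gcongr
    exact Complex.abs_im_le_norm _
  have m1 : ∀ E ∈ K, |A * (e * w E).im| ≤ A * p := by
    intro E hE
    rw [abs_mul, abs_of_pos hA]
    gcongr
    refine (Complex.abs_im_le_norm _).trans ?_
    rw [norm_mul, hne, one_mul, hnw E hE]
  have b1 : ∀ E ∈ K, |u α ω (N + 1) 0 E| ≤ (A + ε') * p := by
    intro E hE
    have := abs_sub_abs_le_abs_sub (u α ω (N + 1) 0 E) (A * (e * w E).im)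
    have := u1 E hE
    have := m1 E hE
    linarith
  have d1 := abs_mul_sub_mul_le (b1 x hx) (m0 y hy) (u1 x hx) (u0 y hy)
  have d2 := abs_mul_sub_mul_le (b1 y hy) (m0 x hx) (u1 y hy) (u0 x hx)
  have hmain : A * (e * w x).im * (A * (w y).im) - A * (e * w y).im * (A * (w x).im)
      = A ^ 2 * s * (p ^ 2 * oscKernel α ω N x y) := by
    linear_combination A ^ 2 * osc_bracket α ω N x y (w := w) fun _ => rfl
  set Br := u α ω (N + 1) 0 x * u α ω N 0 y - u α ω N 0 x * u α ω (N + 1) 0 y with hBr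
  have hBrb : |Br - A ^ 2 * s * (p ^ 2 * oscKernel α ω N x y)|
      ≤ 2 * ((2 * A + ε') * ε') * (p ^ 2 / N) := by
    rw [← hmain]
    have : Br - (A * (e * w x).im * (A * (w y).im) - A * (e * w y).im * (A * (w x).im))
        = (u α ω (N + 1) 0 x * u α ω N 0 y - A * (e * w x).im * (A * (w y).im))
          - (u α ω (N + 1) 0 y * u α ω N 0 x - A * (e * w y).im * (A * (w x).im)) := by
      rw [hBr]; ring
    rw [this]
    refine (abs_sub _ _).trans ((add_le_add d1 d2).trans (le_of_eq ?_))
    rw [hε, hpe]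
    ring
  have hCD := sub_mul_partialKernel hω hα (hKe hx) (hKe hy) N
  rw [← hBr] at hCD
  have hO := abs_oscKernel_le hω hα (hKe hx) (hKe hy) N
  set O := oscKernel α ω N x y with hOdef
  set T := (x - y) * partialKernel α ω N x y with hT
  have hamp := amp_sq hω hα
  rw [← hAdef, ← hs] at hamp
  set r := √((N : ℝ) + 1) * p ^ 2 with hr
  have hr1 : 1 ≤ r ∧ r ≤ 1 + 1 / N := sqrt_add_one_mul_rpow_sq_bounds hN1
  have hsplit : T - O / Real.pi = α * √((N : ℝ) + 1) * (Br - A ^ 2 * s * (p ^ 2 * O)) / √(2 * ω)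
      + (r - 1) * O / Real.pi := by
    have h9 : T = α * √((N : ℝ) + 1) * Br / √(2 * ω) := by
      rw [← hCD]; field_simp
    have h10 : α * √((N : ℝ) + 1) * (A ^ 2 * s * (p ^ 2 * O)) / √(2 * ω) = r * O / Real.pi := by
      have : α * √((N : ℝ) + 1) * (A ^ 2 * s * (p ^ 2 * O)) = (α * A ^ 2 * s) * (r * O) := by
        rw [hr]; ring
      rw [this, hamp]
      field_simp
    rw [h9]
    linear_combination h10
  have hpi : (1 : ℝ) ≤ Real.pi := by linarith [Real.pi_gt_three]
  rw [hsplit]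
  calc _ ≤ |α * √((N : ℝ) + 1) * (Br - A ^ 2 * s * (p ^ 2 * O)) / √(2 * ω)|
        + |(r - 1) * O / Real.pi| := abs_add_le _ _
    _ = α * √((N : ℝ) + 1) * |Br - A ^ 2 * s * (p ^ 2 * O)| / √(2 * ω)
        + (r - 1) * |O| / Real.pi := by
      rw [abs_div, abs_mul, abs_of_nonneg (a := α * √((N : ℝ) + 1)) (by positivity),
        abs_of_pos hq, abs_div, abs_mul, abs_of_nonneg (a := r - 1) (by linarith [hr1.1]),
        abs_of_pos Real.pi_pos]
    _ ≤ α * √((N : ℝ) + 1) * (2 * ((2 * A + ε') * ε') * (p ^ 2 / N)) / √(2 * ω)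
        + (1 / N) * 1 / 1 := by
      gcongr
      linarith [hr1.2]
    _ = α * (2 * ((2 * A + ε') * ε')) * r / √(2 * ω) / N + 1 / N := by rw [hr]; ring
    _ ≤ α * (2 * ((2 * A + ε') * ε')) * 2 / √(2 * ω) / N + 1 / N := by
      gcongr
      have : (1 : ℝ) / N ≤ 1 := by rw [div_le_one hN0]; exact hN1'
      linarith [hr1.2]
    _ = _ := by ring

/-- The v_n are unit vectors, so |P_n| is at most the product of the coefficients, each O(n^(-1/2))
as the quotient of u_n(0) = O(n^(-1/4)) by v_n(0), whose inverse is O(n^(-1/4)). -/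
theorem exists_P_bound (hω : 0 < ω) (hα : ω < α) {K : Set ℝ} (hK : IsCompact K)
    (hKe : K ⊆ (exceptional ω)ᶜ) :
    ∃ C : ℝ, 0 ≤ C ∧ ∀ x ∈ K, ∀ y ∈ K, ∀ n : ℕ, |P α ω n x y| ≤ C / ((n : ℝ) + 1) := by
  obtain ⟨C, N₁, hC, hN₁, h⟩ := exists_u_zero_asymptotics hω hα hK hKe
  obtain ⟨R, hR⟩ := hK.isBounded.exists_norm_le
  obtain ⟨C₃, N₃, hC₃, hN₃, h3⟩ := exists_v_zero_asymptotics hω R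
  have hA := amp_pos hω hα
  set A := amp α ω
  choose M hM using fun n => hK.exists_bound_of_continuousOn ((continuousOn_coeff hω hα n).mono hKe)
  set N := max N₁ N₃ with hN
  -- a bound on the coefficients
  have hc : ∀ E ∈ K, ∀ n, N ≤ n → |coeff α ω n E| ≤ (A + C) * C₃ * (n : ℝ) ^ (-(1 / 2) : ℝ) := by
    intro E hE n hn
    have hn1 : 1 ≤ n := hN₁.trans ((le_max_left _ _).trans hn)
    have hn0 : (0 : ℝ) < n := by exact_mod_cast hn1
    obtain ⟨hv, -, r4, -⟩ := h3 n ((le_max_right _ _).trans hn) E (hR E hE)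
    have h1 := h E hE n ((le_max_left _ _).trans hn)
    have h2 : |u α ω n 0 E| ≤ (A + C) * (n : ℝ) ^ (-(1 / 4) : ℝ) := by
      have h4 : |A * (conj (phase α ω E) * osc (theta α ω) (lam α ω * E) n).im|
          ≤ A * (n : ℝ) ^ (-(1 / 4) : ℝ) := by
        rw [abs_mul, abs_of_pos hA]
        gcongr
        refine (Complex.abs_im_le_norm _).trans ?_
        rw [norm_mul, RCLike.norm_conj, norm_phase hω hα (hKe hE), one_mul, norm_osc _ _ hn0.le]
      have h5 : (n : ℝ) ^ (-(5 / 4) : ℝ) ≤ (n : ℝ) ^ (-(1 / 4) : ℝ) :=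
        Real.rpow_le_rpow_of_exponent_le (by exact_mod_cast hn1) (by norm_num)
      have h6 := abs_sub_abs_le_abs_sub (u α ω n 0 E)
        (A * (conj (phase α ω E) * osc (theta α ω) (lam α ω * E) n).im)
      have h7 : C * (n : ℝ) ^ (-(5 / 4) : ℝ) ≤ C * (n : ℝ) ^ (-(1 / 4) : ℝ) := by gcongr
      linarith
    have h8 : coeff α ω n E = u α ω n 0 E * (v ω n 0 E)⁻¹ := by
      rw [u]; field_simp
    have hp : (n : ℝ) ^ (-(1 / 2) : ℝ) = (n : ℝ) ^ (-(1 / 4) : ℝ) * (n : ℝ) ^ (-(1 / 4) : ℝ) := by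
      rw [← Real.rpow_add hn0]; norm_num
    rw [h8, abs_mul, abs_of_pos (inv_pos.2 hv), hp]
    calc _ ≤ (A + C) * (n : ℝ) ^ (-(1 / 4) : ℝ) * (C₃ * (n : ℝ) ^ (-(1 / 4) : ℝ)) := by gcongr
      _ = _ := by ring
  have hP : ∀ x ∈ K, ∀ y ∈ K, ∀ n, |P α ω n x y| ≤ |coeff α ω n x| * |coeff α ω n y| := by
    intro x hx y hy n
    rw [P_eq, abs_mul, abs_mul]
    exact mul_le_of_le_one_right (by positivity)
      (abs_integral_v_mul_v_le (kSq_ne_zero (hKe hx) n) (kSq_ne_zero (hKe hy) n))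
  -- Covers the finitely many levels before the asymptotics apply; the factor i + 1 undoes the
  -- division in the claim.
  set S := ∑ i ∈ Finset.range N, |M i| * |M i| * ((i : ℝ) + 1) with hS
  have hS0 : 0 ≤ S := Finset.sum_nonneg fun i _ => by positivity
  refine ⟨S + 2 * ((A + C) * C₃) ^ 2, by positivity, fun x hx y hy n => ?_⟩
  by_cases hn : N ≤ n
  · have hn1 : 1 ≤ n := hN₁.trans ((le_max_left _ _).trans hn)
    have hn0 : (1 : ℝ) ≤ n := by exact_mod_cast hn1
    have hp : (n : ℝ) ^ (-(1 / 2) : ℝ) * (n : ℝ) ^ (-(1 / 2) : ℝ) = 1 / n := by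
      rw [← Real.rpow_add (by linarith), one_div (n : ℝ), ← Real.rpow_neg_one]; norm_num
    calc _ ≤ _ := hP x hx y hy n
      _ ≤ ((A + C) * C₃ * (n : ℝ) ^ (-(1 / 2) : ℝ)) * ((A + C) * C₃ * (n : ℝ) ^ (-(1 / 2) : ℝ)) :=
        mul_le_mul (hc x hx n hn) (hc y hy n hn) (abs_nonneg _) (by positivity)
      _ = ((A + C) * C₃) ^ 2 * (1 / n) := by rw [← hp]; ring
      _ ≤ ((A + C) * C₃) ^ 2 * (2 / ((n : ℝ) + 1)) := by
        gcongr ?_ * ?_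
        rw [div_le_div_iff₀ (by linarith) (by linarith)]
        linarith
      _ = (2 * ((A + C) * C₃) ^ 2) / ((n : ℝ) + 1) := by ring
      _ ≤ _ := by gcongr; linarith
  · have h1 : |M n| * |M n| * ((n : ℝ) + 1) ≤ S :=
      Finset.single_le_sum (f := fun i : ℕ => |M i| * |M i| * ((i : ℝ) + 1))
        (fun i _ => by positivity) (Finset.mem_range.2 (not_le.1 hn))
    rw [le_div_iff₀ (by positivity)]
    have h2 : |coeff α ω n x| ≤ |M n| := (hM n x hx).trans (le_abs_self _)
    have h3 : |coeff α ω n y| ≤ |M n| := (hM n y hy).trans (le_abs_self _)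
    calc _ ≤ |M n| * |M n| * ((n : ℝ) + 1) := by
          gcongr
          exact (hP x hx y hy n).trans (mul_le_mul h2 h3 (abs_nonneg _) (abs_nonneg _))
      _ ≤ S := h1
      _ ≤ _ := by have : 0 ≤ 2 * ((A + C) * C₃) ^ 2 := by positivity
                  linarith

/-- A harmonic sum. It is needed near the diagonal, where control of (x-y) K_N says nothing about
K_N. -/
theorem exists_partialKernel_bound (hω : 0 < ω) (hα : ω < α) {K : Set ℝ} (hK : IsCompact K)
    (hKe : K ⊆ (exceptional ω)ᶜ) :
    ∃ C : ℝ, 0 ≤ C ∧ ∀ x ∈ K, ∀ y ∈ K, ∀ N : ℕ,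
      |partialKernel α ω N x y| ≤ C * (1 + Real.log ((N : ℝ) + 1)) := by
  obtain ⟨C, hC, h⟩ := exists_P_bound hω hα hK hKe
  refine ⟨C, hC, fun x hx y hy N => ?_⟩
  have h1 : (harmonic (N + 1) : ℝ) ≤ 1 + Real.log ((N + 1 : ℕ) : ℝ) := harmonic_le_one_add_log _
  have h2 : (harmonic (N + 1) : ℝ) = ∑ i ∈ Finset.range (N + 1), 1 / ((i : ℝ) + 1) := by
    rw [harmonic]
    push_cast
    simp [one_div]
  push_cast at h1
  calc |partialKernel α ω N x y| ≤ ∑ n ∈ Finset.range (N + 1), |P α ω n x y| :=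
        Finset.abs_sum_le_sum_abs _ _
    _ ≤ ∑ n ∈ Finset.range (N + 1), C * (1 / ((n : ℝ) + 1)) := by
        refine Finset.sum_le_sum fun n _ => (h x hx y hy n).trans (le_of_eq ?_)
        ring
    _ = C * harmonic (N + 1) := by rw [h2, Finset.mul_sum]
    _ ≤ _ := by gcongr

end Kernel
-- Wave packets ∫ Ψ(E) u_n(x,E) dE and Fubini.
section Packet

variable {α ω : ℝ}

theorem Admissible.eq_zero {Ψ : ℝ → ℂ} {E : ℝ} (h : E ∉ tsupport Ψ) : Ψ E = 0 :=
  image_eq_zero_of_notMem_tsupport h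

theorem Admissible.notMem {Ψ : ℝ → ℂ} (hΨ : Admissible ω Ψ) {E : ℝ} (h : E ∈ tsupport Ψ) :
    E ∉ exceptional ω :=
  Set.disjoint_left.1 hΨ.disjoint h

theorem continuousOn_u (hω : 0 < ω) (hα : ω < α) (n : ℕ) :
    ContinuousOn (fun p : ℝ × ℝ => u α ω n p.1 p.2) (Set.univ ×ˢ (exceptional ω)ᶜ) :=
  ((continuousOn_coeff hω hα n).comp continuousOn_snd fun _ hp => hp.2).mul (continuousOn_v ω n)

/-- Each exceptional energy has a neighbourhood on which Ψ vanishes, so the behaviour of f there is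
irrelevant. -/
theorem Admissible.continuous_mul {X : Type*} [TopologicalSpace X] (hω : 0 < ω) {Ψ : ℝ → ℂ}
    (hΨ : Admissible ω Ψ) {f : X × ℝ → ℂ} (hf : ContinuousOn f (Set.univ ×ˢ (exceptional ω)ᶜ)) :
    Continuous fun p : X × ℝ => Ψ p.2 * f p := by
  rw [continuous_iff_continuousAt]
  intro p
  by_cases hp : p.2 ∈ exceptional ω
  · have h1 : p.2 ∉ tsupport Ψ := fun h => hΨ.notMem h hp
    have h2 : ∀ᶠ q : X × ℝ in 𝓝 p, (0 : ℂ) = Ψ q.2 * f q := by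
      filter_upwards [((isClosed_tsupport Ψ).isOpen_compl.preimage continuous_snd).mem_nhds h1]
        with q hq
      rw [Admissible.eq_zero hq, zero_mul]
    exact continuousAt_const.congr h2
  · exact (hΨ.continuous.comp continuous_snd).continuousAt.mul (hf.continuousAt
      ((isOpen_univ.prod (isClosed_exceptional hω).isOpen_compl).mem_nhds ⟨trivial, hp⟩))

theorem Admissible.continuous_mul_u (hω : 0 < ω) (hα : ω < α) {Ψ : ℝ → ℂ}
    (hΨ : Admissible ω Ψ) (n : ℕ) :
    Continuous fun p : ℝ × ℝ => Ψ p.2 * (u α ω n p.1 p.2 : ℂ) :=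
  hΨ.continuous_mul hω (Complex.continuous_ofReal.comp_continuousOn (continuousOn_u hω hα n))

theorem Admissible.integrable_mul_u (hω : 0 < ω) (hα : ω < α) {Ψ : ℝ → ℂ}
    (hΨ : Admissible ω Ψ) (n : ℕ) (x : ℝ) :
    Integrable fun E : ℝ => Ψ E * (u α ω n x E : ℂ) :=
  ((hΨ.continuous_mul_u hω hα n).comp (Continuous.prodMk_right x)).integrable_of_hasCompactSupport
    hΨ.hasCompactSupport.mul_right

/-- The components `∫ Ψ(E) u_n(x,E) dE` of the image of `Ψ`. -/
noncomputable def packet (α ω : ℝ) (Ψ : ℝ → ℂ) (n : ℕ) (x : ℝ) : ℂ :=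
  ∫ E : ℝ, Ψ E * (u α ω n x E : ℂ)

theorem Admissible.continuous_packet (hω : 0 < ω) (hα : ω < α) {Ψ : ℝ → ℂ}
    (hΨ : Admissible ω Ψ) (n : ℕ) : Continuous (packet α ω Ψ n) := by
  have h : packet α ω Ψ n = fun x => ∫ E in tsupport Ψ, Ψ E * (u α ω n x E : ℂ) := by
    funext x
    refine (setIntegral_eq_integral_of_forall_compl_eq_zero fun E hE => ?_).symm
    rw [Admissible.eq_zero hE, zero_mul]
  rw [h]
  exact continuous_parametric_integral_of_continuous
    (f := fun x E => Ψ E * (u α ω n x E : ℂ)) (hΨ.continuous_mul_u hω hα n) hΨ.hasCompactSupport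

theorem packet_neg (α ω : ℝ) (Ψ : ℝ → ℂ) (n : ℕ) (x : ℝ) :
    packet α ω Ψ n (-x) = packet α ω Ψ n x := by
  simp only [packet, u, v, abs_neg]

theorem integrable_prod_circle {X : Type*} [TopologicalSpace X] [MeasurableSpace X]
    [T2Space X] [BorelSpace X] [SecondCountableTopology X] {μ : Measure X} [SFinite μ]
    [IsFiniteMeasureOnCompacts μ]
    {f : X × ℝ → ℂ} (hf : Continuous f) {S : Set X} (hS : IsCompact S)
    (h0 : ∀ p : X × ℝ, p.1 ∉ S → f p = 0) : Integrable f (μ.prod circleMeasure) := by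
  have hs : Function.support f ⊆ S ×ˢ (Set.univ : Set ℝ) := fun p hp =>
    ⟨by_contra fun h => hp (h0 p h), trivial⟩
  rw [← integrableOn_iff_integrable_of_support_subset hs]
  have h1 : (μ.prod circleMeasure).restrict (S ×ˢ (Set.univ : Set ℝ))
      = (μ.prod volume).restrict (S ×ˢ Set.Icc (-Real.pi) Real.pi) := by
    rw [← Measure.prod_restrict, ← Measure.prod_restrict, Measure.restrict_univ, circleMeasure]
  rw [IntegrableOn, h1, ← Measure.prod_restrict]
  obtain ⟨M, hM⟩ := (hS.prod (isCompact_Icc (a := -Real.pi)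
    (b := Real.pi))).exists_bound_of_continuousOn hf.continuousOn
  have : IsFiniteMeasure (μ.restrict S) := ⟨by simpa using hS.measure_lt_top⟩
  have : IsFiniteMeasure ((volume : Measure ℝ).restrict (Set.Icc (-Real.pi) Real.pi)) :=
    ⟨by simp⟩
  refine Integrable.of_bound hf.aestronglyMeasurable M ?_
  rw [Measure.prod_restrict]
  exact ae_restrict_of_forall_mem (hS.measurableSet.prod measurableSet_Icc) hM

theorem Admissible.continuous_mul_P (hω : 0 < ω) (hα : ω < α) {Ψ Φ : ℝ → ℂ}
    (hΨ : Admissible ω Ψ) (hΦ : Admissible ω Φ) (n : ℕ) :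
    Continuous fun q : (ℝ × ℝ) × ℝ => conj (Ψ q.1.1 * (u α ω n q.2 q.1.1 : ℂ)) *
      (Φ q.1.2 * (u α ω n q.2 q.1.2 : ℂ)) :=
  (Complex.continuous_conj.comp ((hΨ.continuous_mul_u hω hα n).comp
    (continuous_snd.prodMk (continuous_fst.comp continuous_fst)))).mul
    ((hΦ.continuous_mul_u hω hα n).comp (continuous_snd.prodMk (continuous_snd.comp continuous_fst)))

theorem integral_conj_mul_u (α ω : ℝ) (Ψ Φ : ℝ → ℂ) (n : ℕ) (p : ℝ × ℝ) :
    ∫ x, conj (Ψ p.1 * (u α ω n x p.1 : ℂ)) * (Φ p.2 * (u α ω n x p.2 : ℂ)) ∂circleMeasure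
      = conj (Ψ p.1) * Φ p.2 * (P α ω n p.1 p.2 : ℂ) := by
  rw [P, ← integral_complex_ofReal, ← integral_const_mul]
  refine integral_congr_ae (ae_of_all _ fun x => ?_)
  simp only [map_mul, Complex.conj_ofReal, Complex.ofReal_mul]
  ring

theorem Admissible.integrable_prod (hω : 0 < ω) (hα : ω < α) {Ψ Φ : ℝ → ℂ}
    (hΨ : Admissible ω Ψ) (hΦ : Admissible ω Φ) (n : ℕ) :
    Integrable (fun q : (ℝ × ℝ) × ℝ => conj (Ψ q.1.1 * (u α ω n q.2 q.1.1 : ℂ)) *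
      (Φ q.1.2 * (u α ω n q.2 q.1.2 : ℂ))) ((volume : Measure (ℝ × ℝ)).prod circleMeasure) := by
  refine integrable_prod_circle (hΨ.continuous_mul_P hω hα hΦ n)
    (hΨ.hasCompactSupport.isCompact.prod hΦ.hasCompactSupport.isCompact) fun q hq => ?_
  rw [Set.mem_prod, not_and_or] at hq
  rcases hq with h | h <;> simp [Admissible.eq_zero h]

theorem Admissible.integrable_mul_P (hω : 0 < ω) (hα : ω < α) {Ψ Φ : ℝ → ℂ}
    (hΨ : Admissible ω Ψ) (hΦ : Admissible ω Φ) (n : ℕ) :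
    Integrable fun p : ℝ × ℝ => conj (Ψ p.1) * Φ p.2 * (P α ω n p.1 p.2 : ℂ) := by
  have h := (hΨ.integrable_prod hω hα hΦ n).integral_prod_left
  simpa only [integral_conj_mul_u] using h

/-- Fubini moves the circle integral outside, where the energy integrals factor. The kernel form
thereby becomes an inner product of packets. -/
theorem Admissible.integral_mul_P (hω : 0 < ω) (hα : ω < α) {Ψ Φ : ℝ → ℂ}
    (hΨ : Admissible ω Ψ) (hΦ : Admissible ω Φ) (n : ℕ) :
    ∫ p : ℝ × ℝ, conj (Ψ p.1) * Φ p.2 * (P α ω n p.1 p.2 : ℂ)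
      = ∫ x, conj (packet α ω Ψ n x) * packet α ω Φ n x ∂circleMeasure := by
  have h := integral_integral_swap (f := fun (p : ℝ × ℝ) x => conj (Ψ p.1 * (u α ω n x p.1 : ℂ)) *
      (Φ p.2 * (u α ω n x p.2 : ℂ))) (hΨ.integrable_prod hω hα hΦ n)
  simp only [integral_conj_mul_u] at h
  rw [h]
  refine integral_congr_ae (ae_of_all _ fun x => ?_)
  simp only [packet]
  rw [← integral_conj]
  exact integral_prod_mul (μ := volume) (ν := volume)
    (fun E => conj (Ψ E * (u α ω n x E : ℂ))) fun E => Φ E * (u α ω n x E : ℂ)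

end Packet
-- Convergence of the partial kernels to the delta function.
section DeltaLimit

theorem lorentz_eq {δ : ℝ} (hδ : 0 < δ) (t : ℝ) :
    δ ^ 2 / (t ^ 2 + δ ^ 2) = (1 + (t / δ) ^ 2)⁻¹ := by
  have : 0 < t ^ 2 + δ ^ 2 := by positivity
  rw [div_pow, eq_comm, inv_eq_iff_eq_inv, inv_div]
  field_simp
  ring

theorem integrable_lorentz {δ : ℝ} (hδ : 0 < δ) (x : ℝ) :
    Integrable fun y : ℝ => δ ^ 2 / ((x - y) ^ 2 + δ ^ 2) := by
  simp only [lorentz_eq hδ]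
  exact (integrable_inv_one_add_sq.comp_div hδ.ne').comp_sub_left x

theorem integral_lorentz {δ : ℝ} (hδ : 0 < δ) (x : ℝ) :
    ∫ y : ℝ, δ ^ 2 / ((x - y) ^ 2 + δ ^ 2) = Real.pi * δ := by
  simp only [lorentz_eq hδ]
  rw [integral_sub_left_eq_self (fun t : ℝ => (1 + (t / δ) ^ 2)⁻¹) volume x,
    Measure.integral_comp_div (fun t : ℝ => (1 + t ^ 2)⁻¹), integral_univ_inv_one_add_sq,
    abs_of_pos hδ, smul_eq_mul, mul_comm]

theorem abs_div_sq_add_sq_le {δ : ℝ} (hδ : 0 < δ) (t : ℝ) :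
    |t / (t ^ 2 + δ ^ 2)| ≤ 1 / (2 * δ) := by
  have h : 0 < t ^ 2 + δ ^ 2 := by positivity
  rw [abs_div, abs_of_pos h, div_le_div_iff₀ h (by positivity), ← sq_abs t]
  nlinarith [sq_nonneg (|t| - δ)]

theorem continuous_regularized {δ : ℝ} (hδ : 0 < δ) :
    Continuous fun p : ℝ × ℝ => (p.1 - p.2) / ((p.1 - p.2) ^ 2 + δ ^ 2) := by
  refine Continuous.div (by fun_prop) (by fun_prop) fun p => ?_
  positivity

theorem continuous_lorentz {δ : ℝ} (hδ : 0 < δ) :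
    Continuous fun p : ℝ × ℝ => δ ^ 2 / ((p.1 - p.2) ^ 2 + δ ^ 2) := by
  refine Continuous.div (by fun_prop) (by fun_prop) fun p => ?_
  positivity

/-- δ²/(t²+δ²) has total mass πδ, so the neighbourhood of the diagonal spoiled by the regularization
costs only O(δ), which beats a logarithm. -/
theorem integral_mul_mul_lorentz_le {f : ℝ → ℝ} (hf : Continuous f) (hc : HasCompactSupport f)
    (h0 : ∀ x, 0 ≤ f x) {M : ℝ} (hM : ∀ x, f x ≤ M) {δ : ℝ} (hδ : 0 < δ) :
    Integrable (fun p : ℝ × ℝ => f p.1 * f p.2 * (δ ^ 2 / ((p.1 - p.2) ^ 2 + δ ^ 2))) ∧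
    ∫ p : ℝ × ℝ, f p.1 * f p.2 * (δ ^ 2 / ((p.1 - p.2) ^ 2 + δ ^ 2))
      ≤ (∫ x, f x) * (M * (Real.pi * δ)) := by
  have hi : Integrable (fun p : ℝ × ℝ => f p.1 * f p.2 * (δ ^ 2 / ((p.1 - p.2) ^ 2 + δ ^ 2))) := by
    refine Continuous.integrable_of_hasCompactSupport
      (((hf.comp continuous_fst).mul (hf.comp continuous_snd)).mul (continuous_lorentz hδ)) ?_
    refine HasCompactSupport.intro (hc.isCompact.prod hc.isCompact) fun p hp => ?_
    rw [Set.mem_prod, not_and_or] at hp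
    rcases hp with h | h <;> simp [image_eq_zero_of_notMem_tsupport h]
  refine ⟨hi, ?_⟩
  have hi1 := hf.integrable_of_hasCompactSupport hc (μ := volume)
  rw [Measure.volume_eq_prod] at hi ⊢
  rw [integral_prod _ hi, ← integral_mul_const]
  refine integral_mono hi.integral_prod_left (hi1.mul_const _) fun x => ?_
  simp only [mul_assoc]
  rw [integral_const_mul]
  refine mul_le_mul_of_nonneg_left ?_ (h0 x)
  rw [← integral_lorentz hδ x, ← integral_const_mul]
  refine integral_mono_of_nonneg (ae_of_all _ fun y => ?_) ((integrable_lorentz hδ x).const_mul M)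
    (ae_of_all _ fun y => ?_)
  · have := h0 y
    simp only [Pi.zero_apply]
    positivity
  · exact mul_le_mul_of_nonneg_right (hM y) (by positivity)

variable {α ω : ℝ}

/-- Split 1 = δ²/(t²+δ²) + t²/(t²+δ²): near the diagonal the bound on k is used, away from it the
bound on tk - o, with |t|/(t²+δ²) ≤ 1/(2δ). -/
theorem abs_kernel_sub_regularized_le {k t o B c δ : ℝ} (hδ : 0 < δ) (hk : |k| ≤ B)
    (ht : |t * k - o| ≤ c) :
    |k - o * (t / (t ^ 2 + δ ^ 2))| ≤ B * (δ ^ 2 / (t ^ 2 + δ ^ 2)) + c * (1 / (2 * δ)) := by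
  have h : 0 < t ^ 2 + δ ^ 2 := by positivity
  have e : k - o * (t / (t ^ 2 + δ ^ 2))
      = k * (δ ^ 2 / (t ^ 2 + δ ^ 2)) + (t * k - o) * (t / (t ^ 2 + δ ^ 2)) := by
    field_simp
    ring
  rw [e]
  refine (abs_add_le _ _).trans ?_
  rw [abs_mul, abs_mul, abs_of_nonneg (a := δ ^ 2 / (t ^ 2 + δ ^ 2)) (by positivity)]
  gcongr
  · exact (abs_nonneg _).trans ht
  · exact abs_div_sq_add_sq_le hδ t

theorem Admissible.integrable_mul_partialKernel (hω : 0 < ω) (hα : ω < α) {Ψ Φ : ℝ → ℂ}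
    (hΨ : Admissible ω Ψ) (hΦ : Admissible ω Φ) (N : ℕ) :
    Integrable fun p : ℝ × ℝ => conj (Ψ p.1) * Φ p.2 * (partialKernel α ω N p.1 p.2 : ℂ) := by
  have h := integrable_finsetSum (Finset.range (N + 1))
    fun n _ => hΨ.integrable_mul_P hω hα hΦ n
  refine h.congr (ae_of_all _ fun p => ?_)
  simp only [partialKernel, Complex.ofReal_sum, Finset.mul_sum]

theorem Admissible.continuous_mul_phase (hω : 0 < ω) (hα : ω < α) {Ψ : ℝ → ℂ}
    (hΨ : Admissible ω Ψ) : Continuous fun E => Ψ E * phase α ω E :=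
  (hΨ.continuous_mul (X := Unit) hω (f := fun p => phase α ω p.2)
    ((continuousOn_phase hω hα).comp continuousOn_snd fun _ hp => hp.2)).comp
    (Continuous.prodMk_right ())

theorem Admissible.continuous_mul_conj_phase (hω : 0 < ω) (hα : ω < α) {Ψ : ℝ → ℂ}
    (hΨ : Admissible ω Ψ) : Continuous fun E => Ψ E * conj (phase α ω E) :=
  (hΨ.continuous_mul (X := Unit) hω (f := fun p => conj (phase α ω p.2))
    (Complex.continuous_conj.comp_continuousOn
      ((continuousOn_phase hω hα).comp continuousOn_snd fun _ hp => hp.2))).comp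
    (Continuous.prodMk_right ())

theorem Admissible.norm_mul_phase (hω : 0 < ω) (hα : ω < α) {Ψ : ℝ → ℂ}
    (hΨ : Admissible ω Ψ) (E : ℝ) : ‖Ψ E‖ * ‖phase α ω E‖ = ‖Ψ E‖ := by
  by_cases h : E ∈ tsupport Ψ
  · rw [norm_phase hω hα (hΨ.notMem h), mul_one]
  · rw [Admissible.eq_zero h, norm_zero, zero_mul]

/-- The regularized leading part of the partial sums, in terms of Fourier-type integrals. -/
theorem Admissible.integral_oscKernel (hω : 0 < ω) (hα : ω < α) {Ψ : ℝ → ℂ}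
    (hΨ : Admissible ω Ψ) {δ : ℝ} (hδ : 0 < δ) (N : ℕ) {f₁ f₂ : ℝ → ℂ}
    (hf₁ : f₁ = fun E => Ψ E * conj (phase α ω E)) (hf₂ : f₂ = fun E => conj (Ψ E * phase α ω E)) :
    Integrable (fun p : ℝ × ℝ => conj (Ψ p.1) * Ψ p.2 *
      ((oscKernel α ω N p.1 p.2 / Real.pi *
        ((p.1 - p.2) / ((p.1 - p.2) ^ 2 + δ ^ 2)) : ℝ) : ℂ)) ∧
    ∫ p : ℝ × ℝ, conj (Ψ p.1) * Ψ p.2 *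
      ((oscKernel α ω N p.1 p.2 / Real.pi * ((p.1 - p.2) / ((p.1 - p.2) ^ 2 + δ ^ 2)) : ℝ) : ℂ)
      = (2 * Complex.I * Real.pi)⁻¹ * ((∫ p : ℝ × ℝ, conj (f₁ p.1) * f₁ p.2 *
          Complex.exp (Complex.I * ((lam α ω * Real.log N) * (p.1 - p.2) : ℝ)) *
          (((p.1 - p.2) / ((p.1 - p.2) ^ 2 + δ ^ 2) : ℝ) : ℂ)) +
        ∫ p : ℝ × ℝ, conj (f₂ p.1) * f₂ p.2 *
          Complex.exp (Complex.I * ((lam α ω * Real.log N) * (p.1 - p.2) : ℝ)) *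
          (((p.1 - p.2) / ((p.1 - p.2) ^ 2 + δ ^ 2) : ℝ) : ℂ)) := by
  have hc1 : Continuous f₁ := hf₁ ▸ hΨ.continuous_mul_conj_phase hω hα
  have hc2 : Continuous f₂ := hf₂ ▸ Complex.continuous_conj.comp (hΨ.continuous_mul_phase hω hα)
  have hi : ∀ f : ℝ → ℂ, Continuous f → (∀ E, E ∉ tsupport Ψ → f E = 0) →
      Integrable fun p : ℝ × ℝ => conj (f p.1) * f p.2 *
          Complex.exp (Complex.I * ((lam α ω * Real.log N) * (p.1 - p.2) : ℝ)) *
          (((p.1 - p.2) / ((p.1 - p.2) ^ 2 + δ ^ 2) : ℝ) : ℂ) := by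
    intro f hf h0
    refine Continuous.integrable_of_hasCompactSupport ?_ ?_
    · refine Continuous.mul (Continuous.mul ((Complex.continuous_conj.comp
        (hf.comp continuous_fst)).mul (hf.comp continuous_snd)) ?_)
        (Complex.continuous_ofReal.comp (continuous_regularized hδ))
      fun_prop
    · refine HasCompactSupport.intro (hΨ.hasCompactSupport.isCompact.prod
        hΨ.hasCompactSupport.isCompact) fun p hp => ?_
      rw [Set.mem_prod, not_and_or] at hp
      rcases hp with h | h <;> simp [h0 _ h]
  have i1 := hi f₁ hc1 fun E h => by rw [hf₁]; simp [Admissible.eq_zero h]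
  have i2 := hi f₂ hc2 fun E h => by rw [hf₂]; simp [Admissible.eq_zero h]
  have i3 := i2.swap
  -- Im z = (z - z̄)/(2i). The conjugate half takes the form of the other one, with f₂ for f₁, after
  -- exchanging the variables; its minus sign is absorbed by the oddness of t/(t²+δ²).
  have e : ∀ p : ℝ × ℝ, conj (Ψ p.1) * Ψ p.2 *
      ((oscKernel α ω N p.1 p.2 / Real.pi *
        ((p.1 - p.2) / ((p.1 - p.2) ^ 2 + δ ^ 2)) : ℝ) : ℂ)
      = (2 * Complex.I * Real.pi)⁻¹ * (conj (f₁ p.1) * f₁ p.2 *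
          Complex.exp (Complex.I * ((lam α ω * Real.log N) * (p.1 - p.2) : ℝ)) *
          (((p.1 - p.2) / ((p.1 - p.2) ^ 2 + δ ^ 2) : ℝ) : ℂ) +
        (fun p : ℝ × ℝ => conj (f₂ p.1) * f₂ p.2 *
          Complex.exp (Complex.I * ((lam α ω * Real.log N) * (p.1 - p.2) : ℝ)) *
          (((p.1 - p.2) / ((p.1 - p.2) ^ 2 + δ ^ 2) : ℝ) : ℂ)) p.swap) := by
    rintro ⟨x, y⟩
    have hz : ∀ z : ℂ, ((z.im : ℝ) : ℂ) = (2 * Complex.I)⁻¹ * (z - conj z) := by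
      intro z
      rw [Complex.sub_conj]
      field_simp
      push_cast
      ring
    have hpi : (Real.pi : ℂ) ≠ 0 := by exact_mod_cast Real.pi_ne_zero
    have ht : (y - x) / ((y - x) ^ 2 + δ ^ 2) = -((x - y) / ((x - y) ^ 2 + δ ^ 2)) := by
      rw [← neg_sub x y, neg_sq, neg_div]
    have hph : ((lam α ω * Real.log N) * (y - x) : ℝ) = -((lam α ω * Real.log N) * (x - y)) := by
      ring
    simp only [Prod.swap_prod_mk, hf₁, hf₂, ht, hph, oscKernel]
    rw [Complex.ofReal_mul, Complex.ofReal_div, hz]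
    generalize ((x - y) / ((x - y) ^ 2 + δ ^ 2) : ℝ) = q
    generalize ((lam α ω * Real.log N) * (x - y) : ℝ) = s
    simp only [map_mul, Complex.conj_conj, ← Complex.exp_conj, Complex.conj_I,
      Complex.conj_ofReal, Complex.ofReal_neg, neg_mul, mul_neg]
    field_simp
    ring
  simp only [e]
  refine ⟨(i1.add i3).const_mul _, ?_⟩
  rw [integral_const_mul]
  congr 1
  refine (integral_add i1 i3).trans ?_
  congr 1
  exact integral_prod_swap (μ := (volume : Measure ℝ)) (ν := (volume : Measure ℝ))
    fun p : ℝ × ℝ => conj (f₂ p.1) * f₂ p.2 *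
      Complex.exp (Complex.I * ((lam α ω * Real.log N) * (p.1 - p.2) : ℝ)) *
      (((p.1 - p.2) / ((p.1 - p.2) ^ 2 + δ ^ 2) : ℝ) : ℂ)

theorem tendsto_rpow_neg_half : Tendsto (fun N : ℕ => (N : ℝ) ^ (-(1 / 2) : ℝ)) atTop (𝓝 0) :=
  (tendsto_rpow_neg_atTop (by norm_num)).comp tendsto_natCast_atTop_atTop

theorem tendsto_rpow_neg_half_mul_log :
    Tendsto (fun N : ℕ => (N : ℝ) ^ (-(1 / 2) : ℝ) * Real.log N) atTop (𝓝 0) := by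
  have h := (isLittleO_log_rpow_atTop (r := 1 / 2) (by norm_num)).tendsto_div_nhds_zero
  refine (h.comp tendsto_natCast_atTop_atTop).congr fun N => ?_
  simp only [Function.comp_apply]
  rw [Real.rpow_neg (Nat.cast_nonneg N), div_eq_mul_inv, mul_comm]

/-- The kernel is compared with its regularized leading part, whose limit is known from
`tendsto_integral_regularized_kernel`. The phases are unimodular, so f₁ and f₂ have the same modulus
as Ψ and each contributes iπ‖Ψ‖². -/
theorem Admissible.tendsto_integral_partialKernel (hω : 0 < ω) (hα : ω < α) {Ψ : ℝ → ℂ}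
    (hΨ : Admissible ω Ψ) :
    Tendsto (fun N : ℕ => ∫ p : ℝ × ℝ,
      conj (Ψ p.1) * Ψ p.2 * (partialKernel α ω N p.1 p.2 : ℂ)) atTop
      (𝓝 ((∫ x, ‖Ψ x‖ ^ 2 : ℝ) : ℂ)) := by
  have hK : IsCompact (tsupport Ψ) := hΨ.hasCompactSupport.isCompact
  have hKe : tsupport Ψ ⊆ (exceptional ω)ᶜ := fun E hE => hΨ.notMem hE
  obtain ⟨C, N₀, hC, h1⟩ := exists_kernel_asymptotics hω hα hK hKe
  obtain ⟨B, hB, h2⟩ := exists_partialKernel_bound hω hα hK hKe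
  obtain ⟨M, hM⟩ := hΨ.hasCompactSupport.exists_bound_of_continuous hΨ.continuous
  -- The scale must satisfy δ log N → 0, both for the kernel limit and for the region near the
  -- diagonal, and 1/(Nδ) → 0 for the O(1/N) error; N^(-1/2) does both.
  set δ : ℕ → ℝ := fun N => (N : ℝ) ^ (-(1 / 2) : ℝ) with hδ
  have hδpos : ∀ N : ℕ, 1 ≤ N → 0 < δ N := fun N hN => by
    have : (0 : ℝ) < N := by exact_mod_cast hN
    simp only [hδ]
    positivity
  set L : ℕ → ℝ := fun N => lam α ω * Real.log N with hL
  have hlam : 0 < lam α ω := by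
    have := sqrt_sq_sub_pos hω hα
    unfold lam
    positivity
  have hLt : Tendsto L atTop atTop :=
    (Real.tendsto_log_atTop.comp tendsto_natCast_atTop_atTop).const_mul_atTop hlam
  have hLδ : Tendsto (fun n => δ n * L n) atTop (𝓝 0) := by
    have := tendsto_rpow_neg_half_mul_log.const_mul (lam α ω)
    rw [mul_zero] at this
    refine this.congr fun n => ?_
    simp only [hδ, hL]
    ring
  have hδe : ∀ᶠ n in atTop, 0 < δ n := (eventually_ge_atTop 1).mono hδpos
  set f₁ : ℝ → ℂ := fun E => Ψ E * conj (phase α ω E) with hf₁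
  set f₂ : ℝ → ℂ := fun E => conj (Ψ E * phase α ω E) with hf₂
  have hc1 : Continuous f₁ := hΨ.continuous_mul_conj_phase hω hα
  have hc2 : Continuous f₂ := Complex.continuous_conj.comp (hΨ.continuous_mul_phase hω hα)
  have hs1 : HasCompactSupport f₁ := hΨ.hasCompactSupport.mul_right
  have hs2 : HasCompactSupport f₂ :=
    HasCompactSupport.intro hK fun E h => by simp [hf₂, Admissible.eq_zero h]
  have n1 : ∀ E, ‖f₁ E‖ = ‖Ψ E‖ := fun E => by
    rw [hf₁, norm_mul, RCLike.norm_conj, hΨ.norm_mul_phase hω hα]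
  have n2 : ∀ E, ‖f₂ E‖ = ‖Ψ E‖ := fun E => by
    rw [hf₂, RCLike.norm_conj, norm_mul, hΨ.norm_mul_phase hω hα]
  have t1 := tendsto_integral_regularized_kernel hc1 hs1 hLt hδe hLδ
  have t2 := tendsto_integral_regularized_kernel hc2 hs2 hLt hδe hLδ
  simp only [n1, n2] at t1 t2
  have tm := (t1.add t2).const_mul (2 * Complex.I * Real.pi)⁻¹
  have hlim : (2 * Complex.I * Real.pi)⁻¹ * (Complex.I * Real.pi * ((∫ x, ‖Ψ x‖ ^ 2 : ℝ) : ℂ) +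
      Complex.I * Real.pi * ((∫ x, ‖Ψ x‖ ^ 2 : ℝ) : ℂ)) = ((∫ x, ‖Ψ x‖ ^ 2 : ℝ) : ℂ) := by
    have hpi : (Real.pi : ℂ) ≠ 0 := by exact_mod_cast Real.pi_ne_zero
    field_simp
    ring
  rw [hlim] at tm
  -- comparison of the partial sums with the regularized leading part
  set J := ∫ x, ‖Ψ x‖ with hJ
  have hJ0 : 0 ≤ J := integral_nonneg fun x => norm_nonneg _
  have herr : Tendsto (fun N : ℕ => B * (2 * δ N + δ N * Real.log N) * (J * (M * Real.pi)) +
      C * (δ N / 2) * J ^ 2) atTop (𝓝 0) := by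
    have a := tendsto_rpow_neg_half
    have b := tendsto_rpow_neg_half_mul_log
    have := ((((a.const_mul 2).add b).const_mul B).mul_const (J * (M * Real.pi))).add
      (((a.div_const 2).const_mul C).mul_const (J ^ 2))
    simpa only [mul_zero, zero_mul, add_zero, zero_div] using this
  refine tendsto_of_tendsto_of_dist tm
    (squeeze_zero' (Eventually.of_forall fun _ => dist_nonneg) ?_ herr)
  filter_upwards [eventually_ge_atTop 1, eventually_ge_atTop N₀] with N hN1 hN0
  have hNpos : (0 : ℝ) < N := by exact_mod_cast hN1
  have hd := hδpos N hN1
  obtain ⟨io, eo⟩ := hΨ.integral_oscKernel hω hα hd N hf₁ hf₂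
  rw [← eo, dist_comm, dist_eq_norm,
    ← integral_sub (hΨ.integrable_mul_partialKernel hω hα hΨ N) io]
  obtain ⟨il, bl⟩ := integral_mul_mul_lorentz_le hΨ.continuous.norm hΨ.hasCompactSupport.norm
    (fun x => norm_nonneg _) hM hd
  have ij : Integrable fun p : ℝ × ℝ => ‖Ψ p.1‖ * ‖Ψ p.2‖ := by
    have := (hΨ.continuous.integrable_of_hasCompactSupport hΨ.hasCompactSupport
      (μ := volume)).norm
    exact this.mul_prod this
  set b := B * (1 + Real.log ((N : ℝ) + 1)) with hb
  set c := C / N * (1 / (2 * δ N)) with hc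
  have hb0 : 0 ≤ b := by
    have := Real.log_nonneg (by linarith : (1 : ℝ) ≤ N + 1)
    positivity
  have hpt : ∀ p : ℝ × ℝ, ‖conj (Ψ p.1) * Ψ p.2 * (partialKernel α ω N p.1 p.2 : ℂ) -
      conj (Ψ p.1) * Ψ p.2 * ((oscKernel α ω N p.1 p.2 / Real.pi *
        ((p.1 - p.2) / ((p.1 - p.2) ^ 2 + δ N ^ 2)) : ℝ) : ℂ)‖
      ≤ b * (‖Ψ p.1‖ * ‖Ψ p.2‖ * (δ N ^ 2 / ((p.1 - p.2) ^ 2 + δ N ^ 2)))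
        + c * (‖Ψ p.1‖ * ‖Ψ p.2‖) := by
    rintro ⟨x, y⟩
    simp only
    rw [← mul_sub, ← Complex.ofReal_sub, norm_mul, norm_mul, RCLike.norm_conj, Complex.norm_real,
      Real.norm_eq_abs]
    by_cases hx : x ∈ tsupport Ψ
    · by_cases hy : y ∈ tsupport Ψ
      · have := abs_kernel_sub_regularized_le hd (h2 x hx y hy N) (h1 x hx y hy N hN0)
        calc _ ≤ ‖Ψ x‖ * ‖Ψ y‖ * (b * (δ N ^ 2 / ((x - y) ^ 2 + δ N ^ 2)) + c) := by gcongr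
          _ = _ := by ring
      · simp [Admissible.eq_zero hy]
    · simp [Admissible.eq_zero hx]
  refine (norm_integral_le_of_norm_le ((il.const_mul b).add (ij.const_mul c))
    (ae_of_all _ hpt)).trans ?_
  simp only [Pi.add_apply]
  rw [integral_add (il.const_mul b) (ij.const_mul c), integral_const_mul, integral_const_mul]
  have ej : ∫ p : ℝ × ℝ, ‖Ψ p.1‖ * ‖Ψ p.2‖ = J ^ 2 := by
    rw [Measure.volume_eq_prod, integral_prod_mul (fun x => ‖Ψ x‖) fun x => ‖Ψ x‖, hJ, sq]
  have hlog : 1 + Real.log ((N : ℝ) + 1) ≤ 2 + Real.log N := by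
    have : Real.log ((N : ℝ) + 1) ≤ Real.log (2 * N) :=
      Real.log_le_log (by positivity) (by linarith [(by exact_mod_cast hN1 : (1 : ℝ) ≤ N)])
    rw [Real.log_mul two_ne_zero hNpos.ne'] at this
    linarith [Real.log_two_lt_d9]
  have hM0 : 0 ≤ M := (norm_nonneg _).trans (hM 0)
  -- Uses δ² = 1/N, so that the error away from the diagonal is also of order δ.
  have hcc : c = C * (δ N / 2) := by
    have : δ N * δ N = 1 / N := by
      simp only [hδ]
      rw [← Real.rpow_add hNpos, one_div (N : ℝ), ← Real.rpow_neg_one]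
      norm_num
    rw [hc, div_eq_mul_one_div C, ← this]
    field_simp
  rw [ej, hcc]
  refine add_le_add ?_ le_rfl
  calc b * _ ≤ b * (J * (M * (Real.pi * δ N))) := by gcongr
    _ = B * (δ N * (1 + Real.log ((N : ℝ) + 1))) * (J * (M * Real.pi)) := by rw [hb]; ring
    _ ≤ B * (δ N * (2 + Real.log N)) * (J * (M * Real.pi)) := by
      have := Real.pi_pos
      gcongr
    _ = _ := by ring

end DeltaLimit
-- The isometry of L² spaces and polarization.
theorem measurePreserving_neg_circle :
    MeasurePreserving (fun x : ℝ => -x) circleMeasure circleMeasure := by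
  have h := (Measure.measurePreserving_neg (volume : Measure ℝ)).restrict_preimage
    (measurableSet_Icc (a := -Real.pi) (b := Real.pi))
  have e : (Neg.neg : ℝ → ℝ) ⁻¹' Set.Icc (-Real.pi) Real.pi = Set.Icc (-Real.pi) Real.pi := by
    ext x
    simp only [Set.mem_preimage, Set.mem_Icc]
    constructor <;> rintro ⟨h1, h2⟩ <;> constructor <;> linarith
  rwa [e] at h

/-- Evenness up to null sets is being fixed by an isometry of L². This closed condition yields
completeness, which the extension by density requires. -/
theorem mem_L2Even_iff (f : Lp ℂ 2 circleMeasure) :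
    f ∈ L2Even ↔ Lp.compMeasurePreserving _ measurePreserving_neg_circle f = f := by
  have hc := Lp.coeFn_compMeasurePreserving f measurePreserving_neg_circle
  have hq := measurePreserving_neg_circle.quasiMeasurePreserving
  constructor
  · rintro ⟨g, hg, e⟩
    refine Lp.ext (hc.trans ?_)
    filter_upwards [e, hq.ae_eq_comp e] with x h1 h2
    rw [h2, h1, Function.comp_apply, hg]
  · intro h
    rw [h] at hc
    -- Averaging repairs a representative that is even only almost everywhere.
    refine ⟨fun x => (f x + f (-x)) / 2, fun x => by simp only [neg_neg, add_comm], ?_⟩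
    filter_upwards [hc] with x hx
    rw [Function.comp_apply] at hx
    rw [← hx]
    ring

theorem isClosed_L2Even : IsClosed (L2Even : Set (Lp ℂ 2 circleMeasure)) := by
  have : (L2Even : Set (Lp ℂ 2 circleMeasure))
      = {f | Lp.compMeasurePreserving _ measurePreserving_neg_circle f = f} :=
    Set.ext mem_L2Even_iff
  rw [this]
  exact isClosed_eq (Lp.isometry_compMeasurePreserving measurePreserving_neg_circle).continuous
    continuous_id

instance : CompleteSpace L2Even := isClosed_L2Even.completeSpace_coe

/-- The admissible functions as a linear space. -/
def admissibleSubmodule (ω : ℝ) : Submodule ℂ (ℝ → ℂ) where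
  carrier := {Ψ | Admissible ω Ψ}
  zero_mem' := ⟨continuous_zero, HasCompactSupport.zero, by
    simp [tsupport, show (0 : ℝ → ℂ) = fun _ => 0 from rfl]⟩
  add_mem' := by
    rintro Ψ Φ hΨ hΦ
    exact ⟨hΨ.continuous.add hΦ.continuous, hΨ.hasCompactSupport.add hΦ.hasCompactSupport,
      (hΨ.disjoint.union_left hΦ.disjoint).mono_left (tsupport_add Ψ Φ)⟩
  smul_mem' := by
    rintro c Ψ hΨ
    exact ⟨hΨ.continuous.const_smul c, hΨ.hasCompactSupport.smul_left (f := fun _ => c),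
      hΨ.disjoint.mono_left (closure_mono (Function.support_const_smul_subset c Ψ))⟩

variable {α ω : ℝ}

/-- The embedding of the admissible functions into `L²(ℝ)`. -/
noncomputable def admissibleToLp (ω : ℝ) :
    admissibleSubmodule ω →ₗ[ℂ] Lp ℂ 2 (volume : Measure ℝ) where
  toFun Ψ := Admissible.memLp Ψ.2 |>.toLp Ψ.1
  map_add' _ _ := rfl
  map_smul' _ _ := rfl

theorem inner_admissibleToLp (Ψ Φ : admissibleSubmodule ω) :
    inner ℂ (admissibleToLp ω Ψ) (admissibleToLp ω Φ) = ∫ E, conj (Ψ.1 E) * Φ.1 E := by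
  rw [L2.inner_def]
  refine integral_congr_ae ?_
  filter_upwards [(Admissible.memLp Ψ.2).coeFn_toLp, (Admissible.memLp Φ.2).coeFn_toLp] with x h1 h2
  have h1' : admissibleToLp ω Ψ x = Ψ.1 x := h1
  have h2' : admissibleToLp ω Φ x = Φ.1 x := h2
  rw [h1', h2', RCLike.inner_apply, mul_comm]

/-- An f orthogonal to all admissible functions integrates to zero against every test function
supported in the open complement of the exceptional set, so it vanishes there almost everywhere; the
exceptional set itself is countable, hence null. -/
theorem denseRange_admissibleToLp (hω : 0 < ω) : DenseRange (admissibleToLp ω) := by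
  have h : (LinearMap.range (admissibleToLp ω)).topologicalClosure = ⊤ := by
    rw [Submodule.topologicalClosure_eq_top_iff, Submodule.eq_bot_iff]
    intro f hf
    have hU := (isClosed_exceptional hω).isOpen_compl
    have h1 : ∀ᵐ x : ℝ, x ∈ (exceptional ω)ᶜ → f x = 0 := by
      refine hU.ae_eq_zero_of_integral_contDiff_smul_eq_zero
        (((Lp.memLp f).locallyIntegrable one_le_two).locallyIntegrableOn _) fun g hg hgc hgs => ?_
      have hΨ : Admissible ω fun x => (g x : ℂ) := by
        refine ⟨Complex.continuous_ofReal.comp hg.continuous, hgc.comp_left Complex.ofReal_zero, ?_⟩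
        refine Set.disjoint_left.2 fun x hx => hgs ?_
        refine closure_mono (fun y hy => ?_) hx
        simpa using hy
      have h2 := hf _ (LinearMap.mem_range_self (admissibleToLp ω) ⟨_, hΨ⟩)
      rw [L2.inner_def] at h2
      rw [← h2]
      refine integral_congr_ae ?_
      filter_upwards [hΨ.memLp.coeFn_toLp] with x hx
      have hx' : admissibleToLp ω ⟨_, hΨ⟩ x = (g x : ℂ) := hx
      rw [hx', RCLike.inner_apply, Complex.conj_ofReal, Complex.real_smul, mul_comm]
    refine Lp.ext ?_
    have h3 : ∀ᵐ x : ℝ, x ∈ (exceptional ω)ᶜ :=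
      measure_eq_zero_iff_ae_notMem.1 ((countable_exceptional ω).measure_zero volume)
    filter_upwards [h1, h3, Lp.coeFn_zero ℂ 2 (volume : Measure ℝ)] with x a b c
    rw [a b, c, Pi.zero_apply]
  have h4 := (Submodule.dense_iff_topologicalClosure_eq_top).2 h
  exact h4

theorem Admissible.memLp_packet (hω : 0 < ω) (hα : ω < α) {Ψ : ℝ → ℂ} (hΨ : Admissible ω Ψ)
    (n : ℕ) : MemLp (packet α ω Ψ n) 2 circleMeasure := by
  have hc := hΨ.continuous_packet hω hα n
  obtain ⟨M, hM⟩ := (isCompact_Icc (a := -Real.pi) (b := Real.pi)).exists_bound_of_continuousOn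
    hc.continuousOn
  exact MemLp.of_bound hc.aestronglyMeasurable M (ae_restrict_of_forall_mem measurableSet_Icc hM)

/-- The components of the image of an admissible function, as elements of `L²₊(𝕊)`. -/
noncomputable def packetLp (hω : 0 < ω) (hα : ω < α) (Ψ : admissibleSubmodule ω) (n : ℕ) : L2Even :=
  ⟨(Admissible.memLp_packet hω hα Ψ.2 n).toLp _, packet α ω Ψ.1 n, packet_neg α ω Ψ.1 n,
    (Admissible.memLp_packet hω hα Ψ.2 n).coeFn_toLp⟩

theorem packetLp_ae_eq (hω : 0 < ω) (hα : ω < α) (Ψ : admissibleSubmodule ω) (n : ℕ) :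
    ((packetLp hω hα Ψ n : L2Even) : Lp ℂ 2 circleMeasure) =ᵐ[circleMeasure] packet α ω Ψ.1 n :=
  (Admissible.memLp_packet hω hα Ψ.2 n).coeFn_toLp

theorem inner_packetLp (hω : 0 < ω) (hα : ω < α) (Ψ Φ : admissibleSubmodule ω) (n : ℕ) :
    inner ℂ (packetLp hω hα Ψ n) (packetLp hω hα Φ n)
      = ∫ p : ℝ × ℝ, conj (Ψ.1 p.1) * Φ.1 p.2 * (P α ω n p.1 p.2 : ℂ) := by
  rw [Admissible.integral_mul_P hω hα Ψ.2 Φ.2, Submodule.coe_inner, L2.inner_def]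
  refine integral_congr_ae ?_
  filter_upwards [packetLp_ae_eq hω hα Ψ n, packetLp_ae_eq hω hα Φ n] with x h1 h2
  rw [h1, h2, RCLike.inner_apply, mul_comm]

/-- The partial sums are the quadratic forms of the partial kernels, whose limit is the squared norm
of Ψ. -/
theorem hasSum_norm_packetLp_sq (hω : 0 < ω) (hα : ω < α) (Ψ : admissibleSubmodule ω) :
    HasSum (fun n => ‖packetLp hω hα Ψ n‖ ^ 2) (‖admissibleToLp ω Ψ‖ ^ 2) := by
  -- The shift by 1 matches `partialKernel`, which has N + 1 terms.
  rw [hasSum_iff_tendsto_nat_of_nonneg fun n => by positivity, ← tendsto_add_atTop_iff_nat 1]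
  have h := Admissible.tendsto_integral_partialKernel hω hα Ψ.2
  have e1 : ((∫ x, ‖Ψ.1 x‖ ^ 2 : ℝ) : ℂ) = ((‖admissibleToLp ω Ψ‖ ^ 2 : ℝ) : ℂ) := by
    have := inner_self_eq_norm_sq_to_K (𝕜 := ℂ) (admissibleToLp ω Ψ)
    rw [inner_admissibleToLp] at this
    rw [← integral_complex_ofReal, Complex.ofReal_pow]
    refine Eq.trans (integral_congr_ae (ae_of_all _ fun x => ?_)) this
    simp only [Complex.conj_mul', Complex.ofReal_pow]
  have e2 : ∀ N : ℕ, ∫ p : ℝ × ℝ, conj (Ψ.1 p.1) * Ψ.1 p.2 * (partialKernel α ω N p.1 p.2 : ℂ)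
      = ((∑ n ∈ Finset.range (N + 1), ‖packetLp hω hα Ψ n‖ ^ 2 : ℝ) : ℂ) := by
    intro N
    simp only [partialKernel, Complex.ofReal_sum, Finset.mul_sum]
    rw [integral_finsetSum _ fun n _ => Admissible.integrable_mul_P hω hα Ψ.2 Ψ.2 n]
    refine Finset.sum_congr rfl fun n _ => ?_
    rw [← inner_packetLp hω hα Ψ Ψ n, Complex.ofReal_pow]
    exact inner_self_eq_norm_sq_to_K (𝕜 := ℂ) (packetLp hω hα Ψ n)
  simp only [e1, e2] at h
  exact (Complex.continuous_re.tendsto _).comp h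

/-- The map `Ψ ↦ (∫ Ψ(E) u_n(·,E) dE)_n` on admissible functions. -/
noncomputable def packetMap (hω : 0 < ω) (hα : ω < α) :
    admissibleSubmodule ω →ₗ[ℂ] lp (fun _ : ℕ => L2Even) 2 where
  toFun Ψ := ⟨packetLp hω hα Ψ, memℓp_gen (by
    simpa using (hasSum_norm_packetLp_sq hω hα Ψ).summable)⟩
  map_add' Ψ Φ := by
    refine lp.ext (funext fun n => Subtype.ext (Lp.ext ?_))
    refine (packetLp_ae_eq hω hα (Ψ + Φ) n).trans (EventuallyEq.trans ?_ (Lp.coeFn_add _ _).symm)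
    filter_upwards [packetLp_ae_eq hω hα Ψ n, packetLp_ae_eq hω hα Φ n] with x h1 h2
    rw [Pi.add_apply, h1, h2]
    simp only [packet]
    rw [← integral_add (Admissible.integrable_mul_u hω hα Ψ.2 n x)
      (Admissible.integrable_mul_u hω hα Φ.2 n x)]
    refine integral_congr_ae (ae_of_all _ fun E => ?_)
    exact add_mul _ _ _
  map_smul' c Ψ := by
    refine lp.ext (funext fun n => Subtype.ext (Lp.ext ?_))
    refine (packetLp_ae_eq hω hα (c • Ψ) n).trans (EventuallyEq.trans ?_ (Lp.coeFn_smul _ _).symm)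
    filter_upwards [packetLp_ae_eq hω hα Ψ n] with x h1
    rw [Pi.smul_apply, RingHom.id_apply, h1, smul_eq_mul]
    simp only [packet]
    rw [← integral_const_mul]
    refine integral_congr_ae (ae_of_all _ fun E => ?_)
    exact mul_assoc _ _ _

theorem norm_packetMap (hω : 0 < ω) (hα : ω < α) (Ψ : admissibleSubmodule ω) :
    ‖packetMap hω hα Ψ‖ = ‖admissibleToLp ω Ψ‖ := by
  have h1 := lp.hasSum_norm (p := 2) (by norm_num) (packetMap hω hα Ψ)
  have h2 := hasSum_norm_packetLp_sq hω hα Ψ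
  simp only [ENNReal.toReal_ofNat, Real.rpow_ofNat] at h1
  have h3 : ‖packetMap hω hα Ψ‖ ^ 2 = ‖admissibleToLp ω Ψ‖ ^ 2 := h1.unique h2
  exact (sq_eq_sq₀ (norm_nonneg _) (norm_nonneg _)).1 h3

theorem extendOfNorm_packetMap (hω : 0 < ω) (hα : ω < α) (Ψ : admissibleSubmodule ω) :
    (packetMap hω hα).extendOfNorm (admissibleToLp ω) (admissibleToLp ω Ψ) = packetMap hω hα Ψ :=
  LinearMap.extendOfNorm_eq (denseRange_admissibleToLp hω)
    ⟨1, fun Ψ => by rw [norm_packetMap, one_mul]⟩ Ψ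

/-- The isometric extension of `packetMap` to `L²(ℝ)`. -/
noncomputable def packetIsometry (hω : 0 < ω) (hα : ω < α) :
    Lp ℂ 2 (volume : Measure ℝ) →ₗᵢ[ℂ] lp (fun _ : ℕ => L2Even) 2 where
  toLinearMap := ((packetMap hω hα).extendOfNorm (admissibleToLp ω)).toLinearMap
  norm_map' f := by
    refine congrFun ((denseRange_admissibleToLp hω).equalizer
      (g := fun f => ‖(packetMap hω hα).extendOfNorm (admissibleToLp ω) f‖) (h := fun f => ‖f‖)
      (by fun_prop) continuous_norm (funext fun Ψ => ?_)) f
    simp only [Function.comp_apply]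
    rw [extendOfNorm_packetMap, norm_packetMap]

theorem packetIsometry_apply (hω : 0 < ω) (hα : ω < α) (Ψ : admissibleSubmodule ω) :
    packetIsometry hω hα (admissibleToLp ω Ψ) = packetMap hω hα Ψ :=
  extendOfNorm_packetMap hω hα Ψ

/-- Polarization: only the diagonal case was proved analytically, but a linear isometry preserves
inner products, and the inner product in ℓ² is the sum over levels. For complex series `HasSum`
includes absolute convergence. -/
theorem hasSum_integral_mul_P (hω : 0 < ω) (hα : ω < α) {Ψ Φ : ℝ → ℂ} (hΨ : Admissible ω Ψ)
    (hΦ : Admissible ω Φ) :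
    HasSum (fun n : ℕ => ∫ p : ℝ × ℝ, conj (Ψ p.1) * Φ p.2 * (P α ω n p.1 p.2 : ℂ))
      (∫ E : ℝ, conj (Ψ E) * Φ E) := by
  have h := lp.hasSum_inner (𝕜 := ℂ) (packetMap hω hα ⟨Ψ, hΨ⟩) (packetMap hω hα ⟨Φ, hΦ⟩)
  rw [← packetIsometry_apply, ← packetIsometry_apply, LinearIsometry.inner_map_map,
    inner_admissibleToLp, packetIsometry_apply, packetIsometry_apply] at h
  exact h.congr_fun fun n => (inner_packetLp hω hα ⟨Ψ, hΨ⟩ ⟨Φ, hΦ⟩ n).symm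

theorem existsUnique_isometry (hω : 0 < ω) (hα : ω < α) :
    ∃! J : Lp ℂ 2 (volume : Measure ℝ) →ₗᵢ[ℂ] lp (fun _ : ℕ => L2Even) 2,
      ∀ (Ψ : ℝ → ℂ) (hΨ : Admissible ω Ψ) (n : ℕ),
        ((J (hΨ.memLp.toLp Ψ) n : L2Even) : Lp ℂ 2 circleMeasure)
          =ᵐ[circleMeasure] fun x => ∫ E : ℝ, Ψ E * (u α ω n x E : ℂ) := by
  refine ⟨packetIsometry hω hα, fun Ψ hΨ n => ?_, fun J hJ => ?_⟩
  · have h := packetIsometry_apply hω hα ⟨Ψ, hΨ⟩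
    change packetIsometry hω hα (hΨ.memLp.toLp Ψ) = _ at h
    rw [h]
    exact packetLp_ae_eq hω hα ⟨Ψ, hΨ⟩ n
  · refine LinearIsometry.ext fun f => congrFun ((denseRange_admissibleToLp hω).equalizer
      J.continuous (packetIsometry hω hα).continuous (funext fun Ψ => ?_)) f
    rw [Function.comp_apply, Function.comp_apply, packetIsometry_apply]
    refine lp.ext (funext fun n => Subtype.ext (Lp.ext ?_))
    exact (hJ Ψ.1 Ψ.2 n).trans (packetLp_ae_eq hω hα Ψ n).symm

end Smilansky

theorem mainTheorem8 (α ω : ℝ) (hω : 0 < ω) (hα : ω < α) :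
    -- for non-exceptional energies the formal eigenfunctions are well defined
    (∀ E : ℝ, E ∉ Smilansky.exceptional ω →
      (∃! D : ℕ → ℂ, Smilansky.IsNormalSolution α ω E D) ∧
      (∃! z : ℂ, Smilansky.IsAmplitude α ω E z) ∧
      Smilansky.IsFormalEigenfunction α ω E (fun n x => Smilansky.u α ω n x E)) ∧
    -- the delta-normalization
    (∀ Ψ Φ : ℝ → ℂ, Smilansky.Admissible ω Ψ → Smilansky.Admissible ω Φ →
      (∀ n : ℕ, Integrable (fun p : ℝ × ℝ =>
        conj (Ψ p.1) * Φ p.2 * (Smilansky.P α ω n p.1 p.2 : ℂ))) ∧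
      HasSum (fun n : ℕ => ∫ p : ℝ × ℝ,
          conj (Ψ p.1) * Φ p.2 * (Smilansky.P α ω n p.1 p.2 : ℂ))
        (∫ E : ℝ, conj (Ψ E) * Φ E)) ∧
    -- the map `Ψ ↦ (∫ Ψ(E) u_n(·,E) dE)_n` is isometric and extends uniquely to an isometry
    (∀ Ψ : ℝ → ℂ, Smilansky.Admissible ω Ψ → ∀ (n : ℕ) (x : ℝ),
      Integrable (fun E : ℝ => Ψ E * (Smilansky.u α ω n x E : ℂ))) ∧
    (∃! J : Lp ℂ 2 (volume : Measure ℝ) →ₗᵢ[ℂ] lp (fun _ : ℕ => Smilansky.L2Even) 2,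
      ∀ (Ψ : ℝ → ℂ) (hΨ : Smilansky.Admissible ω Ψ) (n : ℕ),
        ((J (hΨ.memLp.toLp Ψ) n : Smilansky.L2Even) : Lp ℂ 2 Smilansky.circleMeasure)
          =ᵐ[Smilansky.circleMeasure]
            fun x => ∫ E : ℝ, Ψ E * (Smilansky.u α ω n x E : ℂ)) := by
  exact ⟨fun E hE => Smilansky.eigenfunctions_well_defined hω hα hE,
    fun Ψ Φ hΨ hΦ => ⟨fun n => hΨ.integrable_mul_P hω hα hΦ n,
      Smilansky.hasSum_integral_mul_P hω hα hΨ hΦ⟩,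
    fun Ψ hΨ n x => hΨ.integrable_mul_u hω hα n x,
    Smilansky.existsUnique_isometry hω hα⟩
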